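/- Let $B$ be a connected building set on $[n+1]=\{1,\dots,n+1\}$: a set of non-empty subsets of $[n+1]$ that contains all singletons and $[n+1]$ itself, and contains $T\cup U$ whenever $T,U\in B$ and $T\cap U\neq\varnothing$. For $S\in B$ put $B|_S=\{T\in B: T\subseteq S\}$, a connected building set on $S$. Let $P_B=\sum_{T\in B}\mathrm{conv}(e_i: i\in T)\subset\mathbb R^{n+1}$ (Minkowski sum) be the nestohedron, which is not assumed to be flag, and $P_{B|_S}\subset\mathbb R^{S}\subset\mathbb R^{n+1}$ that of $B|_S$. For a simple polytope $P$ with facets $F_1,\dots,F_m$ let $K_P=\{\sigma\subseteq[m]:\bigcap_{i\in\sigma}F_i\ne\varnothing\}$ be its nerve complex (the empty intersection being $P$), let $\mathcal Z_P=(T^m\times P)/\!\sim$ be its moment-angle manifold, where $T=S^1$ and $(t,p)\sim(s,q)$ iff $p=q$ and $t_i=s_i$ for all $i$ with $p\notin F_i$, and for a simplicial complex $K$ on $[m]$ let $\mathcal Z_K=\bigcup_{\sigma\in K}(D^2,S^1)^\sigma\subset\mathbb C^m$ be its moment-angle-complex. Call a homeomorphism $h:\mathcal Z_P\to\mathcal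 Z_{K_P}$ canonical if it has the form $h[t,p]=t\cdot c(p)$ for a map $c:P\to[0,1]^m$ (in particular it is $T^m$-equivariant). Write $N_B=K_{P_B}$. **Proposition.** Let $S\in B$, $S\ne[n+1]$. 1. $T\mapsto F_T=\{x\in P_B:\sum_{i\in T}x_i\text{ is minimal}\}$ is a bijection from $B\setminus\{[n+1]\}$ onto the set of facets of $P_B$; the same holds for $B|_S\setminus\{S\}$ and $P_{B|_S}$. With these labels, the inclusion $B|_S\setminus\{S\}\subset B\setminus\{[n+1]\}$ identifies $N_{B|_S}$ with a full subcomplex of $N_B$. 2. There is a vector $v\in\mathbb R^{[n+1]\setminus S}$ such that $v+P_{B|_S}$ is a face of $P_B$. For every such $v$ and every $T\in B|_S\setminus\{S\}$, the facet of the face $v+P_{B|_S}$ that corresponds to $T$ is the intersection of this face with the facet of $P_B$ labelled by $T$, and with no other facet of $P_B$. Hence $x\mapsto v+x$ induces a map $\hat\phi_S:\mathcal Z_{P_{B|_S}}\to\mathcal Z_{P_B}$, $[t,p]\mapsto[t',v+p]$, where $t'_T=t_T$ for $T\in B|_S\setminus\{S\}$ and $t'_T=1$ for all other $T$. 3. For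 every such $v$ there are homeomorphisms $h_1:\mathcal Z_{P_{B|_S}}\to\mathcal Z_{N_{B|_S}}$ and $h_2:\mathcal Z_{P_B}\to\mathcal Z_{N_B}$ with $$h_2\circ\hat\phi_S=j_{S*}\circ h_1,$$ where $j_{S*}:\mathcal Z_{N_{B|_S}}\to\mathcal Z_{N_B}$ is the map induced by the inclusion of the full subcomplex (it sets the remaining coordinates equal to $1$). Moreover, $h_1$ can be taken canonical and $h_2$ homotopic to a canonical homeomorphism; so the square formed with these two canonical homeomorphisms commutes up to homotopy. 4. For every such $v$ and every commutative ring $R$, the map $\hat\phi_S^*:H^*(\mathcal Z_{P_B};R)\to H^*(\mathcal Z_{P_{B|_S}};R)$ is a split epimorphism of graded rings: it has a right inverse that is a homomorphism of graded unital $R$-algebras. -/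

import Mathlib

open Set
open scoped Pointwise

noncomputable section

universe u v

namespace NestoMA

/-! ### Singular cohomology and its cup product -/

section Cohomology

/-- Singular `n`-simplices of `X`. -/
abbrev Sing (X : Type v) [TopologicalSpace X] (n : ℕ) : Type v :=
  C(stdSimplex ℝ (Fin (n + 1)), X)

variable {X Y : Type v} [TopologicalSpace X] [TopologicalSpace Y]

/-- Precomposition of a singular simplex with the affine map that is given on vertices by `α`. -/
def Sing.pull {m n : ℕ} (α : Fin (m + 1) → Fin (n + 1)) (σ : Sing X n) : Sing X m :=
  σ.comp ⟨stdSimplex.map α, stdSimplex.continuous_map α⟩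

/-- The `i`-th face of a singular simplex. -/
def Sing.face {n : ℕ} (i : Fin (n + 2)) (σ : Sing X (n + 1)) : Sing X n := σ.pull i.succAbove

/-- The front `p`-face of a singular `(p+q)`-simplex. -/
def Sing.front {p q : ℕ} (σ : Sing X (p + q)) : Sing X p :=
  σ.pull fun i : Fin (p + 1) => (⟨i, by omega⟩ : Fin (p + q + 1))

/-- The back `q`-face of a singular `(p+q)`-simplex. -/
def Sing.back {p q : ℕ} (σ : Sing X (p + q)) : Sing X q :=
  σ.pull fun i : Fin (q + 1) => (⟨p + i, by omega⟩ : Fin (p + q + 1))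

lemma Sing.pull_pull {l m n : ℕ} (α : Fin (m + 1) → Fin (n + 1)) (β : Fin (l + 1) → Fin (m + 1))
    (σ : Sing X n) : (σ.pull α).pull β = σ.pull (α ∘ β) := by
  ext x
  simp only [Sing.pull, ContinuousMap.comp_apply, ContinuousMap.coe_mk]
  rw [stdSimplex.map_comp_apply]

lemma Sing.pull_id {n : ℕ} (σ : Sing X n) : σ.pull id = σ := by
  ext x
  simp [Sing.pull]

variable (R : Type u) [CommRing R]

/-- Singular `n`-cochains with coefficients in `R`. -/
abbrev Cochain (X : Type v) [TopologicalSpace X] (n : ℕ) := Sing X n → R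

variable (X) in
/-- The coboundary: `(d f)(σ) = ∑ i, (-1) ^ i * f (∂ᵢ σ)`. -/
def d (n : ℕ) : Cochain R X n →ₗ[R] Cochain R X (n + 1) where
  toFun f σ := ∑ i : Fin (n + 2), (-1) ^ (i : ℕ) * f (σ.face i)
  map_add' f g := by
    funext σ
    simp [mul_add, Finset.sum_add_distrib]
  map_smul' c f := by
    funext σ
    simp only [Pi.smul_apply, smul_eq_mul, RingHom.id_apply, Finset.mul_sum]
    exact Finset.sum_congr rfl fun i _ => by ring

variable (X) in
/-- Singular cocycles. -/
abbrev cocycles (n : ℕ) : Submodule R (Cochain R X n) := LinearMap.ker (d X R n)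

variable (X) in
/-- Singular coboundaries. -/
def coboundaries : (n : ℕ) → Submodule R (Cochain R X n)
  | 0 => ⊥
  | n + 1 => LinearMap.range (d X R n)

variable (X) in
/-- Singular cohomology `H^n(X; R)`. -/
abbrev Cohomology (n : ℕ) : Type _ :=
  (cocycles X R n) ⧸ (coboundaries X R n).submoduleOf (cocycles X R n)

variable {R}

/-- The class of a cocycle. -/
def cls {n : ℕ} (f : cocycles X R n) : Cohomology X R n :=
  Submodule.Quotient.mk f

/-- The cup product of cochains. -/
def cupCochain {p q : ℕ} (f : Cochain R X p) (g : Cochain R X q) : Cochain R X (p + q) :=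
  fun σ => f σ.front * g σ.back

lemma mem_coboundaries {n m : ℕ} (h : m + 1 = n) (f : Cochain R X n) (g : Cochain R X m)
    (hfg : ∀ σ : Sing X n, f σ = d X R m g (σ.pull (Fin.cast (by omega)))) :
    f ∈ coboundaries X R n := by
  subst h
  refine ⟨g, funext fun σ => ?_⟩
  rw [hfg σ]
  exact congrArg _ (Sing.pull_id σ).symm

/-- The Leibniz rule, evaluated on a simplex. -/
lemma leibniz {p q : ℕ} (f : Cochain R X p) (g : Cochain R X q) (σ : Sing X (p + q + 1)) :
    d X R (p + q) (cupCochain f g) σ =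
      d X R p f (σ.pull fun i => ⟨i, by omega⟩) * g (σ.pull fun i => ⟨p + 1 + i, by omega⟩) +
      (-1) ^ p * (f (σ.pull fun i => ⟨i, by omega⟩) *
        d X R q g (σ.pull fun i => ⟨p + i, by omega⟩)) := by
  let a : ℕ → R := fun i => f (σ.pull fun k => ⟨if (k : ℕ) < i then (k : ℕ) else k + 1, by grind⟩)
  let b : ℕ → R := fun i => g (σ.pull fun k => ⟨p + if (k : ℕ) < i then (k : ℕ) else k + 1, by grind⟩)
  have hsucc : ∀ {n : ℕ} (i : Fin (n + 1)) (k : Fin n),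
      ((i.succAbove k : Fin (n + 1)) : ℕ) = if (k : ℕ) < i then (k : ℕ) else k + 1 := by
    intro n i k
    simp only [Fin.succAbove, Fin.lt_def, Fin.val_castSucc]
    split_ifs <;> simp
  have h1 : d X R p f (σ.pull fun i => ⟨i, by omega⟩) =
      ∑ i ∈ Finset.range (p + 2), (-1) ^ i * a i := by
    rw [Finset.sum_range]
    simp only [d, LinearMap.coe_mk, AddHom.coe_mk]
    refine Finset.sum_congr rfl fun i _ => ?_
    simp only [Sing.face, Sing.pull_pull, a]
    congr 3
    funext k
    simp [hsucc]
  have h2 : d X R q g (σ.pull fun i => ⟨p + i, by omega⟩) =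
      ∑ i ∈ Finset.range (q + 2), (-1) ^ i * b i := by
    rw [Finset.sum_range]
    simp only [d, LinearMap.coe_mk, AddHom.coe_mk]
    refine Finset.sum_congr rfl fun i _ => ?_
    simp only [Sing.face, Sing.pull_pull, b]
    congr 3
    funext k
    simp [hsucc]
  have h3 : g (σ.pull fun i => ⟨p + 1 + i, by omega⟩) = b 0 := by
    simp only [b]
    congr 2
    funext k
    simp [Fin.ext_iff]
    omega
  have h4 : f (σ.pull fun i => ⟨i, by omega⟩) = a (p + 1) := by
    simp only [a]
    congr 2
    funext k
    simp [Fin.ext_iff]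
    omega
  have h5 : d X R (p + q) (cupCochain f g) σ =
      ∑ i ∈ Finset.range (p + 1 + (q + 1)),
        (-1) ^ i * (a (min i (p + 1)) * b (i - p)) := by
    rw [show p + 1 + (q + 1) = p + q + 2 by ring, Finset.sum_range]
    simp only [d, LinearMap.coe_mk, AddHom.coe_mk]
    refine Finset.sum_congr rfl fun i _ => ?_
    simp only [cupCochain, Sing.front, Sing.back, Sing.face, Sing.pull_pull, a, b]
    congr 4
    · funext k
      simp only [Function.comp, Fin.ext_iff, hsucc]
      grind
    · funext k
      simp only [Function.comp, Fin.ext_iff, hsucc]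
      grind
  rw [h1, h2, h3, h4, h5, Finset.sum_range_add, Finset.sum_range_succ _ (p + 1),
    Finset.sum_range_succ' _ (q + 1), add_mul, Finset.sum_mul, mul_add, mul_add]
  have e1 : ∀ i ∈ Finset.range (p + 1), (-1 : R) ^ i * (a (min i (p + 1)) * b (i - p)) =
      (-1) ^ i * a i * b 0 := by
    intro i hi
    have := Finset.mem_range.1 hi
    rw [min_eq_left (by omega), Nat.sub_eq_zero_of_le (by omega)]
    ring
  have e2 : ∀ j ∈ Finset.range (q + 1),
      (-1 : R) ^ (p + 1 + j) * (a (min (p + 1 + j) (p + 1)) * b (p + 1 + j - p)) =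
      (-1) ^ p * (a (p + 1) * ((-1) ^ (j + 1) * b (j + 1))) := by
    intro j _
    rw [min_eq_right (by omega), show p + 1 + j - p = j + 1 by omega]
    ring
  rw [Finset.sum_congr rfl e1, Finset.sum_congr rfl e2, Finset.mul_sum, Finset.mul_sum]
  ring

/-- The cup product of cocycles. -/
def cupCocycle {p q : ℕ} (f : cocycles X R p) (g : cocycles X R q) : cocycles X R (p + q) :=
  ⟨cupCochain f.1 g.1, by
    rw [LinearMap.mem_ker]
    funext σ
    rw [leibniz, LinearMap.mem_ker.1 f.2, LinearMap.mem_ker.1 g.2]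
    simp⟩

lemma cup_left_coboundary {p q : ℕ} {f : Cochain R X p} (hf : f ∈ coboundaries X R p)
    (g : cocycles X R q) : cupCochain f g.1 ∈ coboundaries X R (p + q) := by
  cases p with
  | zero =>
    have : f = 0 := hf
    subst this
    have h0 : cupCochain (0 : Cochain R X 0) g.1 = 0 := by
      funext σ
      simp [cupCochain]
    rw [h0]
    exact Submodule.zero_mem _
  | succ p =>
    obtain ⟨f, rfl⟩ := hf
    refine mem_coboundaries (m := p + q) (by omega) _ (cupCochain f g.1) fun σ => ?_
    rw [leibniz, LinearMap.mem_ker.1 g.2]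
    simp only [cupCochain, Sing.front, Sing.back, Sing.pull_pull, Pi.zero_apply, mul_zero,
      add_zero]
    rfl

lemma cup_right_coboundary {p q : ℕ} (f : cocycles X R p) {g : Cochain R X q}
    (hg : g ∈ coboundaries X R q) : cupCochain f.1 g ∈ coboundaries X R (p + q) := by
  cases q with
  | zero =>
    have : g = 0 := hg
    subst this
    have h0 : cupCochain f.1 (0 : Cochain R X 0) = 0 := by
      funext σ
      simp [cupCochain]
    rw [h0]
    exact Submodule.zero_mem _
  | succ q =>
    obtain ⟨g, rfl⟩ := hg
    refine mem_coboundaries (m := p + q) (by omega) _ ((-1 : R) ^ p • cupCochain f.1 g)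
      fun σ => ?_
    rw [map_smul, Pi.smul_apply, leibniz, LinearMap.mem_ker.1 f.2]
    simp only [cupCochain, Sing.front, Sing.back, Sing.pull_pull, Pi.zero_apply, zero_mul,
      zero_add, smul_eq_mul, ← mul_assoc, ← mul_pow, neg_one_mul, neg_neg, one_pow, one_mul]
    rfl

/-- The cup product on singular cohomology. -/
def cup {p q : ℕ} (x : Cohomology X R p) (y : Cohomology X R q) : Cohomology X R (p + q) :=
  Quotient.liftOn₂ x y (fun f g => cls (cupCocycle f g)) (by
    intro f g f' g' hf hg
    have hf' : (f - f').1 ∈ coboundaries X R p :=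
      (Submodule.quotientRel_def ((coboundaries X R p).submoduleOf (cocycles X R p))).1 hf
    have hg' : (g - g').1 ∈ coboundaries X R q :=
      (Submodule.quotientRel_def ((coboundaries X R q).submoduleOf (cocycles X R q))).1 hg
    refine (Submodule.Quotient.eq _).2 ?_
    change cupCochain f.1 g.1 - cupCochain f'.1 g'.1 ∈ coboundaries X R (p + q)
    have : cupCochain f.1 g.1 - cupCochain f'.1 g'.1 =
        cupCochain (f - f').1 g.1 + cupCochain f'.1 (g - g').1 := by
      funext σ
      simp only [cupCochain, Pi.sub_apply, Pi.add_apply, Submodule.coe_sub]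
      ring
    rw [this]
    exact Submodule.add_mem _ (cup_left_coboundary hf' g) (cup_right_coboundary f' hg'))

variable (X R) in
/-- The unit of the cohomology ring: the class of the constant cochain `1`. -/
def one : Cohomology X R 0 :=
  cls ⟨fun _ => 1, by
    rw [LinearMap.mem_ker]
    funext σ
    simp [d, Fin.sum_univ_two]⟩

variable (R) in
/-- Composition with a continuous map, on cochains. -/
def pullCochain (φ : C(X, Y)) (n : ℕ) : Cochain R Y n →ₗ[R] Cochain R X n where
  toFun f σ := f (φ.comp σ)
  map_add' _ _ := rfl
  map_smul' _ _ := rfl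

lemma d_pullCochain (φ : C(X, Y)) (n : ℕ) (f : Cochain R Y n) :
    d X R n (pullCochain R φ n f) = pullCochain R φ (n + 1) (d Y R n f) := rfl

variable (R) in
/-- Composition with a continuous map, on cocycles. -/
def pullCocycle (φ : C(X, Y)) (n : ℕ) : cocycles Y R n →ₗ[R] cocycles X R n :=
  (pullCochain R φ n).restrict fun f hf => by
    rw [LinearMap.mem_ker, d_pullCochain, LinearMap.mem_ker.1 hf, map_zero]

variable (R) in
/-- The map `φ^* : H^n(Y; R) → H^n(X; R)` induced by a continuous map `φ : X → Y`. -/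
def pullback (φ : C(X, Y)) (n : ℕ) : Cohomology Y R n →ₗ[R] Cohomology X R n :=
  Submodule.mapQ _ _ (pullCocycle R φ n) (by
    intro f hf
    change pullCochain R φ n f.1 ∈ coboundaries X R n
    have hf' : f.1 ∈ coboundaries Y R n := hf
    cases n with
    | zero =>
      have h0 : f.1 = 0 := hf'
      rw [h0, map_zero]
      exact Submodule.zero_mem _
    | succ n =>
      obtain ⟨g, hg⟩ := hf'
      rw [← hg, ← d_pullCochain]
      exact ⟨_, rfl⟩)

/-- Induced maps in cohomology are multiplicative. -/
lemma pullback_cup (φ : C(X, Y)) {p q : ℕ} (x : Cohomology Y R p) (y : Cohomology Y R q) :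
    pullback R φ (p + q) (cup x y) = cup (pullback R φ p x) (pullback R φ q y) := by
  obtain ⟨f, rfl⟩ := Submodule.Quotient.mk_surjective _ x
  obtain ⟨g, rfl⟩ := Submodule.Quotient.mk_surjective _ y
  rfl

/-- Induced maps in cohomology are unital. -/
lemma pullback_one (φ : C(X, Y)) : pullback R φ 0 (one Y R) = one X R := rfl

variable (R) in
/-- `φ^* : H^*(Y; R) → H^*(X; R)` is a split epimorphism of graded rings: it has a right inverse
that is a homomorphism of graded unital `R`-algebras. -/
def IsSplitEpiInCohomology (φ : C(X, Y)) : Prop :=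
  ∃ s : ∀ q : ℕ, Cohomology X R q →ₗ[R] Cohomology Y R q,
    (∀ q x, pullback R φ q (s q x) = x) ∧
    s 0 (one X R) = one Y R ∧
    ∀ p q (x : Cohomology X R p) (y : Cohomology X R q),
      s (p + q) (cup x y) = cup (s p x) (s q y)

end Cohomology

/-! ### Moment-angle complexes and moment-angle manifolds -/

section MomentAngle

variable {ι κ : Type}

/-- The moment-angle-complex `⋃_{σ ∈ K} (D², S¹)^σ ⊆ ℂ^ι` of a simplicial complex `K` with vertices
in `ι`, which is given as its set of simplices (the empty one included). -/
def momentAngleComplex (K : Set (Finset ι)) : Set (ι → ℂ) :=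
  {z | ∃ σ ∈ K, ∀ i, (i ∈ σ → ‖z i‖ ≤ 1) ∧ (i ∉ σ → ‖z i‖ = 1)}

/-- The map of moment-angle-complexes induced by an injective simplicial map: the coordinates
outside the image of `f` are set to be `1`. -/
def momentAngleComplexMap {K : Set (Finset ι)} {L : Set (Finset κ)} (f : ι ↪ κ)
    (hf : ∀ σ ∈ K, σ.map f ∈ L) (z : momentAngleComplex K) : momentAngleComplex L :=
  ⟨Function.extend f z.1 1, by
    obtain ⟨σ, hσ, hz⟩ := z.2
    refine ⟨σ.map f, hf σ hσ, fun k => ?_⟩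
    by_cases hk : ∃ i, f i = k
    · obtain ⟨i, rfl⟩ := hk
      simpa [f.injective.extend_apply] using hz i
    · simp [Function.extend_apply' _ _ _ hk]⟩

variable {E : Type} [TopologicalSpace E]

/-- The nerve complex of a polytope `P` with facets `F i`: a set of facets is a simplex if these
facets have a common point in `P`. -/
def nerveComplex (P : Set E) (F : ι → Set E) : Set (Finset ι) :=
  {σ | ∃ x ∈ P, ∀ i ∈ σ, x ∈ F i}

/-- The relation on `T^ι × P` whose quotient is the moment-angle manifold: `(t, p) ∼ (s, q)` iff
`p = q` and `t s⁻¹` lies in the coordinate subtorus of those facets that contain `p`. -/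
def momentAngleSetoid (P : Set E) (F : ι → Set E) : Setoid ((ι → Circle) × P) where
  r a b := a.2 = b.2 ∧ ∀ i, (a.2 : E) ∉ F i → a.1 i = b.1 i
  iseqv :=
    { refl := fun _ => ⟨rfl, fun _ _ => rfl⟩
      symm := fun h => ⟨h.1.symm, fun i hi => (h.2 i (h.1 ▸ hi)).symm⟩
      trans := fun h h' => ⟨h.1.trans h'.1, fun i hi => (h.2 i hi).trans (h'.2 i (h.1 ▸ hi))⟩ }

/-- The moment-angle manifold `T^ι × P / ∼` of a polytope `P` with facets `F i`, `i : ι`. -/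
def MomentAngleManifold (P : Set E) (F : ι → Set E) : Type := Quotient (momentAngleSetoid P F)

instance (P : Set E) (F : ι → Set E) : TopologicalSpace (MomentAngleManifold P F) :=
  inferInstanceAs (TopologicalSpace (Quotient (momentAngleSetoid P F)))

/-- The point `[t, p]` of the moment-angle manifold. -/
def MomentAngleManifold.mk {P : Set E} {F : ι → Set E} (t : ι → Circle) (p : P) :
    MomentAngleManifold P F :=
  Quotient.mk (momentAngleSetoid P F) (t, p)

/-- A map from the moment-angle manifold of `P` to the moment-angle-complex of its nerve complex
is in canonical form if it is `T^ι`-equivariant and is induced by a map `c` of `P` to the cube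
`[0, 1]^ι`, that is, `[t, p] ↦ t • c p`. -/
def IsCanonicalForm {P : Set E} {F : ι → Set E}
    (h : MomentAngleManifold P F → momentAngleComplex (nerveComplex P F)) : Prop :=
  ∃ c : P → ι → ℝ, (∀ p i, c p i ∈ Icc (0 : ℝ) 1) ∧
    ∀ t p i, (h (MomentAngleManifold.mk t p)).1 i = (t i : ℂ) * (c p i : ℂ)

variable [AddCommGroup E] [Module ℝ E]

/-- A facet of a convex set: a maximal element among the non-empty proper exposed faces. -/
def IsFacet (P G : Set E) : Prop :=
  Maximal (fun G => IsExposed ℝ P G ∧ G.Nonempty ∧ G ≠ P) G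

/-- The translation by `v` embeds the polytope `P` with facets `F i`, `i : ι`, as a face of the
polytope `Q` with facets `G k`, `k : κ`, and for every `i : ι` the facet `F i` of this face is cut
out by the facet `G (f i)` of `Q` and by no other facet of `Q`. -/
structure IsFaceEmbedding (P : Set E) (F : ι → Set E) (Q : Set E) (G : κ → Set E) (v : E)
    (f : ι ↪ κ) : Prop where
  exposed : IsExposed ℝ Q ((fun x => v + x) '' P)
  facet_iff : ∀ i k, (fun x => v + x) '' F i = (fun x => v + x) '' P ∩ G k ↔ k = f i

variable {P Q : Set E} {F : ι → Set E} {G : κ → Set E} {v : E} {f : ι ↪ κ}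

lemma IsFaceEmbedding.mem (hf : IsFaceEmbedding P F Q G v f) {x : E} (hx : x ∈ P) : v + x ∈ Q :=
  hf.exposed.subset ⟨x, hx, rfl⟩

lemma IsFaceEmbedding.mem_facet (hf : IsFaceEmbedding P F Q G v f) {x : E} {i : ι}
    (hx : x ∈ F i) : v + x ∈ G (f i) := by
  have h := (hf.facet_iff i (f i)).2 rfl
  have hx' : v + x ∈ (fun x => v + x) '' F i := ⟨x, hx, rfl⟩
  rw [h] at hx'
  exact hx'.2

lemma IsFaceEmbedding.map_mem (hf : IsFaceEmbedding P F Q G v f) :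
    ∀ σ ∈ nerveComplex P F, σ.map f ∈ nerveComplex Q G := by
  rintro σ ⟨x, hx, h⟩
  refine ⟨v + x, hf.mem hx, fun k hk => ?_⟩
  obtain ⟨i, hi, rfl⟩ := Finset.mem_map.1 hk
  exact hf.mem_facet (h i hi)

/-- The map of moment-angle manifolds induced by a face embedding: `[t, p] ↦ [t', v + p]`, where
`t'` has the coordinate `t i` at the facet `f i`, and the coordinate `1` elsewhere. -/
def momentAngleManifoldMap [ContinuousAdd E] (hf : IsFaceEmbedding P F Q G v f) :
    C(MomentAngleManifold P F, MomentAngleManifold Q G) where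
  toFun := Quotient.map
    (fun a : (ι → Circle) × P =>
      ((Function.extend f a.1 1, ⟨v + a.2, hf.mem a.2.2⟩) : (κ → Circle) × Q))
    (by
      rintro ⟨t, p⟩ ⟨s, q⟩ ⟨h, h'⟩
      obtain rfl : p = q := h
      refine ⟨rfl, fun k hk => ?_⟩
      by_cases hk' : ∃ i, f i = k
      · obtain ⟨i, rfl⟩ := hk'
        have hi := h' i fun hp => hk (hf.mem_facet hp)
        simpa [f.injective.extend_apply] using hi
      · simp [Function.extend_apply' _ _ _ hk'])
  continuous_toFun := by
    refine Continuous.quotient_map' (Continuous.prodMk ?_ ?_) _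
    · refine continuous_pi fun k => ?_
      by_cases hk : ∃ i, f i = k
      · obtain ⟨i, rfl⟩ := hk
        simp only [f.injective.extend_apply]
        fun_prop
      · simp only [Function.extend_apply' _ _ _ hk]
        fun_prop
    · fun_prop

end MomentAngle

/-! ### Building sets and nestohedra -/

section Nestohedra

variable {α : Type} [DecidableEq α]

/-- Building sets on a finite set `V`; their elements are non-empty subsets of `V`. -/
structure IsBuildingSet (V : Finset α) (B : Finset (Finset α)) : Prop where
  subset : ∀ T ∈ B, T ⊆ V
  nonempty : ∀ T ∈ B, T.Nonempty
  singleton_mem : ∀ i ∈ V, {i} ∈ B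
  union_mem : ∀ T ∈ B, ∀ U ∈ B, (T ∩ U).Nonempty → T ∪ U ∈ B

/-- The restriction `B|_S`, a building set on `S`. -/
def restrict (B : Finset (Finset α)) (S : Finset α) : Finset (Finset α) := {T ∈ B | T ⊆ S}

/-- The nestohedron `P_B`: the Minkowski sum of the simplices `conv (e_i | i ∈ T)`, `T ∈ B`. For a
building set on a subset `V` of `α`, it lies in the coordinate subspace `ℝ^V` of `ℝ^α`. -/
def nestohedron (B : Finset (Finset α)) : Set (α → ℝ) :=
  ∑ T ∈ B, convexHull ℝ ((fun i => (Pi.single i 1 : α → ℝ)) '' (T : Set α))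

/-- The facet `F_T` of `P_B`: the points of `P_B` where `∑ i ∈ T, x i` is minimal. -/
def facet (B : Finset (Finset α)) (T : Finset α) : Set (α → ℝ) :=
  {x ∈ nestohedron B | ∀ y ∈ nestohedron B, ∑ i ∈ T, x i ≤ ∑ i ∈ T, y i}

/-- The non-maximal elements of a connected building set on `V`; they label the facets. -/
abbrev NonMax (V : Finset α) (B : Finset (Finset α)) : Type := {T : Finset α // T ∈ B ∧ T ≠ V}

/-- The facets of `P_B`, for a connected building set `B` on `V`. -/
abbrev facets (V : Finset α) (B : Finset (Finset α)) : NonMax V B → Set (α → ℝ) :=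
  fun T => facet B T.1

/-- The nested set complex `N_B`: the nerve complex of `P_B`. -/
abbrev nestedSetComplex (V : Finset α) (B : Finset (Finset α)) : Set (Finset (NonMax V B)) :=
  nerveComplex (nestohedron B) (facets V B)

/-- The moment-angle manifold of `P_B`. -/
abbrev ZP (V : Finset α) (B : Finset (Finset α)) : Type :=
  MomentAngleManifold (nestohedron B) (facets V B)

/-- The moment-angle-complex of `N_B`. -/
abbrev ZN (V : Finset α) (B : Finset (Finset α)) : Set (NonMax V B → ℂ) :=
  momentAngleComplex (nestedSetComplex V B)

/-- The inclusion of `B|_S ∖ {S}` into `B ∖ {V}`, for a proper subset `S` of `V`. -/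
def inclusion {V S : Finset α} (B : Finset (Finset α)) (hS : S ⊂ V) :
    NonMax S (restrict B S) ↪ NonMax V B where
  toFun T := ⟨T.1, (Finset.mem_filter.1 T.2.1).1, fun h =>
    hS.not_subset (h ▸ (Finset.mem_filter.1 T.2.1).2)⟩
  inj' _ _ h := Subtype.ext (Subtype.mk.inj h)

/-- The facet `F_S` of `P_B` is the product of `P_{B|_S} ⊆ ℝ^S` and a realization of `P_{B/S}` in
the complementary coordinate subspace. The vector `v` of that subspace is a vertex of the latter
polytope iff the translate of `P_{B|_S}` by `v` is a face of `P_B`. -/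
def IsFaceTranslation (B : Finset (Finset α)) (S : Finset α) (v : α → ℝ) : Prop :=
  (∀ i ∈ S, v i = 0) ∧
    IsExposed ℝ (nestohedron B) ((fun x => v + x) '' nestohedron (restrict B S))

end Nestohedra

end NestoMA

end

/-! A polytope enters only through affine functions `ℓ i` that vanish on its facets and a choice of
a point `o σ` for every set `σ` of facets that meet, lying on these facets and on no others
(`IsCentered`); the existence of such points encodes simplicity. If `u ∈ [0,1]^ι` has its support in
a simplex of the nerve complex `K`, then its level sets at positive heights form a chain of
simplices, and `layer o u` averages their centres over the heights in `(0, 1]`. Repeated radial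
projection from the centres shows that this is a homeomorphism of the cubical complex `cube K` with
`P` under which `u i = 1` describes the facet `i` (`bijOn_layer`). With its inverse `coord`, the map
`[t, p] ↦ t • (1 - coord p)` is a canonical homeomorphism; it passes through the compact model of
all `(x, d)` with `‖d k‖ = ℓ k x`.

Canonical homeomorphisms alone cannot make the square commute strictly: on the face `v + P'` every
facet of the set `σ` of facets containing it gives the coordinate `0`, while the map of complexes
puts `1` there. Hence the face is first pushed into the interior. Near the face `P` is a product of
`cube K'` with `[0, η]^σ`, because every slice with fixed small distances from the facets in `σ` is
again centred, with nerve complex `K'` (`isCentered_slice`, `bijOn_chart`). So a self-map of `ℂ^σ`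
supported in the sup-norm ball of radius `η` acts on the model (`twist`). The homeomorphism `push η
1` sends `0` to `(η/2, …, η/2)` and is joined to the identity by `push η r`. Its twist moves the
face into the slice at distance `η/2`, with positive real coordinates at `σ`. If the centres with
labels from `P'` are chosen inside that slice (`adjusted`), then pushed points have the cubical
coordinates of `P'` extended by `0`, and the push followed by the canonical homeomorphism makes the
square commute (`exists_square`).

For cohomology, forgetting coordinates retracts the moment-angle-complex onto that of a full
subcomplex. Through the square this yields a continuous left inverse of the map of manifolds, whose
pullback is the multiplicative section.

It remains to treat nestohedra. `mem_nestohedron_iff` describes `P_B` by the inequalities `∑ i ∈ T,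
x i ≥ |B|_T|`, by separation and a greedy bound. Supermodularity of `T ↦ |B|_T|` (`slack_union`)
shows that facets can meet only along nested sets, and an explicit point `nestedCenter` shows that
nested sets do occur. The same supermodularity, applied to `S` and another set, shows that the face
meets no facets beyond those containing it and those labelled by `B|_S`
(`isTransverseFace_nestohedron`). -/

noncomputable section

universe u v

set_option linter.unusedSectionVars false

namespace NestoMA

/-! ### Layer-cake combinations of points -/

section Layer

open MeasureTheory Topology

variable {ι : Type} [Fintype ι]

/-- The upper level sets of a function on a finite type. -/
def level (u : ι → ℝ) (t : ℝ) : Finset ι := {i | t ≤ u i}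

@[simp] lemma mem_level {u : ι → ℝ} {t : ℝ} {i : ι} : i ∈ level u t ↔ t ≤ u i := by
  simp [level]

variable [DecidableEq ι]

/-- The integrand takes finitely many values, and the heights with a prescribed level set form a
finite intersection of half-lines. -/
lemma intervalIntegrable_level (g : Finset ι → ℝ) (u : ι → ℝ) (a b : ℝ) :
    IntervalIntegrable (fun t => g (level u t)) volume a b := by
  let _ : MeasurableSpace (Finset ι) := ⊤
  have h1 : Measurable (level u) := by
    refine measurable_to_countable' fun τ => ?_
    have : level u ⁻¹' {τ} = ⋂ i, {t | t ≤ u i ↔ i ∈ τ} := by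
      ext t
      simp [Finset.ext_iff]
    rw [this]
    refine MeasurableSet.iInter fun i => ?_
    by_cases hi : i ∈ τ
    · simp only [hi, iff_true]
      exact measurableSet_Iic
    · simp only [hi, iff_false, not_le]
      exact measurableSet_Ioi
  have h2 : Measurable fun t => g (level u t) := measurable_from_top.comp h1
  refine (intervalIntegrable_const (c := ∑ τ, |g τ|)).mono_fun h2.aestronglyMeasurable ?_
  refine Filter.Eventually.of_forall fun t => ?_
  change |g (level u t)| ≤ |(∑ τ, |g τ| : ℝ)|
  rw [abs_of_nonneg (Finset.sum_nonneg fun τ _ => abs_nonneg (g τ))]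
  exact Finset.single_le_sum (f := fun τ => |g τ|) (fun _ _ => abs_nonneg _) (Finset.mem_univ _)

/-- The measure of the set of all heights in `(0, 1]` at which the level set of `u` is `τ`. -/
def weight (τ : Finset ι) (u : ι → ℝ) : ℝ := ∫ t in (0 : ℝ)..1, if level u t = τ then 1 else 0

lemma weight_nonneg (τ : Finset ι) (u : ι → ℝ) : 0 ≤ weight τ u :=
  intervalIntegral.integral_nonneg zero_le_one fun t _ => by split_ifs <;> norm_num

/-- The weights are the push-forward of Lebesgue measure on `(0, 1]` under `level u`, so this is a
change of variables. It converts sums over subsets into integrals over heights. -/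
lemma sum_weight_mul (u : ι → ℝ) (g : Finset ι → ℝ) :
    ∑ τ, weight τ u * g τ = ∫ t in (0 : ℝ)..1, g (level u t) := by
  simp only [weight, ← intervalIntegral.integral_mul_const]
  rw [← intervalIntegral.integral_finsetSum]
  · refine intervalIntegral.integral_congr fun t _ => ?_
    simp
  · intro τ _
    exact intervalIntegrable_level (fun ρ => (if ρ = τ then 1 else 0) * g τ) u 0 1

lemma sum_weight (u : ι → ℝ) : ∑ τ, weight τ u = 1 := by
  simpa using sum_weight_mul u fun _ => 1

lemma integral_indicator_le {c : ℝ} (h0 : 0 ≤ c) (h1 : c ≤ 1) :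
    ∫ t in (0 : ℝ)..1, (if t ≤ c then 1 else 0 : ℝ) = c := by
  have hint : ∀ a b : ℝ, IntervalIntegrable (fun t => (if t ≤ c then 1 else 0 : ℝ)) volume a b := by
    intro a b
    have := intervalIntegrable_level (ι := Unit) (fun τ => if () ∈ τ then 1 else 0) (fun _ => c) a b
    simpa using this
  rw [← intervalIntegral.integral_add_adjacent_intervals (hint 0 c) (hint c 1)]
  have e1 : ∫ t in (0 : ℝ)..c, (if t ≤ c then 1 else 0 : ℝ) = ∫ t in (0 : ℝ)..c, (1 : ℝ) := by
    refine intervalIntegral.integral_congr_ae (Filter.Eventually.of_forall fun t ht => ?_)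
    rw [uIoc_of_le h0] at ht
    simp [ht.2]
  have e2 : ∫ t in c..(1 : ℝ), (if t ≤ c then 1 else 0 : ℝ) = ∫ t in c..(1 : ℝ), (0 : ℝ) := by
    refine intervalIntegral.integral_congr_ae (Filter.Eventually.of_forall fun t ht => ?_)
    rw [uIoc_of_le h1] at ht
    simp [ht.1]
  rw [e1, e2]
  simp

lemma sum_weight_mem {u : ι → ℝ} {i : ι} (h : u i ∈ Icc (0 : ℝ) 1) :
    ∑ τ, weight τ u * (if i ∈ τ then 1 else 0) = u i := by
  rw [sum_weight_mul u fun τ => if i ∈ τ then 1 else 0]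
  simpa using integral_indicator_le h.1 h.2

lemma exists_level_eq {τ : Finset ι} {u : ι → ℝ} (h : weight τ u ≠ 0) :
    ∃ t ∈ Ioc (0 : ℝ) 1, level u t = τ := by
  by_contra! hn
  refine h (intervalIntegral.integral_zero_ae (Filter.Eventually.of_forall fun t ht => ?_))
  rw [uIoc_of_le zero_le_one] at ht
  simp [hn t ht]

/-- Scaling a function outside of its top level set. -/
lemma weight_scale {u w : ι → ℝ} {σ : Finset ι} {s : ℝ} (hs0 : 0 < s) (hs1 : s ≤ 1)
    (hu : ∀ i ∈ σ, u i = 1) (hw : ∀ i ∈ σ, w i = 1) (huw : ∀ i ∉ σ, u i = s * w i)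
    (hw1 : ∀ i, w i ≤ 1) (τ : Finset ι) :
    weight τ u = (1 - s) * (if σ = τ then 1 else 0) + s * weight τ w := by
  have hint := intervalIntegrable_level (fun ρ => if ρ = τ then (1 : ℝ) else 0) u
  -- At heights in `(s, 1]` only `σ` survives; at a height `t ≤ s` the level set of `u` is that of
  -- `w` at height `t / s`.
  rw [weight, ← intervalIntegral.integral_add_adjacent_intervals (hint 0 s) (hint s 1), add_comm]
  congr 1
  · have : ∫ t in s..(1 : ℝ), (if level u t = τ then 1 else 0 : ℝ) =
        ∫ t in s..(1 : ℝ), (if σ = τ then 1 else 0 : ℝ) := by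
      refine intervalIntegral.integral_congr_ae (Filter.Eventually.of_forall fun t ht => ?_)
      rw [uIoc_of_le hs1] at ht
      have : level u t = σ := by
        ext i
        rw [mem_level]
        by_cases hi : i ∈ σ
        · simp [hi, hu i hi, ht.2]
        · simp only [hi, iff_false, huw i hi, not_le]
          nlinarith [hw1 i, ht.1]
      simp [this]
    rw [this]
    simp
  · have : ∫ t in (0 : ℝ)..s, (if level u t = τ then 1 else 0 : ℝ) =
        ∫ t in (0 : ℝ)..s, (if level w (t / s) = τ then 1 else 0 : ℝ) := by
      refine intervalIntegral.integral_congr_ae (Filter.Eventually.of_forall fun t ht => ?_)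
      rw [uIoc_of_le hs0.le] at ht
      have : level u t = level w (t / s) := by
        ext i
        rw [mem_level, mem_level, div_le_iff₀ hs0]
        by_cases hi : i ∈ σ
        · simp [hw i hi, hu i hi, ht.2, ht.2.trans hs1]
        · rw [huw i hi, mul_comm]
      simp [this]
    rw [this, intervalIntegral.integral_comp_div
      (fun t => (if level w t = τ then 1 else 0 : ℝ)) hs0.ne']
    simp [weight, hs0.ne']

/-- Dominated convergence: at a height that is none of the finitely many values of `u`, the level
set does not change when `u` is perturbed slightly. -/
lemma continuous_weight (τ : Finset ι) : Continuous (weight τ) := by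
  rw [continuous_iff_continuousAt]
  intro u
  refine intervalIntegral.continuousAt_of_dominated_interval (bound := fun _ => 1)
    (Filter.Eventually.of_forall fun w => ?_) (Filter.Eventually.of_forall fun w => ?_)
    intervalIntegrable_const ?_
  · have := intervalIntegrable_level (fun ρ => if ρ = τ then (1 : ℝ) else 0) w 0 1
    exact this.def'.aestronglyMeasurable
  · refine Filter.Eventually.of_forall fun t _ => ?_
    split_ifs <;> simp
  · have hfin : (Set.range u).Finite := Set.finite_range u
    have hae : ∀ᵐ t ∂(volume : Measure ℝ), t ∉ Set.range u :=
      measure_eq_zero_iff_ae_notMem.1 (hfin.measure_zero volume)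
    filter_upwards [hae] with t ht _
    have hloc : ∀ᶠ w in 𝓝 u, level w t = level u t := by
      have : ∀ i, ∀ᶠ w : ι → ℝ in 𝓝 u, (t ≤ w i ↔ t ≤ u i) := by
        intro i
        have hc : Filter.Tendsto (fun w : ι → ℝ => w i) (𝓝 u) (𝓝 (u i)) :=
          (continuous_apply i).tendsto u
        rcases lt_or_gt_of_ne (fun h : u i = t => ht ⟨i, h⟩) with h | h
        · filter_upwards [hc.eventually (gt_mem_nhds h)] with w hw
          exact iff_of_false (not_le.2 hw) (not_le.2 h)
        · filter_upwards [hc.eventually (lt_mem_nhds h)] with w hw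
          exact iff_of_true hw.le h.le
      filter_upwards [Filter.eventually_all.2 this] with w hw
      ext i
      simp [hw i]
    refine (continuousAt_const (y := if level u t = τ then (1 : ℝ) else 0)).congr ?_
    filter_upwards [hloc] with w hw
    rw [hw]

variable {E : Type} [NormedAddCommGroup E] [NormedSpace ℝ E]

/-- The combination `∫₀¹ o {i | t ≤ u i} dt` of the points `o τ`. -/
def layer (o : Finset ι → E) (u : ι → ℝ) : E := ∑ τ, weight τ u • o τ

lemma continuous_layer (o : Finset ι → E) : Continuous (layer o) :=
  continuous_finsetSum _ fun τ _ => (continuous_weight τ).smul continuous_const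

/-- A subset that is not a level set at any height in `(0, 1]` has weight zero, so its centre is
irrelevant. -/
lemma layer_congr {o o' : Finset ι → E} {u : ι → ℝ}
    (h : ∀ t ∈ Ioc (0 : ℝ) 1, o (level u t) = o' (level u t)) : layer o u = layer o' u := by
  refine Finset.sum_congr rfl fun τ _ => ?_
  by_cases hτ : weight τ u = 0
  · simp [hτ]
  · obtain ⟨t, ht, rfl⟩ := exists_level_eq hτ
    rw [h t ht]

lemma layer_const_add (v : E) (o : Finset ι → E) (u : ι → ℝ) :
    layer (fun τ => v + o τ) u = v + layer o u := by
  simp only [layer, smul_add, Finset.sum_add_distrib, ← Finset.sum_smul, sum_weight, one_smul]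

lemma apply_layer (l : E →ᴬ[ℝ] ℝ) (o : Finset ι → E) (u : ι → ℝ) :
    l (layer o u) = ∑ τ, weight τ u * l (o τ) := by
  have h : ∀ x, l x = l.contLinear x + l 0 := fun x => congrFun (ContinuousAffineMap.decomp l) x
  have h2 : ∑ τ, weight τ u * l 0 = l 0 := by rw [← Finset.sum_mul, sum_weight, one_mul]
  rw [h (layer o u)]
  conv_rhs => enter [2, τ]; rw [h]
  simp only [mul_add, Finset.sum_add_distrib, h2, layer, map_sum, map_smul, smul_eq_mul]

/-- Geometrically, scaling the entries outside `σ` moves the point along the segment to the centre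
of the face `σ`. This ties the cubical coordinates to radial projection. -/
lemma layer_scale {u w : ι → ℝ} {σ : Finset ι} {s : ℝ} (hs0 : 0 < s) (hs1 : s ≤ 1)
    (hu : ∀ i ∈ σ, u i = 1) (hw : ∀ i ∈ σ, w i = 1) (huw : ∀ i ∉ σ, u i = s * w i)
    (hw1 : ∀ i, w i ≤ 1) (o : Finset ι → E) :
    layer o u = AffineMap.lineMap (o σ) (layer o w) s := by
  simp only [layer, weight_scale hs0 hs1 hu hw huw hw1, AffineMap.lineMap_apply_module, add_smul,
    Finset.sum_add_distrib, mul_smul, ← Finset.smul_sum]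
  simp

lemma layer_indicator (σ : Finset ι) (o : Finset ι → E) :
    layer o (fun i => if i ∈ σ then 1 else 0) = o σ := by
  rw [layer_congr (o' := fun _ => o σ)]
  · simp only [layer, ← Finset.sum_smul, sum_weight, one_smul]
  · intro t ht
    congr 1
    ext i
    by_cases hi : i ∈ σ
    · simp [hi, ht.2]
    · simp [hi, ht.1]

/-- Transport of layer-cake combinations along a map of the level sets. -/
lemma layer_of_level {κ : Type} [Fintype κ] [DecidableEq κ] {u : ι → ℝ} {w : κ → ℝ}
    (F : Finset ι → Finset κ) (h : ∀ t ∈ Ioc (0 : ℝ) 1, level w t = F (level u t))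
    (o : Finset κ → E) : layer o w = layer (fun τ => o (F τ)) u := by
  have hw : ∀ ρ, weight ρ w = ∑ τ, weight τ u * if F τ = ρ then 1 else 0 := by
    intro ρ
    rw [sum_weight_mul u fun τ => if F τ = ρ then 1 else 0, weight]
    refine intervalIntegral.integral_congr_ae (Filter.Eventually.of_forall fun t ht => ?_)
    rw [uIoc_of_le zero_le_one] at ht
    rw [h t ht]
  simp only [layer, hw, Finset.sum_smul, mul_smul]
  rw [Finset.sum_comm]
  refine Finset.sum_congr rfl fun τ _ => ?_
  simp

end Layer

/-! ### Polytopes with centres of their faces -/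

section Centered

variable {ι : Type} [Fintype ι] [DecidableEq ι]
variable {E : Type} [NormedAddCommGroup E] [NormedSpace ℝ E]

lemma apply_lineMap (l : E →ᴬ[ℝ] ℝ) (x y : E) (r : ℝ) :
    l (AffineMap.lineMap x y r) = (1 - r) * l x + r * l y := by
  have h : l (AffineMap.lineMap x y r) = AffineMap.lineMap (l x) (l y) r :=
    (l : E →ᵃ[ℝ] ℝ).apply_lineMap x y r
  rw [h, AffineMap.lineMap_apply_module, smul_eq_mul, smul_eq_mul]

/-- The polytope `P` is cut out of its affine span by the inequalities `0 ≤ ℓ i`, `K` is the nerve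
complex of its faces `ℓ i = 0`, and for `σ ∈ K` the point `o σ` lies in the relative interior of
the face `⋂ i ∈ σ, {ℓ i = 0}`, and in no other of the faces `ℓ i = 0`. -/
structure IsCentered (P : Set E) (ℓ : ι → E →ᴬ[ℝ] ℝ) (K : Set (Finset ι)) (o : Finset ι → E) :
    Prop where
  isCompact : IsCompact P
  convex : Convex ℝ P
  nonneg : ∀ x ∈ P, ∀ i, 0 ≤ ℓ i x
  lineMap_mem : ∀ x ∈ P, ∀ y ∈ P, ∀ r : ℝ, (∀ i, 0 ≤ ℓ i (AffineMap.lineMap x y r)) →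
    AffineMap.lineMap x y r ∈ P
  mem_nerve : ∀ x ∈ P, ∀ σ : Finset ι, (∀ i ∈ σ, ℓ i x = 0) → σ ∈ K
  center_mem : ∀ σ ∈ K, o σ ∈ P
  center_eq_zero_iff : ∀ σ ∈ K, ∀ i, ℓ i (o σ) = 0 ↔ i ∈ σ

/-- The cubical complex of a simplicial complex `K`. -/
def cube (K : Set (Finset ι)) : Set (ι → ℝ) :=
  {u | (∀ i, u i ∈ Icc (0 : ℝ) 1) ∧ ∃ σ ∈ K, ∀ i ∉ σ, u i = 0}

lemma isCompact_cube (K : Set (Finset ι)) : IsCompact (cube K) := by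
  have : cube K = ⋃ σ ∈ K, {u | (∀ i, u i ∈ Icc (0 : ℝ) 1) ∧ ∀ i ∉ σ, u i = 0} := by
    ext u
    simp only [cube, mem_ofPred_eq, mem_iUnion, exists_prop]
    grind
  rw [this]
  refine (Set.toFinite K).isCompact_biUnion fun σ _ => ?_
  have h1 : IsCompact (Set.pi univ fun _ : ι => Icc (0 : ℝ) 1) :=
    isCompact_univ_pi fun _ => isCompact_Icc
  have h2 : IsClosed {u : ι → ℝ | ∀ i ∉ σ, u i = 0} := by
    simp only [ofPred_forall]
    exact isClosed_iInter fun i => isClosed_iInter fun _ =>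
      isClosed_eq (continuous_apply i) continuous_const
  refine (h1.inter_right h2).of_isClosed_subset ?_ ?_
  · have : {u : ι → ℝ | (∀ i, u i ∈ Icc (0 : ℝ) 1) ∧ ∀ i ∉ σ, u i = 0} =
        (Set.pi univ fun _ : ι => Icc (0 : ℝ) 1) ∩ {u | ∀ i ∉ σ, u i = 0} := by
      ext u
      exact and_congr_left' (by simp only [mem_univ_pi])
    rw [this]
    exact h1.isClosed.inter h2
  · rintro u ⟨hu, hu'⟩
    exact ⟨fun i _ => hu i, hu'⟩

namespace IsCentered

variable {P : Set E} {ℓ : ι → E →ᴬ[ℝ] ℝ} {K : Set (Finset ι)} {o : Finset ι → E}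

section

variable (hP : IsCentered P ℓ K o)
include hP

lemma mono {σ τ : Finset ι} (hσ : σ ∈ K) (h : τ ⊆ σ) : τ ∈ K :=
  hP.mem_nerve _ (hP.center_mem σ hσ) τ fun i hi => (hP.center_eq_zero_iff σ hσ i).2 (h hi)

lemma center_pos {σ : Finset ι} (hσ : σ ∈ K) {i : ι} (hi : i ∉ σ) : 0 < ℓ i (o σ) :=
  lt_of_le_of_ne (hP.nonneg _ (hP.center_mem σ hσ) i)
    fun h => hi ((hP.center_eq_zero_iff σ hσ i).1 h.symm)

lemma level_mem {u : ι → ℝ} (hu : u ∈ cube K) {t : ℝ} (ht : 0 < t) : level u t ∈ K := by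
  obtain ⟨-, ρ, hρ, h⟩ := hu
  refine hP.mono hρ fun i hi => ?_
  by_contra hn
  rw [mem_level, h i hn] at hi
  linarith

lemma layer_mem {u : ι → ℝ} (hu : u ∈ cube K) : layer o u ∈ P := by
  classical
  -- Nothing is known about `o τ` for `τ ∉ K`; these terms have weight zero and may be replaced by a
  -- point of `P`.
  have h : layer o u = layer (fun τ => if τ ∈ K then o τ else o ∅) u :=
    layer_congr fun t ht => by simp [hP.level_mem hu ht.1]
  rw [h]
  have hK : (∅ : Finset ι) ∈ K := by
    obtain ⟨-, ρ, hρ, -⟩ := hu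
    exact hP.mono hρ (Finset.empty_subset _)
  refine hP.convex.sum_mem (fun τ _ => weight_nonneg τ u) (sum_weight u) fun τ _ => ?_
  split_ifs with hτ
  · exact hP.center_mem τ hτ
  · exact hP.center_mem ∅ hK

/-- The value is an average of non-negative numbers, so it vanishes iff `i` belongs to every level
set of positive weight, that is, iff the heights at most `u i` fill `(0, 1]`. -/
lemma apply_layer_eq_zero_iff {u : ι → ℝ} (hu : u ∈ cube K) (i : ι) :
    ℓ i (layer o u) = 0 ↔ u i = 1 := by
  have hmem : ∀ τ, weight τ u ≠ 0 → τ ∈ K := by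
    intro τ hτ
    obtain ⟨t, ht, rfl⟩ := exists_level_eq hτ
    exact hP.level_mem hu ht.1
  rw [apply_layer, Finset.sum_eq_zero_iff_of_nonneg]
  · constructor
    · intro h
      rw [← sum_weight_mem (hu.1 i)]
      refine Eq.trans ?_ (sum_weight u)
      refine Finset.sum_congr rfl fun τ _ => ?_
      by_cases hτ : weight τ u = 0
      · simp [hτ]
      · have := (mul_eq_zero.1 (h τ (Finset.mem_univ _))).resolve_left hτ
        rw [hP.center_eq_zero_iff τ (hmem τ hτ)] at this
        simp [this]
    · intro h τ _
      by_cases hτ : weight τ u = 0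
      · simp [hτ]
      · have hK := hmem τ hτ
        obtain ⟨t, ht, rfl⟩ := exists_level_eq hτ
        rw [(hP.center_eq_zero_iff _ hK i).2 (by rw [mem_level, h]; exact ht.2), mul_zero]
  · intro τ _
    by_cases hτ : weight τ u = 0
    · simp [hτ]
    · exact mul_nonneg (weight_nonneg τ u) (hP.nonneg _ (hP.center_mem τ (hmem τ hτ)) i)

/-! ### Surjectivity and injectivity of the cubical parametrization -/

/-- The ray from the centre of a face through another point of the face leaves the face at a point
of a smaller face. -/
lemma exists_exit {σ : Finset ι} (hσ : σ ∈ K) {x : E} (hx : x ∈ P) (h : ∀ i ∈ σ, ℓ i x = 0)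
    (hne : x ≠ o σ) : ∃ s ∈ Ioc (0 : ℝ) 1, ∃ q ∈ P, ∃ i ∉ σ,
      (∀ j ∈ insert i σ, ℓ j q = 0) ∧ x = AffineMap.lineMap (o σ) q s := by
  have ho := hP.center_mem σ hσ
  have ho0 : ∀ i ∈ σ, ℓ i (o σ) = 0 := fun i hi => (hP.center_eq_zero_iff σ hσ i).2 hi
  have hex : ∃ i ∉ σ, ℓ i x < ℓ i (o σ) := by
    -- If no `ℓ i` decreases along the ray, the whole ray stays in `P`. The parameter `r` below goes
    -- far enough to violate the norm bound `C`.
    by_contra! hn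
    obtain ⟨C, hC⟩ := hP.isCompact.isBounded.exists_norm_le
    have hpos : 0 < ‖x - o σ‖ := norm_pos_iff.2 (sub_ne_zero.2 hne)
    have hC0 : 0 ≤ C := (norm_nonneg _).trans (hC _ hx)
    set r : ℝ := (C + ‖o σ‖ + 1) / ‖x - o σ‖ with hr
    have hr0 : 0 ≤ r := by positivity
    have hmem : AffineMap.lineMap (o σ) x r ∈ P := by
      refine hP.lineMap_mem _ ho _ hx r fun i => ?_
      rw [apply_lineMap]
      by_cases hi : i ∈ σ
      · simp [h i hi, ho0 i hi]
      · nlinarith [hn i hi, hP.nonneg _ ho i]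
    have h1 := hC _ hmem
    have h2 : r * ‖x - o σ‖ = C + ‖o σ‖ + 1 := div_mul_cancel₀ _ hpos.ne'
    have h3 : ‖r • (x - o σ)‖ = r * ‖x - o σ‖ := by rw [norm_smul, Real.norm_of_nonneg hr0]
    have h4 : r • (x - o σ) = AffineMap.lineMap (o σ) x r - o σ := by
      rw [AffineMap.lineMap_apply_module']
      simp
    have h5 := norm_sub_le (AffineMap.lineMap (o σ) x r) (o σ)
    rw [← h4, h3, h2] at h5
    linarith
  obtain ⟨i₀, hi₀, hlt⟩ := hex
  obtain ⟨i, hi, hmax⟩ := Finset.exists_max_image σᶜ (fun i => 1 - ℓ i x / ℓ i (o σ))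
    ⟨i₀, Finset.mem_compl.2 hi₀⟩
  rw [Finset.mem_compl] at hi
  -- The function `ℓ j` vanishes on the ray at parameter `1 / (1 - ℓ j x / ℓ j (o σ))` when it
  -- decreases, so the maximal `s` gives the first exit, at parameter `1 / s`.
  set s : ℝ := 1 - ℓ i x / ℓ i (o σ) with hs
  have hpos := hP.center_pos hσ hi
  have hs0 : 0 < s := by
    refine lt_of_lt_of_le ?_ (hmax i₀ (Finset.mem_compl.2 hi₀))
    have := (div_lt_one (hP.center_pos hσ hi₀)).2 hlt
    linarith
  have hs1 : s ≤ 1 := by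
    have := div_nonneg (hP.nonneg _ hx i) hpos.le
    linarith
  have hval : ∀ j ∉ σ, s * ℓ j (AffineMap.lineMap (o σ) x (1 / s)) =
      ℓ j x - (1 - s) * ℓ j (o σ) := by
    intro j _
    rw [apply_lineMap]
    field_simp
    ring
  have hzero : ∀ j ∈ σ, ℓ j (AffineMap.lineMap (o σ) x (1 / s)) = 0 := by
    intro j hj
    rw [apply_lineMap, h j hj, ho0 j hj]
    ring
  refine ⟨s, ⟨hs0, hs1⟩, AffineMap.lineMap (o σ) x (1 / s), ?_, i, hi, ?_, ?_⟩
  · refine hP.lineMap_mem _ ho _ hx _ fun j => ?_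
    by_cases hj : j ∈ σ
    · exact (hzero j hj).ge
    · have h1 := hmax j (Finset.mem_compl.2 hj)
      have h2 := hP.center_pos hσ hj
      have h3 : (1 - s) * ℓ j (o σ) ≤ ℓ j x := by
        rw [← le_div_iff₀ h2]
        linarith
      have h4 := hval j hj
      by_contra! hneg
      nlinarith
  · intro j hj
    rcases Finset.mem_insert.1 hj with rfl | hj
    · have h4 := hval j hi
      have h5 : (1 - s) * ℓ j (o σ) = ℓ j x := by
        rw [hs]
        field_simp
        ring
      rw [h5, sub_self] at h4
      exact (mul_eq_zero.1 h4).resolve_left hs0.ne'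
    · exact hzero j hj
  · rw [AffineMap.lineMap_lineMap_right]
    simp [hs0.ne']

/-- Induction on a bound `n` for the number of facets outside `σ`. A point of the face other than
its centre lies on a segment from the centre to a point of a smaller face, whose coordinates are
scaled back by `layer_scale`. -/
lemma exists_layer_eq (n : ℕ) : ∀ σ ∈ K, Fintype.card ι ≤ σ.card + n → ∀ x ∈ P,
    (∀ i ∈ σ, ℓ i x = 0) → ∃ u ∈ cube K, (∀ i ∈ σ, u i = 1) ∧ layer o u = x := by
  have hbase : ∀ σ ∈ K, ∃ u ∈ cube K, (∀ i ∈ σ, u i = 1) ∧ layer o u = o σ := by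
    intro σ hσ
    refine ⟨fun i => if i ∈ σ then 1 else 0, ⟨fun i => ?_, σ, hσ, fun i hi => by simp [hi]⟩,
      fun i hi => by simp [hi], layer_indicator σ o⟩
    dsimp only
    split_ifs <;> simp
  induction n with
  | zero =>
    intro σ hσ hcard x hx h
    by_cases hxo : x = o σ
    · exact hxo ▸ hbase σ hσ
    · obtain ⟨s, -, q, -, i, hi, -⟩ := hP.exists_exit hσ hx h hxo
      have := (Finset.card_eq_iff_eq_univ σ).1 (le_antisymm (Finset.card_le_univ σ) hcard)
      exact absurd (this ▸ Finset.mem_univ i) hi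
  | succ n ih =>
    intro σ hσ hcard x hx h
    by_cases hxo : x = o σ
    · exact hxo ▸ hbase σ hσ
    · obtain ⟨s, hs, q, hq, i, hi, hz, hxq⟩ := hP.exists_exit hσ hx h hxo
      obtain ⟨w, hw, hw1, rfl⟩ := ih (insert i σ) (hP.mem_nerve q hq _ hz)
        (by rw [Finset.card_insert_of_notMem hi]; omega) q hq hz
      obtain ⟨hwI, ρ, hρ, hwρ⟩ := hw
      have hσρ : ∀ j ∈ σ, j ∈ ρ := by
        intro j hj
        by_contra hn
        have := hw1 j (Finset.mem_insert_of_mem hj)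
        rw [hwρ j hn] at this
        norm_num at this
      refine ⟨fun j => if j ∈ σ then 1 else s * w j, ⟨fun j => ?_, ρ, hρ, fun j hj => ?_⟩,
        fun j hj => by simp [hj], ?_⟩
      · dsimp only
        split_ifs
        · simp
        · exact ⟨mul_nonneg hs.1.le (hwI j).1, mul_le_one₀ hs.2 (hwI j).1 (hwI j).2⟩
      · have : j ∉ σ := fun h => hj (hσρ j h)
        simp [this, hwρ j hj]
      · rw [hxq]
        exact layer_scale hs.1 hs.2 (fun j hj => by simp [hj])
          (fun j hj => hw1 j (Finset.mem_insert_of_mem hj)) (fun j hj => by simp [hj])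
          (fun j => (hwI j).2) o

omit hP in
/-- A point of the cubical complex whose coordinates in `σ` are `1` is obtained by scaling from one
with a further coordinate `1`. -/
lemma exists_scale {u : ι → ℝ} (hu : u ∈ cube K) {σ : Finset ι} (h : ∀ i ∈ σ, u i = 1)
    (hne : u ≠ fun i => if i ∈ σ then 1 else 0) : ∃ s ∈ Ioc (0 : ℝ) 1, ∃ i ∉ σ, ∃ w ∈ cube K,
      (∀ j ∈ insert i σ, w j = 1) ∧ ∀ j ∉ σ, u j = s * w j := by
  obtain ⟨hI, ρ, hρ, h0⟩ := hu
  obtain ⟨i₀, hi₀, hpos⟩ : ∃ i ∉ σ, 0 < u i := by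
    by_contra! hn
    refine hne (funext fun i => ?_)
    split_ifs with hi
    · exact h i hi
    · exact le_antisymm (hn i hi) (hI i).1
  obtain ⟨i, hi, hmax⟩ := Finset.exists_max_image σᶜ u ⟨i₀, Finset.mem_compl.2 hi₀⟩
  rw [Finset.mem_compl] at hi
  have hs0 : 0 < u i := hpos.trans_le (hmax i₀ (Finset.mem_compl.2 hi₀))
  refine ⟨u i, ⟨hs0, (hI i).2⟩, i, hi, fun j => if j ∈ σ then 1 else u j / u i,
    ⟨fun j => ?_, ρ, hρ, fun j hj => ?_⟩, fun j hj => ?_, fun j hj => ?_⟩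
  · dsimp only
    split_ifs with hj
    · simp
    · exact ⟨div_nonneg (hI j).1 hs0.le, (div_le_one hs0).2 (hmax j (Finset.mem_compl.2 hj))⟩
  · have : j ∉ σ := by
      intro hjσ
      have := h j hjσ
      rw [h0 j hj] at this
      norm_num at this
    simp [this, h0 j hj]
  · rcases Finset.mem_insert.1 hj with rfl | hj
    · simp [hs0.ne']
    · simp [hj]
  · simp only [hj, if_false]
    field_simp

/-- The radial projection from the centre of the face `σ` can be read off from the image point: `1 -
s` is the minimum over `j ∉ σ` of the ratios of `ℓ j` at the point and at the centre. Both preimages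
thus come from the same exit point, to which the induction applies. -/
lemma eq_of_layer_eq (n : ℕ) : ∀ σ : Finset ι, Fintype.card ι ≤ σ.card + n → ∀ u ∈ cube K,
    ∀ u' ∈ cube K, (∀ i ∈ σ, u i = 1) → (∀ i ∈ σ, u' i = 1) → layer o u = layer o u' →
    u = u' := by
  have hσK : ∀ {σ : Finset ι} {u}, u ∈ cube K → (∀ i ∈ σ, u i = 1) → σ ∈ K := by
    rintro σ u hu h
    refine hP.mono (hP.level_mem hu one_pos) fun i hi => ?_
    rw [mem_level, h i hi]
  have hscale : ∀ {σ : Finset ι} {u w : ι → ℝ} {s : ℝ} {i : ι}, u ∈ cube K → w ∈ cube K →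
      (∀ j ∈ σ, u j = 1) → s ∈ Ioc (0 : ℝ) 1 → (∀ j ∈ insert i σ, w j = 1) →
      (∀ j ∉ σ, u j = s * w j) → layer o u = AffineMap.lineMap (o σ) (layer o w) s ∧
      ℓ i (layer o u) = (1 - s) * ℓ i (o σ) ∧
      ∀ j, (1 - s) * ℓ j (o σ) ≤ ℓ j (layer o u) := by
    intro σ u w s i hu hw h1 hs hw1 huw
    have := layer_scale hs.1 hs.2 h1 (fun j hj => hw1 j (Finset.mem_insert_of_mem hj)) huw
      (fun j => (hw.1 j).2) o
    refine ⟨this, ?_, fun j => ?_⟩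
    · rw [this, apply_lineMap, (hP.apply_layer_eq_zero_iff hw i).2 (hw1 i (by simp))]
      ring
    · rw [this, apply_lineMap]
      have := mul_nonneg hs.1.le (hP.nonneg _ (hP.layer_mem hw) j)
      linarith
  have hcenter : ∀ {σ : Finset ι} {u}, u ∈ cube K → (∀ i ∈ σ, u i = 1) → layer o u = o σ →
      u = fun i => if i ∈ σ then 1 else 0 := by
    intro σ u hu h he
    by_contra hne
    obtain ⟨s, hs, i, hi, w, hw, hw1, huw⟩ := exists_scale hu h hne
    have := (hscale hu hw h hs hw1 huw).2.1
    rw [he] at this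
    have hpos := hP.center_pos (hσK hu h) hi
    nlinarith [hs.1]
  induction n with
  | zero =>
    intro σ hcard u hu u' hu' h h' _
    have := (Finset.card_eq_iff_eq_univ σ).1 (le_antisymm (Finset.card_le_univ σ) hcard)
    subst this
    funext i
    rw [h i (Finset.mem_univ i), h' i (Finset.mem_univ i)]
  | succ n ih =>
    intro σ hcard u hu u' hu' h h' he
    by_cases hne : u = fun i => if i ∈ σ then 1 else 0
    · have e1 : layer o u' = o σ := by rw [← he, hne, layer_indicator]
      rw [hne, hcenter hu' h' e1]
    by_cases hne' : u' = fun i => if i ∈ σ then 1 else 0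
    · have e1 : layer o u = o σ := by rw [he, hne', layer_indicator]
      rw [hne', hcenter hu h e1]
    obtain ⟨s, hs, i, hi, w, hw, hw1, huw⟩ := exists_scale hu h hne
    obtain ⟨s', hs', i', hi', w', hw', hw1', huw'⟩ := exists_scale hu' h' hne'
    obtain ⟨a1, a2, a3⟩ := hscale hu hw h hs hw1 huw
    obtain ⟨b1, b2, b3⟩ := hscale hu' hw' h' hs' hw1' huw'
    have hK := hσK hu h
    have hss : s = s' := by
      have c1 := b3 i
      have c2 := a3 i'
      rw [← he, a2] at c1
      rw [he, b2] at c2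
      have d1 := le_of_mul_le_mul_right c1 (hP.center_pos hK hi)
      have d2 := le_of_mul_le_mul_right c2 (hP.center_pos hK hi')
      linarith
    subst hss
    have hww : layer o w = layer o w' := by
      rw [a1, b1] at he
      simp only [AffineMap.lineMap_apply_module, add_right_inj] at he
      exact smul_right_injective E hs.1.ne' he
    -- The maximal entries `i` and `i'` may differ, but being `1` at `i` is visible in the common
    -- image.
    have hwi : w' i = 1 := by
      rw [← hP.apply_layer_eq_zero_iff hw', ← hww, hP.apply_layer_eq_zero_iff hw]
      exact hw1 i (by simp)
    have := ih (insert i σ) (by rw [Finset.card_insert_of_notMem hi]; omega) w hw w' hw' hw1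
      (fun j hj => by
        rcases Finset.mem_insert.1 hj with rfl | hj
        · exact hwi
        · exact hw1' j (Finset.mem_insert_of_mem hj)) hww
    subst this
    funext j
    by_cases hj : j ∈ σ
    · rw [h j hj, h' j hj]
    · rw [huw j hj, huw' j hj]

/-- The layer-cake combinations of the centres parametrize the polytope by the cubical complex. -/
theorem bijOn_layer : BijOn (layer o) (cube K) P := by
  refine ⟨fun u hu => hP.layer_mem hu, fun u hu u' hu' h => ?_, fun x hx => ?_⟩
  · exact hP.eq_of_layer_eq (Fintype.card ι) ∅ (by simp) u hu u' hu' (by simp) (by simp) h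
  · have hK : (∅ : Finset ι) ∈ K := hP.mem_nerve x hx ∅ (by simp)
    obtain ⟨u, hu, -, h⟩ := hP.exists_layer_eq (Fintype.card ι) ∅ hK (by simp) x hx (by simp)
    exact ⟨u, hu, h⟩

end

/-- The homeomorphism of the cubical complex of the nerve complex with the polytope. -/
def homeo (hP : IsCentered P ℓ K o) : cube K ≃ₜ P :=
  haveI := isCompact_iff_compactSpace.1 (isCompact_cube K)
  Continuous.homeoOfEquivCompactToT2 (f := hP.bijOn_layer.equiv)
    (((continuous_layer o).comp continuous_subtype_val).subtype_mk _)

/-- The cubical coordinates of the points of the polytope. -/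
def coord (hP : IsCentered P ℓ K o) (x : P) : ι → ℝ := hP.homeo.symm x

section

variable (hP : IsCentered P ℓ K o)

lemma continuous_coord : Continuous hP.coord :=
  continuous_subtype_val.comp hP.homeo.symm.continuous

lemma coord_mem (x : P) : hP.coord x ∈ cube K := (hP.homeo.symm x).2

lemma layer_coord (x : P) : layer o (hP.coord x) = x :=
  congrArg Subtype.val (hP.homeo.apply_symm_apply x)

lemma coord_layer {u : ι → ℝ} (hu : u ∈ cube K) :
    hP.coord ⟨layer o u, hP.layer_mem hu⟩ = u :=
  congrArg Subtype.val (hP.homeo.symm_apply_apply ⟨u, hu⟩)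

lemma coord_eq_one_iff (x : P) (i : ι) : hP.coord x i = 1 ↔ ℓ i x = 0 := by
  rw [← hP.apply_layer_eq_zero_iff (hP.coord_mem x), hP.layer_coord]

end

end IsCentered

end Centered

/-! ### Exposed faces -/

section Exposed

open Topology

variable {ι : Type} [Fintype ι] [DecidableEq ι]
variable {E : Type} [NormedAddCommGroup E] [NormedSpace ℝ E]
variable {P : Set E} {ℓ : ι → E →ᴬ[ℝ] ℝ} {K : Set (Finset ι)} {o : Finset ι → E}

/-- Passing to a midpoint with a point where `ℓ k` is positive makes `ℓ k` positive and keeps the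
values already positive. -/
lemma exists_relInterior {G : Set E} (hG : Convex ℝ G) (hne : G.Nonempty)
    (h0 : ∀ x ∈ G, ∀ k, 0 ≤ ℓ k x) :
    ∃ g ∈ G, ∀ k, (∀ y ∈ G, ℓ k y = 0) ∨ 0 < ℓ k g := by
  suffices ∀ s : Finset ι, ∃ g ∈ G, ∀ k ∈ s, (∀ y ∈ G, ℓ k y = 0) ∨ 0 < ℓ k g by
    simpa using this Finset.univ
  intro s
  induction s using Finset.induction_on with
  | empty => exact ⟨_, hne.some_mem, by simp⟩
  | insert k s _ ih =>
    obtain ⟨g, hg, h⟩ := ih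
    by_cases hk : ∀ y ∈ G, ℓ k y = 0
    · refine ⟨g, hg, fun j hj => ?_⟩
      rcases Finset.mem_insert.1 hj with rfl | hj
      exacts [Or.inl hk, h j hj]
    push Not at hk
    obtain ⟨y, hy, hky⟩ := hk
    have hl : ∀ j, ℓ j (AffineMap.lineMap g y (1 / 2 : ℝ)) = ℓ j g / 2 + ℓ j y / 2 := by
      intro j
      rw [apply_lineMap]
      ring
    refine ⟨AffineMap.lineMap g y (1 / 2 : ℝ),
      hG.lineMap_mem hg hy ⟨by norm_num, by norm_num⟩, fun j hj => ?_⟩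
    rcases Finset.mem_insert.1 hj with rfl | hj
    · right
      rw [hl]
      have := lt_of_le_of_ne (h0 y hy j) (Ne.symm hky)
      linarith [h0 g hg j]
    · refine (h j hj).imp_right fun hpos => ?_
      rw [hl]
      linarith [h0 y hy j]

namespace IsCentered

variable (hP : IsCentered P ℓ K o)
include hP

/-- A non-empty exposed face is the intersection of the facets that contain it. -/
lemma exposed_eq {G : Set E} (hG : IsExposed ℝ P G) (hne : G.Nonempty) :
    G = {x | x ∈ P ∧ ∀ k, (∀ y ∈ G, ℓ k y = 0) → ℓ k x = 0} := by
  obtain ⟨g, hg, hpos⟩ := exists_relInterior (ℓ := ℓ) (hG.convex hP.convex) hne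
    fun x hx k => hP.nonneg x (hG.subset hx) k
  refine Subset.antisymm (fun x hx => ⟨hG.subset hx, fun k hk => hk x hx⟩) ?_
  rintro x ⟨hx, h⟩
  obtain ⟨l, hl⟩ := hG hne
  have hgP := hG.subset hg
  -- The segment from `x` to the relatively interior point `g` can be prolonged slightly beyond `g`
  -- inside `P`. A linear function whose maximum on `P` is attained at `g` cannot be smaller at `x`.
  have hev : ∀ k, ∀ᶠ ε in 𝓝[>] (0 : ℝ), 0 ≤ ℓ k (AffineMap.lineMap x g (1 + ε)) := by
    intro k
    rcases hpos k with hk | hk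
    · refine Filter.Eventually.of_forall fun ε => ?_
      rw [apply_lineMap, h k hk, hk g hg]
      simp
    · have hc : Filter.Tendsto (fun ε : ℝ => (1 - (1 + ε)) * ℓ k x + (1 + ε) * ℓ k g) (𝓝 0)
          (𝓝 ((1 - (1 + 0)) * ℓ k x + (1 + 0) * ℓ k g)) :=
        Continuous.tendsto (by fun_prop) 0
      have hlt : 0 < (1 - (1 + 0)) * ℓ k x + (1 + 0) * ℓ k g := by simpa using hk
      filter_upwards [(hc.eventually (lt_mem_nhds hlt)).filter_mono nhdsWithin_le_nhds] with ε hε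
      rw [apply_lineMap]
      exact hε.le
  obtain ⟨ε, hε, hε0⟩ := ((Filter.eventually_all.2 hev).and self_mem_nhdsWithin).exists
  have hmem := hP.lineMap_mem x hx g hgP (1 + ε) hε
  rw [hl] at hg ⊢
  refine ⟨hx, fun y hy => (hg.2 y hy).trans ?_⟩
  have h1 := hg.2 _ hmem
  rw [AffineMap.lineMap_apply_module, map_add, map_smul, map_smul, smul_eq_mul, smul_eq_mul] at h1
  have h2 : ε * (l g - l x) ≤ 0 := by linarith
  have h3 : 0 < ε := hε0
  by_contra! hlt
  nlinarith

omit hP in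
lemma isExposed_zero (h0 : ∀ x ∈ P, ∀ k, 0 ≤ ℓ k x) (k : ι)
    (hne : ∃ x ∈ P, ℓ k x = 0) : IsExposed ℝ P {x | x ∈ P ∧ ℓ k x = 0} := by
  have h : ∀ x, ℓ k x = (ℓ k).contLinear x + ℓ k 0 :=
    fun x => congrFun (ContinuousAffineMap.decomp (ℓ k)) x
  intro _
  refine ⟨-(ℓ k).contLinear, Set.ext fun x => and_congr_right fun hx => ?_⟩
  obtain ⟨z, hz, hz0⟩ := hne
  constructor
  · intro hx0 y hy
    have h1 := h0 y hy k
    rw [h] at h1 hx0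
    simp only [neg_apply]
    linarith
  · intro hy
    have h1 := hy z hz
    have h2 := h0 x hx k
    rw [h] at h2 hz0 ⊢
    simp only [neg_apply] at h1
    linarith

lemma zero_ne (hK : ∀ k, {k} ∈ K) (k : ι) : {x | x ∈ P ∧ ℓ k x = 0} ≠ P := by
  have h : (∅ : Finset ι) ∈ K := hP.mono (hK k) (Finset.empty_subset _)
  intro he
  have hm := hP.center_mem _ h
  rw [← he] at hm
  exact Finset.notMem_empty k ((hP.center_eq_zero_iff _ h k).1 hm.2)

omit [Fintype ι] in
lemma eq_of_zero_subset (hK : ∀ k, {k} ∈ K) {i j : ι}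
    (h : {x | x ∈ P ∧ ℓ i x = 0} ⊆ {x | x ∈ P ∧ ℓ j x = 0}) : i = j := by
  have h1 := @h (o {i}) ⟨hP.center_mem _ (hK i), (hP.center_eq_zero_iff _ (hK i) i).2 (by simp)⟩
  have h2 := (hP.center_eq_zero_iff _ (hK i) j).1 h1.2
  exact (Finset.mem_singleton.1 h2).symm

/-- By `exposed_eq`, a non-empty proper exposed face lies in some zero set of `ℓ k`. The centres `o
{k}` show that these zero sets are pairwise incomparable, so they are exactly the maximal ones. -/
theorem isFacet_iff (hK : ∀ k, {k} ∈ K) (G : Set E) :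
    IsFacet P G ↔ ∃ k, {x | x ∈ P ∧ ℓ k x = 0} = G := by
  have hne : ∀ k, ∃ x ∈ P, ℓ k x = 0 := fun k =>
    ⟨o {k}, hP.center_mem _ (hK k), (hP.center_eq_zero_iff _ (hK k) k).2 (by simp)⟩
  have hprop : ∀ k, IsExposed ℝ P {x | x ∈ P ∧ ℓ k x = 0} ∧
      {x | x ∈ P ∧ ℓ k x = 0}.Nonempty ∧ {x | x ∈ P ∧ ℓ k x = 0} ≠ P := fun k =>
    ⟨isExposed_zero hP.nonneg k (hne k), hne k, hP.zero_ne hK k⟩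
  have hsub : ∀ G, IsExposed ℝ P G → G.Nonempty → G ≠ P →
      ∃ k, G ⊆ {x | x ∈ P ∧ ℓ k x = 0} := by
    intro G hG hGne hGP
    by_contra! hn
    refine hGP ?_
    rw [hP.exposed_eq hG hGne]
    refine Set.ext fun x => ⟨fun h => h.1, fun hx => ⟨hx, fun k hk => ?_⟩⟩
    exact absurd (fun y hy => ⟨hG.subset hy, hk y hy⟩) (hn k)
  constructor
  · intro hG
    obtain ⟨k, hk⟩ := hsub G hG.1.1 hG.1.2.1 hG.1.2.2
    exact ⟨k, Subset.antisymm (hG.2 (hprop k) hk) hk⟩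
  · rintro ⟨k, rfl⟩
    refine ⟨hprop k, fun H hH hle => ?_⟩
    obtain ⟨j, hj⟩ := hsub H hH.1 hH.2.1 hH.2.2
    obtain rfl := hP.eq_of_zero_subset hK (hle.trans hj)
    exact hj

end IsCentered

end Exposed

/-! ### The canonical homeomorphism -/

section Model

open Topology

/-- The direction of a complex number. -/
def sgn (z : ℂ) : ℂ := z / ‖z‖

@[simp] lemma sgn_zero : sgn 0 = 0 := by simp [sgn]

lemma norm_sgn {z : ℂ} (hz : z ≠ 0) : ‖sgn z‖ = 1 := by
  simp [sgn, hz]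

lemma norm_sgn_le (z : ℂ) : ‖sgn z‖ ≤ 1 := by
  by_cases hz : z = 0
  · simp [hz]
  · exact (norm_sgn hz).le

lemma sgn_mul_norm (z : ℂ) : sgn z * (‖z‖ : ℂ) = z := by
  by_cases hz : z = 0
  · simp [hz]
  · rw [sgn, div_mul_cancel₀]
    simpa using hz

lemma sgn_mul_pos (z : ℂ) {r : ℝ} (hr : 0 < r) : sgn (z * r) = sgn z := by
  have : (r : ℂ) ≠ 0 := by exact_mod_cast hr.ne'
  simp only [sgn, norm_mul, Complex.norm_real, Real.norm_of_nonneg hr.le, Complex.ofReal_mul]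
  rw [mul_div_mul_right _ _ this]

lemma sgn_of_norm_eq_one {z : ℂ} (hz : ‖z‖ = 1) : sgn z = z := by
  simp [sgn, hz]

lemma sgn_sgn (z : ℂ) : sgn (sgn z) = sgn z := by
  by_cases hz : z = 0
  · simp [hz]
  · exact sgn_of_norm_eq_one (norm_sgn hz)

lemma norm_sgn_mul {z : ℂ} {r : ℝ} (hr : 0 ≤ r) (h : z = 0 → r = 0) : ‖sgn z * r‖ = r := by
  by_cases hz : z = 0
  · simp [hz, h hz]
  · rw [norm_mul, norm_sgn hz, one_mul, Complex.norm_real, Real.norm_of_nonneg hr]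

lemma sgn_sgn_mul_mul {z : ℂ} {r s : ℝ} (hr : 0 ≤ r) (h : r = 0 → s = 0) :
    sgn (sgn z * r) * s = sgn z * s := by
  rcases hr.eq_or_lt with hr | hr
  · rw [h hr.symm]
    simp
  · rw [sgn_mul_pos _ hr, sgn_sgn]

/-- The direction is bounded and discontinuous only at `0`, where the modulus `r` vanishes. -/
lemma continuous_sgn_mul {X : Type*} [TopologicalSpace X] {d : X → ℂ} {r : X → ℝ}
    (hd : Continuous d) (hr : Continuous r) (h : ∀ x, d x = 0 → r x = 0) :
    Continuous fun x => sgn (d x) * (r x : ℂ) := by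
  rw [continuous_iff_continuousAt]
  intro x
  by_cases hx : d x = 0
  · have h0 : Filter.Tendsto (fun y => |r y|) (𝓝 x) (𝓝 0) := by
      have := (continuous_abs.comp hr).tendsto x
      simpa only [Function.comp_def, h x hx, abs_zero] using this
    rw [ContinuousAt, hx, sgn_zero, zero_mul]
    refine squeeze_zero_norm (fun y => ?_) h0
    rw [norm_mul, Complex.norm_real, Real.norm_eq_abs]
    exact mul_le_of_le_one_left (abs_nonneg _) (norm_sgn_le _)
  · have hn : ((‖d x‖ : ℝ) : ℂ) ≠ 0 := by simpa using hx
    refine ContinuousAt.mul (ContinuousAt.div hd.continuousAt ?_ hn) ?_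
    · exact (Complex.continuous_ofReal.comp (continuous_norm.comp hd)).continuousAt
    · exact (Complex.continuous_ofReal.comp hr).continuousAt

variable {ι : Type} [Fintype ι] [DecidableEq ι]
variable {E : Type} [NormedAddCommGroup E] [NormedSpace ℝ E]
variable {P : Set E} {ℓ : ι → E →ᴬ[ℝ] ℝ} {F : ι → Set E} {o : Finset ι → E}

/-- The moment-angle manifold as a subspace of `E × ℂ^ι`. -/
def model (P : Set E) (ℓ : ι → E →ᴬ[ℝ] ℝ) : Set (E × (ι → ℂ)) :=
  {z | z.1 ∈ P ∧ ∀ k, ‖z.2 k‖ = ℓ k z.1}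

lemma model_eq_zero_iff (z : model P ℓ) (k : ι) : z.1.2 k = 0 ↔ ℓ k z.1.1 = 0 := by
  rw [← z.2.2 k, norm_eq_zero]

/-- The polytope coordinate of a point of the model. -/
def model.fst (z : model P ℓ) : P := ⟨z.1.1, z.2.1⟩

lemma model.continuous_fst : Continuous (model.fst : model P ℓ → P) := by
  unfold model.fst
  fun_prop

lemma model.continuous_snd (k : ι) : Continuous fun z : model P ℓ => z.1.2 k := by
  fun_prop

/-- `[t, p] ↦ (p, t • ℓ p)`. -/
def toModel (h0 : ∀ x ∈ P, ∀ k, 0 ≤ ℓ k x) (hF : ∀ k, ∀ x ∈ P, x ∈ F k ↔ ℓ k x = 0) :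
    MomentAngleManifold P F → model P ℓ :=
  Quotient.lift (fun a : (ι → Circle) × P =>
      (⟨(a.2.1, fun k => (a.1 k : ℂ) * (ℓ k a.2.1 : ℂ)), a.2.2, fun k => by
        rw [norm_mul, Circle.norm_coe, one_mul, Complex.norm_real,
          Real.norm_of_nonneg (h0 _ a.2.2 k)]⟩ : model P ℓ)) (by
    rintro ⟨t, p⟩ ⟨s, q⟩ ⟨h, h'⟩
    obtain rfl : p = q := h
    refine Subtype.ext (Prod.ext rfl (funext fun k => ?_))
    by_cases hk : ℓ k p.1 = 0
    · simp [hk]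
    · have : t k = s k := h' k fun hp => hk ((hF k _ p.2).1 hp)
      simp [this])

/-- The phase at `k` is lost exactly where `ℓ k` vanishes, which is exactly the identification that
defines the manifold. -/
lemma bijective_toModel (h0 : ∀ x ∈ P, ∀ k, 0 ≤ ℓ k x)
    (hF : ∀ k, ∀ x ∈ P, x ∈ F k ↔ ℓ k x = 0) : Function.Bijective (toModel h0 hF) := by
  constructor
  · rintro ⟨t, p⟩ ⟨s, q⟩ h
    have h1 : p.1 = q.1 := congrArg (fun z => z.1.1) h
    have h2 : ∀ k, (t k : ℂ) * (ℓ k p.1 : ℂ) = (s k : ℂ) * (ℓ k q.1 : ℂ) := fun k =>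
      congrArg (fun z => z.1.2 k) h
    obtain rfl : p = q := Subtype.ext h1
    refine Quotient.sound ⟨rfl, fun k hk => ?_⟩
    have hne : (ℓ k p.1 : ℂ) ≠ 0 := by
      exact_mod_cast fun h => hk ((hF k _ p.2).2 h)
    exact Circle.ext (mul_right_cancel₀ hne (h2 k))
  · rintro ⟨⟨x, d⟩, hx, hd⟩
    have ht : ∀ k, ∃ t : Circle, (t : ℂ) * (ℓ k x : ℂ) = d k := by
      intro k
      have hn : ‖d k‖ = ℓ k x := hd k
      by_cases hk : d k = 0
      · refine ⟨1, ?_⟩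
        rw [hk, norm_zero] at hn
        simp [hk, ← hn]
      · refine ⟨⟨sgn (d k), mem_sphere_zero_iff_norm.2 (norm_sgn hk)⟩, ?_⟩
        rw [← hn]
        exact sgn_mul_norm _
    choose t ht using ht
    exact ⟨MomentAngleManifold.mk t ⟨x, hx⟩, Subtype.ext (Prod.ext rfl (funext ht))⟩

lemma continuous_toModel (h0 : ∀ x ∈ P, ∀ k, 0 ≤ ℓ k x)
    (hF : ∀ k, ∀ x ∈ P, x ∈ F k ↔ ℓ k x = 0) : Continuous (toModel h0 hF) := by
  refine Continuous.quotient_lift (Continuous.subtype_mk ?_ _) _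
  refine Continuous.prodMk (by fun_prop) (continuous_pi fun k => ?_)
  have h1 : Continuous fun a : (ι → Circle) × P => (a.1 k : ℂ) := by fun_prop
  have h2 : Continuous fun a : (ι → Circle) × P => ℓ k a.2.1 := by fun_prop
  exact h1.mul (Complex.continuous_ofReal.comp h2)

lemma compactSpace_momentAngleManifold (hP : IsCompact P) :
    CompactSpace (MomentAngleManifold P F) := by
  have := isCompact_iff_compactSpace.1 hP
  exact inferInstanceAs (CompactSpace (Quotient (momentAngleSetoid P F)))

/-- The moment-angle manifold is homeomorphic to its model. -/
def homeoModel (hP : IsCompact P) (h0 : ∀ x ∈ P, ∀ k, 0 ≤ ℓ k x)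
    (hF : ∀ k, ∀ x ∈ P, x ∈ F k ↔ ℓ k x = 0) : MomentAngleManifold P F ≃ₜ model P ℓ :=
  haveI := compactSpace_momentAngleManifold (F := F) hP
  Continuous.homeoOfEquivCompactToT2 (f := Equiv.ofBijective _ (bijective_toModel h0 hF))
    (continuous_toModel h0 hF)

namespace IsCentered

variable {K : Set (Finset ι)} (hP : IsCentered P ℓ K o)

lemma coord_le_one (x : P) (k : ι) : 0 ≤ 1 - hP.coord x k :=
  sub_nonneg.2 ((hP.coord_mem x).1 k).2

lemma norm_modelMap (z : model P ℓ) (k : ι) :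
    ‖sgn (z.1.2 k) * ((1 - hP.coord (model.fst z) k : ℝ) : ℂ)‖ = 1 - hP.coord (model.fst z) k := by
  refine norm_sgn_mul (hP.coord_le_one _ k) fun h => ?_
  rw [model_eq_zero_iff] at h
  rw [(hP.coord_eq_one_iff (model.fst z) k).2 h, sub_self]

/-- `(x, d) ↦ sgn d • (1 - coord x)`. -/
def modelMap (z : model P ℓ) : momentAngleComplex K :=
  ⟨fun k => sgn (z.1.2 k) * ((1 - hP.coord (model.fst z) k : ℝ) : ℂ), by
    obtain ⟨hI, σ, hσ, h⟩ := hP.coord_mem (model.fst z)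
    refine ⟨σ, hσ, fun k => ⟨fun _ => ?_, fun hk => ?_⟩⟩
    · rw [hP.norm_modelMap]
      linarith [(hI k).1]
    · rw [hP.norm_modelMap, h k hk, sub_zero]⟩

lemma continuous_modelMap : Continuous hP.modelMap := by
  refine Continuous.subtype_mk (continuous_pi fun k => ?_) _
  refine continuous_sgn_mul (model.continuous_snd k) ?_ fun z h => ?_
  · exact continuous_const.sub
      ((continuous_apply k).comp (hP.continuous_coord.comp model.continuous_fst))
  · rw [model_eq_zero_iff] at h
    rw [(hP.coord_eq_one_iff (model.fst z) k).2 h, sub_self]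

/-- The moduli of the image determine `coord`, hence the point of `P`, and the directions are lost
at the same places on both sides. The inverse uses the cubical coordinates `1 - ‖y k‖`. -/
lemma bijective_modelMap : Function.Bijective hP.modelMap := by
  constructor
  · intro z w h
    have hk : ∀ k, sgn (z.1.2 k) * ((1 - hP.coord (model.fst z) k : ℝ) : ℂ) =
        sgn (w.1.2 k) * ((1 - hP.coord (model.fst w) k : ℝ) : ℂ) := fun k =>
      congrFun (congrArg Subtype.val h) k
    have hc : hP.coord (model.fst z) = hP.coord (model.fst w) := by
      funext k
      have := congrArg norm (hk k)
      rw [hP.norm_modelMap, hP.norm_modelMap] at this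
      linarith
    have hx : z.1.1 = w.1.1 := by
      have h1 := hP.layer_coord (model.fst z)
      rw [hc, hP.layer_coord] at h1
      exact h1.symm
    refine Subtype.ext (Prod.ext hx (funext fun k => ?_))
    by_cases h0 : ℓ k z.1.1 = 0
    · rw [(model_eq_zero_iff z k).2 h0, (model_eq_zero_iff w k).2 (hx ▸ h0)]
    · have h1 : ((1 - hP.coord (model.fst z) k : ℝ) : ℂ) ≠ 0 := by
        have : hP.coord (model.fst z) k ≠ 1 := fun h => h0 ((hP.coord_eq_one_iff _ k).1 h)
        exact_mod_cast sub_ne_zero.2 this.symm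
      have h2 := hk k
      rw [← hc] at h2
      rw [← sgn_mul_norm (z.1.2 k), ← sgn_mul_norm (w.1.2 k), mul_right_cancel₀ h1 h2, z.2.2 k,
        w.2.2 k, hx]
  · rintro ⟨y, σ, hσ, h⟩
    have hle : ∀ k, ‖y k‖ ≤ 1 := fun k => by
      by_cases hk : k ∈ σ
      · exact (h k).1 hk
      · exact ((h k).2 hk).le
    have hu : (fun k => 1 - ‖y k‖) ∈ cube K :=
      ⟨fun k => ⟨sub_nonneg.2 (hle k), sub_le_self _ (norm_nonneg _)⟩, σ, hσ, fun k hk => by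
        simp [(h k).2 hk]⟩
    have hx := hP.layer_mem hu
    have hz : ∀ k, y k = 0 → ℓ k (layer o fun k => 1 - ‖y k‖) = 0 := fun k hk => by
      rw [hP.apply_layer_eq_zero_iff hu, hk, norm_zero, sub_zero]
    refine ⟨⟨(layer o fun k => 1 - ‖y k‖,
      fun k => sgn (y k) * (ℓ k (layer o fun k => 1 - ‖y k‖) : ℂ)), hx, fun k =>
        norm_sgn_mul (hP.nonneg _ hx k) (hz k)⟩, Subtype.ext (funext fun k => ?_)⟩
    have hc : hP.coord ⟨layer o fun k => 1 - ‖y k‖, hx⟩ = fun k => 1 - ‖y k‖ := hP.coord_layer hu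
    change sgn (sgn (y k) * (ℓ k (layer o fun k => 1 - ‖y k‖) : ℂ)) *
      ((1 - hP.coord ⟨layer o fun k => 1 - ‖y k‖, hx⟩ k : ℝ) : ℂ) = y k
    rw [hc, sub_sub_cancel, sgn_sgn_mul_mul (hP.nonneg _ hx k), sgn_mul_norm]
    rw [hP.apply_layer_eq_zero_iff hu]
    intro h1
    linarith

include hP in
lemma isCompact_model : IsCompact (model P ℓ) := by
  have hPc := hP.isCompact
  have hsub : CompactSpace (model P ℓ) :=
    haveI := compactSpace_momentAngleManifold (F := fun k => {x | x ∈ P ∧ ℓ k x = 0}) hPc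
    (homeoModel (F := fun k => {x | x ∈ P ∧ ℓ k x = 0}) hPc hP.nonneg
      fun k x hx => ⟨fun h => h.2, fun h => ⟨hx, h⟩⟩).compactSpace
  exact isCompact_iff_compactSpace.2 hsub

/-- The model is homeomorphic to the moment-angle-complex. -/
def homeoComplex : model P ℓ ≃ₜ momentAngleComplex K :=
  haveI := isCompact_iff_compactSpace.1 hP.isCompact_model
  Continuous.homeoOfEquivCompactToT2 (f := Equiv.ofBijective _ hP.bijective_modelMap)
    hP.continuous_modelMap

lemma homeoComplex_apply (z : model P ℓ) (k : ι) :
    (hP.homeoComplex z).1 k = sgn (z.1.2 k) * ((1 - hP.coord (model.fst z) k : ℝ) : ℂ) := rfl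

end IsCentered

/-- The canonical homeomorphism of a moment-angle manifold with the moment-angle-complex. -/
def canonicalHomeo (hP : IsCentered P ℓ (nerveComplex P F) o)
    (hF : ∀ k, ∀ x ∈ P, x ∈ F k ↔ ℓ k x = 0) :
    MomentAngleManifold P F ≃ₜ momentAngleComplex (nerveComplex P F) :=
  (homeoModel hP.isCompact hP.nonneg hF).trans hP.homeoComplex

lemma canonicalHomeo_mk (hP : IsCentered P ℓ (nerveComplex P F) o)
    (hF : ∀ k, ∀ x ∈ P, x ∈ F k ↔ ℓ k x = 0) (t : ι → Circle) (p : P) (k : ι) :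
    (canonicalHomeo hP hF (MomentAngleManifold.mk t p)).1 k =
      (t k : ℂ) * ((1 - hP.coord p k : ℝ) : ℂ) := by
  change sgn ((t k : ℂ) * (ℓ k p.1 : ℂ)) * ((1 - hP.coord p k : ℝ) : ℂ) = _
  have h := sgn_of_norm_eq_one (Circle.norm_coe (t k))
  conv_lhs => rw [← h]
  rw [sgn_sgn_mul_mul (hP.nonneg _ p.2 k), h]
  rw [← hP.coord_eq_one_iff p k]
  intro h1
  rw [h1, sub_self]

lemma isCanonicalForm_canonicalHomeo (hP : IsCentered P ℓ (nerveComplex P F) o)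
    (hF : ∀ k, ∀ x ∈ P, x ∈ F k ↔ ℓ k x = 0) : IsCanonicalForm (canonicalHomeo hP hF) :=
  ⟨fun p k => 1 - hP.coord p k, fun p k => ⟨hP.coord_le_one p k,
    sub_le_self _ ((hP.coord_mem p).1 k).1⟩, fun t p k => canonicalHomeo_mk hP hF t p k⟩

end Model

/-! ### A product neighbourhood of a face -/

section Collar

open Topology

variable {ι κ : Type} [Fintype ι] [DecidableEq ι] [Fintype κ] [DecidableEq κ]
variable {E : Type} [NormedAddCommGroup E] [NormedSpace ℝ E]

/-- The translate of `P'` by `v` is the face of `P` that is the intersection of the facets with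
labels in `σ`; the facets of this face are cut out by the facets of `P` with labels in the range of
`f`, it meets no other facets of `P`, and `f` embeds the nerve complex of `P'` as a full
subcomplex. -/
structure IsTransverseFace (P : Set E) (ℓ : κ → E →ᴬ[ℝ] ℝ) (K : Set (Finset κ))
    (o : Finset κ → E) (P' : Set E) (ℓ' : ι → E →ᴬ[ℝ] ℝ) (K' : Set (Finset ι))
    (o' : Finset ι → E) (v : E) (f : ι ↪ κ) (σ : Finset κ) : Prop where
  big : IsCentered P ℓ K o
  small : IsCentered P' ℓ' K' o'
  mem_iff : ∀ x, x ∈ P' ↔ v + x ∈ P ∧ ∀ k ∈ σ, ℓ k (v + x) = 0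
  apply_map : ∀ x ∈ P', ∀ i, ℓ (f i) (v + x) = ℓ' i x
  pos : ∀ x ∈ P', ∀ k ∉ σ, k ∉ Set.range f → 0 < ℓ k (v + x)
  full : ∀ τ : Finset ι, τ.map f ∈ K → τ ∈ K'

/-- The centres of the faces of the slice of `P` with distances `a` from the facets in `σ`. -/
def sliceCenter (ℓ : κ → E →ᴬ[ℝ] ℝ) (o : Finset κ → E) (o' : Finset ι → E) (v : E) (f : ι ↪ κ)
    (σ : Finset κ) (a : σ → ℝ) (τ : Finset ι) : E :=
  (v + o' τ) + ∑ U : σ, (a U / ℓ U (o ((σ ∪ τ.map f).erase U))) •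
    (o ((σ ∪ τ.map f).erase U) - (v + o' τ))

/-- The points of `P` with distances `a` from the facets in `σ`. -/
def slice (P : Set E) (ℓ : κ → E →ᴬ[ℝ] ℝ) (σ : Finset κ) (a : σ → ℝ) : Set E :=
  {x | x ∈ P ∧ ∀ U : σ, ℓ U x = a U}

/-- The points of `P` with distances at most `η` from the facets in `σ`. -/
def collar (P : Set E) (ℓ : κ → E →ᴬ[ℝ] ℝ) (σ : Finset κ) (η : ℝ) : Set E :=
  {x | x ∈ P ∧ ∀ U : σ, ℓ U x ≤ η}

lemma apply_add_sum {s : Type*} [Fintype s] (l : E →ᴬ[ℝ] ℝ) (x : E) (c : s → ℝ) (y : s → E) :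
    l (x + ∑ U, c U • (y U - x)) = l x + ∑ U, c U * (l (y U) - l x) := by
  have h : ∀ x, l x = l.contLinear x + l 0 := fun x => congrFun (ContinuousAffineMap.decomp l) x
  rw [h (x + _), h x]
  conv_rhs => enter [2, 2, U]; rw [h (y U)]
  simp only [map_add, map_sum, map_smul, map_sub, smul_eq_mul, add_sub_add_right_eq_sub]
  ring

namespace IsTransverseFace

variable {P : Set E} {ℓ : κ → E →ᴬ[ℝ] ℝ} {K : Set (Finset κ)} {o : Finset κ → E}
  {P' : Set E} {ℓ' : ι → E →ᴬ[ℝ] ℝ} {K' : Set (Finset ι)} {o' : Finset ι → E} {v : E} {f : ι ↪ κ}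
  {σ : Finset κ} (hT : IsTransverseFace P ℓ K o P' ℓ' K' o' v f σ)

section

include hT

/-- The centre of the face `P'` itself lies on every facet in `σ` and on no facet labelled by `f`.
-/
lemma notMem {τ : Finset ι} (hτ : τ ∈ K') (i : ι) : f i ∉ σ := by
  intro h
  have h0 := hT.small.mono hτ (Finset.empty_subset _)
  have hm := hT.small.center_mem _ h0
  have h1 := ((hT.mem_iff _).1 hm).2 _ h
  rw [hT.apply_map _ hm, hT.small.center_eq_zero_iff _ h0] at h1
  exact Finset.notMem_empty i h1

lemma base_mem {τ : Finset ι} (hτ : τ ∈ K') : v + o' τ ∈ P :=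
  ((hT.mem_iff _).1 (hT.small.center_mem _ hτ)).1

lemma apply_base_eq_zero_iff {τ : Finset ι} (hτ : τ ∈ K') (k : κ) :
    ℓ k (v + o' τ) = 0 ↔ k ∈ σ ∪ τ.map f := by
  have hm := hT.small.center_mem _ hτ
  by_cases hk : k ∈ σ
  · simp [hk, ((hT.mem_iff _).1 hm).2 k hk]
  by_cases hf : k ∈ Set.range f
  · obtain ⟨i, rfl⟩ := hf
    rw [hT.apply_map _ hm, hT.small.center_eq_zero_iff _ hτ]
    simp [hk]
  · have h1 := (hT.pos _ hm k hk hf).ne'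
    simp only [h1, false_iff, Finset.mem_union, hk, Finset.mem_map, false_or]
    rintro ⟨i, -, rfl⟩
    exact hf ⟨i, rfl⟩

lemma union_mem {τ : Finset ι} (hτ : τ ∈ K') : σ ∪ τ.map f ∈ K :=
  hT.big.mem_nerve _ (hT.base_mem hτ) _ fun k hk => (hT.apply_base_eq_zero_iff hτ k).2 hk

lemma map_mem {τ : Finset ι} (hτ : τ ∈ K') : τ.map f ∈ K :=
  hT.big.mono (hT.union_mem hτ) Finset.subset_union_right

lemma erase_mem {τ : Finset ι} (hτ : τ ∈ K') (U : κ) : (σ ∪ τ.map f).erase U ∈ K :=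
  hT.big.mono (hT.union_mem hτ) (Finset.erase_subset _ _)

lemma erase_pos {τ : Finset ι} (hτ : τ ∈ K') (U : κ) :
    0 < ℓ U (o ((σ ∪ τ.map f).erase U)) :=
  hT.big.center_pos (hT.erase_mem hτ U) (Finset.notMem_erase U _)

/-- The centre belonging to `(σ ∪ τ.map f).erase U` lies on every facet of this set except `U`.
Moving towards it therefore changes `ℓ U` but no other distance from a facet in `σ`, and the
coefficient is normalized to make that change `a U`. -/
lemma apply_sliceCenter (a : σ → ℝ) {τ : Finset ι} (hτ : τ ∈ K') (U : σ) :
    ℓ U (sliceCenter ℓ o o' v f σ a τ) = a U := by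
  rw [sliceCenter, apply_add_sum, (hT.apply_base_eq_zero_iff hτ U).2 (by simp),
    Finset.sum_eq_single U]
  · rw [sub_zero, zero_add, div_mul_cancel₀ _ (hT.erase_pos hτ U).ne']
  · intro W _ hW
    rw [(hT.big.center_eq_zero_iff _ (hT.erase_mem hτ W) U).2, sub_zero, mul_zero]
    simp [Finset.mem_erase, Subtype.coe_injective.ne hW.symm]
  · simp

/-- A positive number `η` that is small enough for the `η`-neighbourhood of the face to be a
product. -/
lemma exists_width : ∃ η : ℝ, 0 < η ∧
    (∀ x ∈ collar P ℓ σ η, ∀ k ∉ σ, k ∉ Set.range f → 0 < ℓ k x) ∧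
    ∀ τ ∈ K', ∑ U : σ, η / ℓ U (o ((σ ∪ τ.map f).erase U)) < 1 := by
  have h1 : ∀ k, ∀ᶠ η in 𝓝[>] (0 : ℝ), k ∉ σ → k ∉ Set.range f →
      ∀ x ∈ collar P ℓ σ η, 0 < ℓ k x := by
    intro k
    by_cases hk : k ∉ σ ∧ k ∉ Set.range f
    swap
    · exact Filter.Eventually.of_forall fun η h h' => absurd ⟨h, h'⟩ hk
    -- The total distance from the facets in `σ` is positive on the compact set `C`, because such a
    -- facet `k` misses the face. Hence it is at least some `δ > 0`, and any `η` with `|σ| η < δ`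
    -- separates the collar from `C`.
    set C : Set E := {x | x ∈ P ∧ ℓ k x = 0} with hCdef
    have hC : IsCompact C := hT.big.isCompact.inter_right
      (isClosed_eq (ℓ k).continuous continuous_const)
    have hcont : Continuous fun x => ∑ U : σ, ℓ U x :=
      continuous_finsetSum _ fun U _ => (ℓ U).continuous
    have hpos : ∀ x ∈ C, 0 < ∑ U : σ, ℓ U x := by
      rintro x ⟨hx, hx0⟩
      refine lt_of_le_of_ne (Finset.sum_nonneg fun U _ => hT.big.nonneg x hx U) fun h => ?_
      have h0 := (Finset.sum_eq_zero_iff_of_nonneg fun (U : σ) _ => hT.big.nonneg x hx U).1 h.symm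
      have hm : x - v ∈ P' := (hT.mem_iff _).2
        ⟨by simpa using hx, fun j hj => by simpa using h0 ⟨j, hj⟩ (Finset.mem_univ _)⟩
      have := hT.pos _ hm k hk.1 hk.2
      rw [add_sub_cancel, hx0] at this
      exact lt_irrefl _ this
    obtain ⟨δ, hδ, hδC⟩ : ∃ δ : ℝ, 0 < δ ∧ ∀ x ∈ C, δ ≤ ∑ U : σ, ℓ U x := by
      rcases C.eq_empty_or_nonempty with he | hne
      · exact ⟨1, one_pos, by simp [he]⟩
      · obtain ⟨x, hx, hmin⟩ := hC.exists_isMinOn hne hcont.continuousOn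
        exact ⟨_, hpos x hx, fun y hy => hmin hy⟩
    have hlim : Filter.Tendsto (fun η : ℝ => ∑ _U : σ, η) (𝓝 0) (𝓝 (∑ _U : σ, 0)) :=
      Continuous.tendsto (by fun_prop) 0
    have hlt : ∑ _U : σ, (0 : ℝ) < δ := by simpa using hδ
    filter_upwards [(hlim.eventually (gt_mem_nhds hlt)).filter_mono nhdsWithin_le_nhds]
      with η hη _ _ x hx
    refine lt_of_le_of_ne (hT.big.nonneg x hx.1 k) fun h => ?_
    have := hδC x ⟨hx.1, h.symm⟩
    exact absurd (this.trans (Finset.sum_le_sum fun U _ => hx.2 U)) (not_le.2 hη)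
  have h2 : ∀ τ : Finset ι, ∀ᶠ η in 𝓝[>] (0 : ℝ),
      ∑ U : σ, η / ℓ U (o ((σ ∪ τ.map f).erase U)) < 1 := by
    intro τ
    have hlim : Filter.Tendsto (fun η : ℝ => ∑ U : σ, η / ℓ U (o ((σ ∪ τ.map f).erase U))) (𝓝 0)
        (𝓝 (∑ U : σ, 0 / ℓ U (o ((σ ∪ τ.map f).erase U)))) :=
      Continuous.tendsto (continuous_finsetSum _ fun U _ => continuous_id.div_const _) 0
    exact (hlim.eventually (gt_mem_nhds (by simp))).filter_mono nhdsWithin_le_nhds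
  obtain ⟨η, ⟨hη1, hη2⟩, hη0⟩ := (((Filter.eventually_all.2 h1).and
    (Filter.eventually_all.2 h2)).and self_mem_nhdsWithin).exists
  exact ⟨η, hη0, fun x hx k hk hk' => hη1 k hk hk' x hx, fun τ _ => hη2 τ⟩

/-- The facets outside `σ` and the range of `f` do not reach the collar, so the `ℓ (f i)` alone cut
out the slice. The bound on the sum makes the slice centres convex combinations with positive weight
at the base point, which keeps them off the facets not in `τ`. -/
lemma isCentered_slice {η : ℝ}
    (hpos : ∀ x ∈ collar P ℓ σ η, ∀ k ∉ σ, k ∉ Set.range f → 0 < ℓ k x)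
    (hη : ∀ τ ∈ K', ∑ U : σ, η / ℓ U (o ((σ ∪ τ.map f).erase U)) < 1)
    {a : σ → ℝ} (ha : a ∈ Icc (0 : σ → ℝ) fun _ => η) :
    IsCentered (slice P ℓ σ a) (fun i => ℓ (f i)) K' (sliceCenter ℓ o o' v f σ a) where
  isCompact := by
    have : slice P ℓ σ a = P ∩ ⋂ U : σ, {x | ℓ U x = a U} := by
      ext x
      simp [slice]
    rw [this]
    exact hT.big.isCompact.inter_right
      (isClosed_iInter fun U => isClosed_eq (ℓ U).continuous continuous_const)
  convex := by
    rw [convex_iff_segment_subset]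
    rintro x ⟨hx, hxa⟩ y ⟨hy, hya⟩ z hz
    rw [segment_eq_image_lineMap] at hz
    obtain ⟨r, hr, rfl⟩ := hz
    refine ⟨hT.big.convex.lineMap_mem hx hy hr, fun U => ?_⟩
    rw [apply_lineMap, hxa, hya]
    ring
  nonneg x hx i := hT.big.nonneg x hx.1 (f i)
  lineMap_mem := by
    rintro x ⟨hx, hxa⟩ y ⟨hy, hya⟩ r hr
    set z := AffineMap.lineMap x y r with hz
    have hza : ∀ U : σ, ℓ U z = a U := by
      intro U
      rw [hz, apply_lineMap, hxa, hya]
      ring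
    refine ⟨hT.big.lineMap_mem x hx y hy r fun k => ?_, hza⟩
    by_contra! hneg
    -- Among the violated inequalities, `k₁` is the first to become an equality on the way from `x`
    -- to `z`. There the point still lies in the collar, where facets such as `k₁` are impossible.
    obtain ⟨k₁, hk₁, hmin⟩ := Finset.exists_min_image {k | ℓ k z < 0}
      (fun k => ℓ k x / (ℓ k x - ℓ k z)) ⟨k, Finset.mem_filter.2 ⟨Finset.mem_univ k, hneg⟩⟩
    simp only [Finset.mem_filter, Finset.mem_univ, true_and] at hk₁ hmin
    have hx₁ := hT.big.nonneg x hx k₁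
    set s := ℓ k₁ x / (ℓ k₁ x - ℓ k₁ z) with hs
    have hs0 : 0 ≤ s := div_nonneg hx₁ (by linarith)
    have hs1 : s ≤ 1 := (div_le_one (by linarith)).2 (by linarith)
    have hval : ∀ j, ℓ j (AffineMap.lineMap x z s) = (1 - s) * ℓ j x + s * ℓ j z :=
      fun j => apply_lineMap _ _ _ _
    have hmem : AffineMap.lineMap x z s ∈ P := by
      have he : AffineMap.lineMap x z s = AffineMap.lineMap x y (s * r) := by
        rw [hz, AffineMap.lineMap_lineMap_right]
      rw [he]
      refine hT.big.lineMap_mem x hx y hy _ fun j => ?_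
      rw [← he, hval]
      have hxj := hT.big.nonneg x hx j
      by_cases hj : ℓ j z < 0
      · have h1 := hmin j hj
        rw [le_div_iff₀ (by linarith)] at h1
        linarith
      · exact add_nonneg (mul_nonneg (by linarith) hxj) (mul_nonneg hs0 (not_lt.1 hj))
    have h0 : ℓ k₁ (AffineMap.lineMap x z s) = 0 := by
      have : s * (ℓ k₁ x - ℓ k₁ z) = ℓ k₁ x := div_mul_cancel₀ _ (by linarith)
      rw [hval]
      linarith
    refine (hpos (AffineMap.lineMap x z s) ⟨hmem, fun U => ?_⟩ k₁ (fun h => ?_) ?_).ne' h0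
    · rw [hval, hxa, hza]
      have := ha.2 U
      linarith
    · have := ha.1 ⟨k₁, h⟩
      rw [← hza] at this
      exact absurd hk₁ (not_lt.2 this)
    · rintro ⟨i, rfl⟩
      exact absurd hk₁ (not_lt.2 (hr i))
  mem_nerve x hx τ hτ := hT.full τ (hT.big.mem_nerve x hx.1 _ fun k hk => by
    obtain ⟨i, hi, rfl⟩ := Finset.mem_map.1 hk
    exact hτ i hi)
  center_mem τ hτ := by
    refine ⟨?_, fun U => hT.apply_sliceCenter a hτ U⟩
    set c : σ → ℝ := fun U => a U / ℓ U (o ((σ ∪ τ.map f).erase U)) with hc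
    have hc0 : ∀ U, 0 ≤ c U := fun U => div_nonneg (ha.1 U) (hT.erase_pos hτ U).le
    have hc1 : ∑ U, c U ≤ 1 := (Finset.sum_le_sum fun U _ =>
      div_le_div_of_nonneg_right (ha.2 U) (hT.erase_pos hτ U).le).trans (hη τ hτ).le
    have he : sliceCenter ℓ o o' v f σ a τ = ∑ w : Option σ,
        (w.elim (1 - ∑ U, c U) c) • (w.elim (v + o' τ) fun U => o ((σ ∪ τ.map f).erase U)) := by
      simp only [sliceCenter, Fintype.sum_option, Option.elim, sub_smul, one_smul, smul_sub,
        Finset.sum_sub_distrib, Finset.sum_smul]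
      abel
    rw [he]
    refine hT.big.convex.sum_mem (fun w _ => ?_) ?_ fun w _ => ?_
    · cases w with
      | none => exact sub_nonneg.2 hc1
      | some U => exact hc0 U
    · simp [Fintype.sum_option]
    · cases w with
      | none => exact hT.base_mem hτ
      | some U => exact hT.big.center_mem _ (hT.erase_mem hτ U)
  center_eq_zero_iff τ hτ i := by
    have hnot := hT.notMem hτ i
    have hb : ℓ (f i) (v + o' τ) = 0 ↔ i ∈ τ := by
      rw [hT.apply_base_eq_zero_iff hτ]
      simp [hnot]
    rw [sliceCenter, apply_add_sum]
    by_cases hi : i ∈ τ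
    · simp only [hi, iff_true, hb.2 hi, zero_add]
      refine Finset.sum_eq_zero fun U _ => ?_
      rw [(hT.big.center_eq_zero_iff _ (hT.erase_mem hτ U) (f i)).2, sub_zero, mul_zero]
      refine Finset.mem_erase.2 ⟨fun h => hnot (h ▸ U.2), by simp [hi]⟩
    · simp only [hi, iff_false]
      have hpos : 0 < ℓ (f i) (v + o' τ) :=
        lt_of_le_of_ne (hT.big.nonneg _ (hT.base_mem hτ) _) fun h => hi (hb.1 h.symm)
      set c : σ → ℝ := fun U => a U / ℓ U (o ((σ ∪ τ.map f).erase U)) with hc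
      have hc0 : ∀ U, 0 ≤ c U := fun U => div_nonneg (ha.1 U) (hT.erase_pos hτ U).le
      have hc1 : ∑ U, c U < 1 := (Finset.sum_le_sum fun U _ =>
        div_le_div_of_nonneg_right (ha.2 U) (hT.erase_pos hτ U).le).trans_lt (hη τ hτ)
      have h1 : -(∑ U, c U) * ℓ (f i) (v + o' τ) ≤ ∑ U, c U *
          (ℓ (f i) (o ((σ ∪ τ.map f).erase U)) - ℓ (f i) (v + o' τ)) := by
        rw [← Finset.sum_neg_distrib, Finset.sum_mul]
        refine Finset.sum_le_sum fun U _ => ?_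
        have := mul_nonneg (hc0 U)
          (hT.big.nonneg _ (hT.big.center_mem _ (hT.erase_mem hτ U)) (f i))
        linarith
      have h2 : 0 < (1 - ∑ U, c U) * ℓ (f i) (v + o' τ) := mul_pos (by linarith) hpos
      have h3 : 0 < ℓ (f i) (v + o' τ) + ∑ U, c U *
          (ℓ (f i) (o ((σ ∪ τ.map f).erase U)) - ℓ (f i) (v + o' τ)) := by linarith
      exact h3.ne'

end

end IsTransverseFace

end Collar

/-! ### Twisting the collar of a face -/

section Twist

open Topology

variable {ι κ : Type} [Fintype ι] [DecidableEq ι] [Fintype κ] [DecidableEq κ]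
variable {E : Type} [NormedAddCommGroup E] [NormedSpace ℝ E]

namespace IsTransverseFace

variable {P : Set E} {ℓ : κ → E →ᴬ[ℝ] ℝ} {K : Set (Finset κ)} {o : Finset κ → E}
  {P' : Set E} {ℓ' : ι → E →ᴬ[ℝ] ℝ} {K' : Set (Finset ι)} {o' : Finset ι → E} {v : E} {f : ι ↪ κ}
  {σ : Finset κ} {η : ℝ}

/-- The point of the collar with cubical coordinates `w.1` in the slice with distances `w.2` from
the facets in `σ`. -/
def chart (_ : IsTransverseFace P ℓ K o P' ℓ' K' o' v f σ) (w : (ι → ℝ) × (σ → ℝ)) : E :=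
  layer (sliceCenter ℓ o o' v f σ w.2) w.1

/-- The number `η` is small enough for the `η`-neighbourhood of the face to be a product. -/
structure IsWidth (_ : IsTransverseFace P ℓ K o P' ℓ' K' o' v f σ) (η : ℝ) : Prop where
  width_pos : 0 < η
  pos : ∀ x ∈ collar P ℓ σ η, ∀ k ∉ σ, k ∉ Set.range f → 0 < ℓ k x
  sum_lt : ∀ τ ∈ K', ∑ U : σ, η / ℓ U (o ((σ ∪ τ.map f).erase U)) < 1

variable {hT : IsTransverseFace P ℓ K o P' ℓ' K' o' v f σ}

lemma continuous_chart : Continuous hT.chart := by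
  refine continuous_finsetSum _ fun τ _ => ?_
  refine ((continuous_weight τ).comp continuous_fst).smul ?_
  refine continuous_const.add (continuous_finsetSum _ fun U _ => ?_)
  exact (((continuous_apply U).comp continuous_snd).div_const _).smul continuous_const

namespace IsWidth

variable (hη : hT.IsWidth η)
include hη

lemma centered {a : σ → ℝ} (ha : a ∈ Icc (0 : σ → ℝ) fun _ => η) :
    IsCentered (slice P ℓ σ a) (fun i => ℓ (f i)) K' (sliceCenter ℓ o o' v f σ a) :=
  hT.isCentered_slice hη.pos hη.sum_lt ha

lemma chart_mem {w : (ι → ℝ) × (σ → ℝ)} (h1 : w.1 ∈ cube K')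
    (h2 : w.2 ∈ Icc (0 : σ → ℝ) fun _ => η) : hT.chart w ∈ slice P ℓ σ w.2 :=
  (hη.centered h2).layer_mem h1

/-- The collar is fibred into slices by the distances from the facets in `σ`, and each slice is
parametrized by the same cubical complex. -/
lemma bijOn_chart : BijOn hT.chart (cube K' ×ˢ Icc (0 : σ → ℝ) fun _ => η) (collar P ℓ σ η) := by
  refine ⟨fun w hw => ?_, fun w hw w' hw' h => ?_, fun x hx => ?_⟩
  · have := hη.chart_mem hw.1 hw.2
    exact ⟨this.1, fun U => (this.2 U).trans_le (hw.2.2 U)⟩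
  · have h2 : w.2 = w'.2 := by
      funext U
      rw [← (hη.chart_mem hw.1 hw.2).2 U, ← (hη.chart_mem hw'.1 hw'.2).2 U, h]
    refine Prod.ext ((hη.centered hw.2).bijOn_layer.injOn hw.1 hw'.1 ?_) h2
    simpa only [chart, ← h2] using h
  · have ha : (fun U : σ => ℓ U x) ∈ Icc (0 : σ → ℝ) fun _ => η :=
      ⟨fun U => hT.big.nonneg x hx.1 U, hx.2⟩
    obtain ⟨u, hu, h⟩ := (hη.centered ha).bijOn_layer.surjOn ⟨hx.1, fun U => rfl⟩
    exact ⟨(u, fun U => ℓ U x), ⟨hu, ha⟩, h⟩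

/-- `chart` is a continuous bijection of a compact space onto a Hausdorff one. Outside the collar
the coordinate gets the junk value `0`. -/
lemma exists_coord : ∃ c : E → ι → ℝ, ContinuousOn c (collar P ℓ σ η) ∧
    (∀ x ∈ collar P ℓ σ η, c x ∈ cube K' ∧ hT.chart (c x, fun U => ℓ U x) = x) ∧
    ∀ u ∈ cube K', ∀ a ∈ Icc (0 : σ → ℝ) fun _ => η, c (hT.chart (u, a)) = u := by
  classical
  have hc : IsCompact (cube K' ×ˢ Icc (0 : σ → ℝ) fun _ => η) :=
    (isCompact_cube K').prod isCompact_Icc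
  have := isCompact_iff_compactSpace.1 hc
  let e : ↥(cube K' ×ˢ Icc (0 : σ → ℝ) fun _ => η) ≃ₜ collar P ℓ σ η :=
    Continuous.homeoOfEquivCompactToT2 (f := hη.bijOn_chart.equiv)
      ((continuous_chart.comp continuous_subtype_val).subtype_mk _)
  have he : ∀ w, (e w : E) = hT.chart w := fun w => rfl
  have hes : ∀ x (hx : x ∈ collar P ℓ σ η), hT.chart (e.symm ⟨x, hx⟩) = x := fun x hx => by
    rw [← he, e.apply_symm_apply]
  refine ⟨fun x => if h : x ∈ collar P ℓ σ η then (e.symm ⟨x, h⟩).1.1 else 0, ?_, ?_, ?_⟩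
  · rw [continuousOn_iff_continuous_domRestrict]
    have : Continuous fun x => (e.symm x).1.1 := by fun_prop
    refine this.congr fun x => ?_
    simp
  · intro x hx
    have hm := (e.symm ⟨x, hx⟩).2
    have h2 : (e.symm ⟨x, hx⟩).1.2 = fun U : σ => ℓ U x := by
      funext U
      rw [← (hη.chart_mem hm.1 hm.2).2 U, hes]
    simp only [hx, dif_pos]
    refine ⟨hm.1, ?_⟩
    rw [← h2]
    exact hes x hx
  · intro u hu a ha
    have hw : hT.chart (u, a) ∈ collar P ℓ σ η := hη.bijOn_chart.mapsTo ⟨hu, ha⟩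
    have : e.symm ⟨hT.chart (u, a), hw⟩ = ⟨(u, a), hu, ha⟩ := by
      rw [Homeomorph.symm_apply_eq]
      rfl
    simp [hw, this]

/-- The cubical coordinates of a point of the collar, in the slice that contains it. -/
def coord (hη : hT.IsWidth η) : E → ι → ℝ := hη.exists_coord.choose

lemma continuousOn_coord : ContinuousOn hη.coord (collar P ℓ σ η) :=
  hη.exists_coord.choose_spec.1

lemma coord_mem {x : E} (hx : x ∈ collar P ℓ σ η) : hη.coord x ∈ cube K' :=
  (hη.exists_coord.choose_spec.2.1 x hx).1

lemma chart_coord {x : E} (hx : x ∈ collar P ℓ σ η) :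
    hT.chart (hη.coord x, fun U => ℓ U x) = x :=
  (hη.exists_coord.choose_spec.2.1 x hx).2

lemma coord_chart {u : ι → ℝ} (hu : u ∈ cube K') {a : σ → ℝ}
    (ha : a ∈ Icc (0 : σ → ℝ) fun _ => η) : hη.coord (hT.chart (u, a)) = u :=
  hη.exists_coord.choose_spec.2.2 u hu a ha

lemma apply_chart_eq_zero_iff {u : ι → ℝ} (hu : u ∈ cube K') {a : σ → ℝ}
    (ha : a ∈ Icc (0 : σ → ℝ) fun _ => η) (i : ι) : ℓ (f i) (hT.chart (u, a)) = 0 ↔ u i = 1 :=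
  (hη.centered ha).apply_layer_eq_zero_iff hu i

/-- The facets outside of `σ` that contain a point of the collar depend on its cubical coordinates
only. -/
lemma apply_chart_coord_eq_zero_iff {x : E} (hx : x ∈ collar P ℓ σ η) {a : σ → ℝ}
    (ha : a ∈ Icc (0 : σ → ℝ) fun _ => η) {k : κ} (hk : k ∉ σ) :
    ℓ k (hT.chart (hη.coord x, a)) = 0 ↔ ℓ k x = 0 := by
  have hu := hη.coord_mem hx
  by_cases hf : k ∈ Set.range f
  · obtain ⟨i, rfl⟩ := hf
    rw [hη.apply_chart_eq_zero_iff hu ha]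
    conv_rhs => rw [← hη.chart_coord hx]
    rw [hη.apply_chart_eq_zero_iff hu ⟨fun U => hT.big.nonneg x hx.1 U, hx.2⟩]
  · have h1 := hη.pos _ (hη.bijOn_chart.mapsTo ⟨hu, ha⟩ : hT.chart (hη.coord x, a) ∈ _) k hk hf
    have h2 := hη.pos x hx k hk hf
    simp [h1.ne', h2.ne']

end IsWidth

/-- Self-maps of `ℂ^σ` that preserve the ball of radius `η` and fix all points outside of it. -/
structure IsSupported (η : ℝ) (φ : (σ → ℂ) → (σ → ℂ)) : Prop where
  norm_le : ∀ z, ‖z‖ ≤ η → ‖φ z‖ ≤ η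
  fix : ∀ z, η ≤ ‖z‖ → φ z = z

section Twist

variable (σ) in
/-- The coordinates of a point of the model at the facets in `σ`. -/
def normal (z : model P ℓ) : σ → ℂ := fun U => z.1.2 U

lemma continuous_normal : Continuous (normal σ : model P ℓ → σ → ℂ) := by
  unfold normal
  fun_prop

variable (hη : hT.IsWidth η)

include hη in
lemma norm_normal_le_iff (z : model P ℓ) : ‖normal σ z‖ ≤ η ↔ z.1.1 ∈ collar P ℓ σ η := by
  rw [pi_norm_le_iff_of_nonneg hη.width_pos.le]
  refine ⟨fun h => ⟨z.2.1, fun U => ?_⟩, fun h U => ?_⟩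
  · rw [← z.2.2 U]
    exact h U
  · exact (z.2.2 U).trans_le (h.2 U)

open Classical in
/-- The polytope coordinate of the image under a twist. -/
def twistFst (hη : hT.IsWidth η) (φ : (σ → ℂ) → (σ → ℂ)) (z : model P ℓ) : E :=
  if ‖normal σ z‖ ≤ η then hT.chart (hη.coord z.1.1, fun U => ‖φ (normal σ z) U‖) else z.1.1

variable {φ ψ : (σ → ℂ) → (σ → ℂ)}

include hη in
lemma norm_mem (hφ : IsSupported η φ) {d : σ → ℂ} (hd : ‖d‖ ≤ η) :
    (fun U => ‖φ d U‖) ∈ Icc (0 : σ → ℝ) fun _ => η :=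
  ⟨fun _ => norm_nonneg _, (pi_norm_le_iff_of_nonneg hη.width_pos.le).1 (hφ.norm_le d hd)⟩

lemma twistFst_mem (hφ : IsSupported η φ) (z : model P ℓ) : twistFst hη φ z ∈ P := by
  unfold twistFst
  split_ifs with h
  · exact (hη.chart_mem (hη.coord_mem ((norm_normal_le_iff hη z).1 h)) (norm_mem hη hφ h)).1
  · exact z.2.1

lemma apply_twistFst (hφ : IsSupported η φ) (z : model P ℓ) (U : σ) :
    ℓ U (twistFst hη φ z) = ‖φ (normal σ z) U‖ := by
  unfold twistFst
  split_ifs with h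
  · exact (hη.chart_mem (hη.coord_mem ((norm_normal_le_iff hη z).1 h)) (norm_mem hη hφ h)).2 U
  · rw [hφ.fix _ (not_le.1 h).le]
    exact (z.2.2 U).symm

/-- A twist preserves the cubical coordinates along the face, and these decide which facets outside
`σ` contain the point. -/
lemma apply_twistFst_eq_zero_iff (hφ : IsSupported η φ) (z : model P ℓ) {k : κ} (hk : k ∉ σ) :
    ℓ k (twistFst hη φ z) = 0 ↔ ℓ k z.1.1 = 0 := by
  unfold twistFst
  split_ifs with h
  · exact hη.apply_chart_coord_eq_zero_iff ((norm_normal_le_iff hη z).1 h) (norm_mem hη hφ h) hk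
  · exact Iff.rfl

/-- The self-map of the model that acts on the coordinates in `σ` by `φ`. -/
def twist (hη : hT.IsWidth η) (hφ : IsSupported η φ) (z : model P ℓ) : model P ℓ :=
  ⟨(twistFst hη φ z, fun k => if h : k ∈ σ then φ (normal σ z) ⟨k, h⟩ else
    sgn (z.1.2 k) * (ℓ k (twistFst hη φ z) : ℂ)), twistFst_mem hη hφ z, fun k => by
      dsimp only
      split_ifs with h
      · exact (apply_twistFst hη hφ z ⟨k, h⟩).symm
      -- Wherever the direction is undefined, the new modulus also vanishes.
      · refine norm_sgn_mul (hT.big.nonneg _ (twistFst_mem hη hφ z) k) fun h0 => ?_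
        rwa [apply_twistFst_eq_zero_iff hη hφ z h, ← model_eq_zero_iff]⟩

lemma normal_twist (hφ : IsSupported η φ) (z : model P ℓ) :
    normal σ (twist hη hφ z) = φ (normal σ z) := by
  funext U
  simp [normal, twist]

lemma twist_apply {k : κ} (hk : k ∉ σ) (hφ : IsSupported η φ) (z : model P ℓ) :
    (twist hη hφ z).1.2 k = sgn (z.1.2 k) * (ℓ k (twistFst hη φ z) : ℂ) := by
  simp [twist, hk]

lemma ext_normal {z w : model P ℓ} (h1 : z.1.1 = w.1.1) (h2 : normal σ z = normal σ w)
    (h3 : ∀ k ∉ σ, z.1.2 k = w.1.2 k) : z = w := by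
  refine Subtype.ext (Prod.ext h1 (funext fun k => ?_))
  by_cases hk : k ∈ σ
  · exact congrFun h2 ⟨k, hk⟩
  · exact h3 k hk

/-- Besides acting on the normal coordinates, a twist keeps the cubical coordinates along the face
and the phases at the other facets, so twists compose like the maps of `ℂ^σ`. -/
lemma twist_twist (hφ : IsSupported η φ) (hψ : IsSupported η ψ) {χ : (σ → ℂ) → (σ → ℂ)}
    (hχ : IsSupported η χ) (z : model P ℓ) (h : φ (ψ (normal σ z)) = χ (normal σ z)) :
    twist hη hφ (twist hη hψ z) = twist hη hχ z := by
  have hfst : twistFst hη φ (twist hη hψ z) = twistFst hη χ z := by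
    unfold twistFst
    by_cases hz : ‖normal σ z‖ ≤ η
    · rw [normal_twist, if_pos (hψ.norm_le _ hz), if_pos hz, h]
      have : (twist hη hψ z).1.1 = hT.chart (hη.coord z.1.1, fun U => ‖ψ (normal σ z) U‖) :=
        if_pos hz
      rw [this, hη.coord_chart (hη.coord_mem ((norm_normal_le_iff hη z).1 hz))
        (norm_mem hη hψ hz)]
    · have hfix := hψ.fix _ (not_le.1 hz).le
      rw [normal_twist, hfix, if_neg hz, if_neg hz]
      exact if_neg hz
  refine ext_normal hfst (by rw [normal_twist, normal_twist, normal_twist, h]) fun k hk => ?_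
  rw [twist_apply hη hk, twist_apply hη hk, twist_apply hη hk, hfst]
  refine sgn_sgn_mul_mul (hT.big.nonneg _ (twistFst_mem hη hψ z) k) fun h0 => ?_
  rw [apply_twistFst_eq_zero_iff hη hψ z hk] at h0
  rwa [apply_twistFst_eq_zero_iff hη hχ z hk]

lemma twist_eq_self (hφ : IsSupported η φ) (z : model P ℓ) (h : φ (normal σ z) = normal σ z) :
    twist hη hφ z = z := by
  have hfst : twistFst hη φ z = z.1.1 := by
    unfold twistFst
    split_ifs with hz
    · rw [h]
      have : (fun U => ‖normal σ z U‖) = fun U : σ => ℓ U z.1.1 := funext fun U => z.2.2 U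
      rw [this, hη.chart_coord ((norm_normal_le_iff hη z).1 hz)]
    · rfl
  refine ext_normal hfst (by rw [normal_twist, h]) fun k hk => ?_
  rw [twist_apply hη hk, hfst, ← z.2.2 k, sgn_mul_norm]

/-- A jointly continuous family of twists. -/
lemma continuous_twist {X : Type*} [TopologicalSpace X] {Φ : X → (σ → ℂ) → (σ → ℂ)}
    (hΦ : ∀ r, IsSupported η (Φ r)) (hc : Continuous fun p : X × (σ → ℂ) => Φ p.1 p.2) :
    Continuous fun p : X × model P ℓ => twist hη (hΦ p.1) p.2 := by
  have hn : Continuous fun p : X × model P ℓ => Φ p.1 (normal σ p.2) :=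
    hc.comp (continuous_fst.prodMk (continuous_normal.comp continuous_snd))
  have hfst : Continuous fun p : X × model P ℓ => twistFst hη (Φ p.1) p.2 := by
    unfold twistFst
    -- On the sphere of radius `η` the two branches agree, because supported maps fix it pointwise.
    refine continuous_if_le (continuous_normal.comp continuous_snd).norm continuous_const
      ?_ ?_ ?_
    · refine continuous_chart.comp_continuousOn (ContinuousOn.prodMk ?_ ?_)
      · refine hη.continuousOn_coord.comp (t := collar P ℓ σ η)
          (Continuous.continuousOn (by fun_prop)) fun p hp => ?_
        exact (norm_normal_le_iff hη p.2).1 hp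
      · exact (continuous_pi fun U => ((continuous_apply U).comp hn).norm).continuousOn
    · exact Continuous.continuousOn (by fun_prop)
    · intro p hp
      have := congrArg (fun w : model P ℓ => w.1.1)
        (twist_eq_self hη (hΦ p.1) p.2 ((hΦ p.1).fix _ hp.ge))
      exact (if_pos hp.le).symm.trans this
  refine Continuous.subtype_mk (hfst.prodMk (continuous_pi fun k => ?_)) _
  by_cases hk : k ∈ σ
  · simp only [hk, dif_pos]
    exact (continuous_apply _).comp hn
  · simp only [hk, dif_neg, not_false_eq_true]
    refine continuous_sgn_mul ((model.continuous_snd k).comp continuous_snd)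
      ((ℓ k).continuous.comp hfst) fun p hp => ?_
    have hp' : p.2.1.2 k = 0 := hp
    rw [model_eq_zero_iff] at hp'
    exact (apply_twistFst_eq_zero_iff hη (hΦ p.1) p.2 hk).2 hp'

end Twist

/-- The family of maps that pushes the centre of the ball of radius `η` towards `(η/2, …, η/2)`. -/
def push (η : ℝ) (r : unitInterval) (z : σ → ℂ) : σ → ℂ :=
  fun U => z U + ((r * (max 0 (η - ‖z‖) / 2) : ℝ) : ℂ)

lemma continuous_push (η : ℝ) :
    Continuous fun p : unitInterval × (σ → ℂ) => push η p.1 p.2 := by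
  refine continuous_pi fun U => ?_
  unfold push
  refine ((continuous_apply U).comp continuous_snd).add (Complex.continuous_ofReal.comp ?_)
  fun_prop

lemma isSupported_push (hη : 0 < η) (r : unitInterval) :
    IsSupported η (push (σ := σ) η r) := by
  refine ⟨fun z hz => ?_, fun z hz => ?_⟩
  · rw [pi_norm_le_iff_of_nonneg hη.le]
    intro U
    have h1 : max 0 (η - ‖z‖) = η - ‖z‖ := max_eq_right (by linarith)
    have h2 : 0 ≤ r * ((η - ‖z‖) / 2) := mul_nonneg r.2.1 (by linarith)
    have h3 : r * ((η - ‖z‖) / 2) ≤ (η - ‖z‖) / 2 :=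
      mul_le_of_le_one_left (by linarith) r.2.2
    refine (norm_add_le _ _).trans ?_
    rw [h1, Complex.norm_real, Real.norm_of_nonneg h2]
    linarith [norm_le_pi_norm z U]
  · funext U
    simp [push, max_eq_left (sub_nonpos.2 hz)]

lemma push_zero (z : σ → ℂ) : push η 0 z = z := by
  funext U
  simp [push]

/-- The push is the identity plus a map with Lipschitz constant `1/2`. This gives injectivity
directly, and surjectivity by Banach's fixed point theorem. -/
lemma bijective_push : Function.Bijective (push (σ := σ) η 1) := by
  have hlip : ∀ (w z z' : σ → ℂ), dist (fun U => w U - ((max 0 (η - ‖z‖) / 2 : ℝ) : ℂ))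
      (fun U => w U - ((max 0 (η - ‖z'‖) / 2 : ℝ) : ℂ)) ≤ (1 / 2 : ℝ) * dist z z' := by
    intro w z z'
    refine (dist_pi_le_iff (by positivity)).2 fun U => ?_
    have h1 := abs_max_sub_max_le_abs (η - ‖z‖) (η - ‖z'‖) 0
    rw [sub_sub_sub_cancel_left, max_comm _ 0, max_comm _ 0] at h1
    have h2 := abs_norm_sub_norm_le z' z
    rw [dist_eq_norm, sub_sub_sub_cancel_left, ← Complex.ofReal_sub, Complex.norm_real,
      Real.norm_eq_abs, ← sub_div, abs_div, abs_two, abs_sub_comm, dist_comm z, dist_eq_norm]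
    linarith
  have hpush : ∀ z : σ → ℂ, push η 1 z = fun U => z U + ((max 0 (η - ‖z‖) / 2 : ℝ) : ℂ) := by
    intro z
    funext U
    simp [push]
  constructor
  · intro z z' h
    have h1 : ∀ y : σ → ℂ, (fun U => push η 1 y U - ((max 0 (η - ‖y‖) / 2 : ℝ) : ℂ)) = y := by
      intro y
      simp [hpush]
    have h2 := hlip (push η 1 z) z z'
    rw [h1, h, h1] at h2
    have := dist_nonneg (x := z) (y := z')
    exact dist_le_zero.1 (by linarith)
  · intro w
    have hc : ContractingWith (1 / 2)
        (fun z : σ → ℂ => fun U => w U - ((max 0 (η - ‖z‖) / 2 : ℝ) : ℂ)) := by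
      refine ⟨by norm_num, LipschitzWith.of_dist_le_mul fun z z' => ?_⟩
      simpa using hlip w z z'
    refine ⟨hc.fixedPoint, ?_⟩
    have h := hc.fixedPoint_isFixedPt
    set z := hc.fixedPoint with hz
    rw [hpush]
    funext U
    have := congrFun h U
    simp only at this
    linear_combination -this

lemma exists_push_inverse : ∃ ψ : (σ → ℂ) → (σ → ℂ), (0 < η → IsSupported η ψ) ∧
    (∀ z, ψ (push η 1 z) = z) ∧ ∀ z, push η 1 (ψ z) = z := by
  let e := Equiv.ofBijective _ (bijective_push (σ := σ) (η := η))
  have h1 : ∀ z, e.symm (push η 1 z) = z := fun z => e.symm_apply_apply z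
  have h2 : ∀ z, push η 1 (e.symm z) = z := fun z => e.apply_symm_apply z
  refine ⟨e.symm, fun hη => ⟨fun z hz => ?_, fun z hz => ?_⟩, h1, h2⟩
  · by_contra! hlt
    have := h2 z
    rw [(isSupported_push hη 1).fix _ hlt.le] at this
    rw [this] at hlt
    linarith
  · conv_lhs => rw [← (isSupported_push hη 1).fix z hz]
    exact h1 z

/-- The self-homeomorphism of the model that pushes the face off the facets in `σ`. -/
def pushHomeo (hη : hT.IsWidth η) : model P ℓ ≃ₜ model P ℓ :=
  haveI := isCompact_iff_compactSpace.1 hT.big.isCompact_model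
  Continuous.homeoOfEquivCompactToT2
    (f := {
      toFun := twist hη (isSupported_push hη.width_pos 1)
      invFun := twist hη (exists_push_inverse.choose_spec.1 hη.width_pos)
      left_inv := fun z => by
        -- Both composites are compared with the twist by the push at time `0`, which is the
        -- identity.
        rw [twist_twist hη _ _ (isSupported_push hη.width_pos 0) z,
          twist_eq_self hη _ z (push_zero _)]
        rw [push_zero]
        exact exists_push_inverse.choose_spec.2.1 _
      right_inv := fun z => by
        rw [twist_twist hη _ _ (isSupported_push hη.width_pos 0) z,
          twist_eq_self hη _ z (push_zero _)]
        rw [push_zero]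
        exact exists_push_inverse.choose_spec.2.2 _ })
    ((continuous_twist hη (isSupported_push hη.width_pos) (continuous_push η)).comp
      (continuous_const.prodMk continuous_id))

lemma pushHomeo_apply (hη : hT.IsWidth η) (z : model P ℓ) :
    pushHomeo hη z = twist hη (isSupported_push hη.width_pos 1) z := rfl

end IsTransverseFace

end Twist

/-! ### The commutative square of a face -/

section Square

open Topology

variable {ι κ : Type} [Fintype ι] [DecidableEq ι] [Fintype κ] [DecidableEq κ]
variable {E : Type} [NormedAddCommGroup E] [NormedSpace ℝ E]

namespace IsTransverseFace

variable {P : Set E} {ℓ : κ → E →ᴬ[ℝ] ℝ} {K : Set (Finset κ)} {o : Finset κ → E}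
  {P' : Set E} {ℓ' : ι → E →ᴬ[ℝ] ℝ} {K' : Set (Finset ι)} {o' : Finset ι → E} {v : E} {f : ι ↪ κ}
  {σ : Finset κ} {η : ℝ}

open Classical in
/-- Centres of the faces of `P` such that the centres with labels in the range of `f` lie in the
slice with distances `η / 2` from the facets in `σ`. -/
def adjusted (_ : IsTransverseFace P ℓ K o P' ℓ' K' o' v f σ) (η : ℝ) (ρ : Finset κ) : E :=
  if h : ∃ τ ∈ K', τ.map f = ρ then sliceCenter ℓ o o' v f σ (fun _ => η / 2) h.choose else o ρ

variable {hT : IsTransverseFace P ℓ K o P' ℓ' K' o' v f σ}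

lemma adjusted_map {τ : Finset ι} (hτ : τ ∈ K') :
    hT.adjusted η (τ.map f) = sliceCenter ℓ o o' v f σ (fun _ => η / 2) τ := by
  have h : ∃ ρ ∈ K', ρ.map f = τ.map f := ⟨τ, hτ, rfl⟩
  have h2 : h.choose = τ := Finset.map_injective f h.choose_spec.2
  rw [adjusted, dif_pos h, h2]

lemma half_mem (hη : hT.IsWidth η) :
    (fun _ => η / 2) ∈ Icc (0 : σ → ℝ) fun _ => η := by
  have := hη.width_pos
  exact ⟨fun _ => by simp; linarith, fun _ => by simp; linarith⟩

/-- Any point on exactly the facets in `ρ` can serve as a centre. The slice at distance `η / 2`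
supplies such points, since it meets only facets labelled by `f`. -/
lemma isCentered_adjusted (hη : hT.IsWidth η) : IsCentered P ℓ K (hT.adjusted η) := by
  have hs := hη.centered (half_mem hη)
  refine { hT.big with center_mem := fun ρ hρ => ?_, center_eq_zero_iff := fun ρ hρ k => ?_ }
  · by_cases h : ∃ τ ∈ K', τ.map f = ρ
    · obtain ⟨τ, hτ, rfl⟩ := h
      rw [adjusted_map hτ]
      exact (hs.center_mem τ hτ).1
    · rw [adjusted, dif_neg h]
      exact hT.big.center_mem ρ hρ
  · by_cases h : ∃ τ ∈ K', τ.map f = ρ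
    · obtain ⟨τ, hτ, rfl⟩ := h
      rw [adjusted_map hτ]
      have hm := hs.center_mem τ hτ
      by_cases hk : k ∈ σ
      · have h1 : ℓ k _ = η / 2 := hm.2 ⟨k, hk⟩
        rw [h1]
        refine iff_of_false (half_pos hη.width_pos).ne' fun hkτ => ?_
        obtain ⟨i, -, rfl⟩ := Finset.mem_map.1 hkτ
        exact hT.notMem hτ i hk
      · by_cases hf : k ∈ Set.range f
        · obtain ⟨i, rfl⟩ := hf
          simpa using hs.center_eq_zero_iff τ hτ i
        · refine iff_of_false (hη.pos _ ⟨hm.1, fun U => ?_⟩ k hk hf).ne' fun hkτ => ?_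
          · exact (hm.2 U).trans_le ((half_mem hη).2 U)
          · obtain ⟨i, -, rfl⟩ := Finset.mem_map.1 hkτ
            exact hf ⟨i, rfl⟩
    · rw [adjusted, dif_neg h]
      exact hT.big.center_eq_zero_iff ρ hρ k

lemma extend_mem_cube (hT : IsTransverseFace P ℓ K o P' ℓ' K' o' v f σ) {u : ι → ℝ}
    (hu : u ∈ cube K') : Function.extend f u 0 ∈ cube K := by
  obtain ⟨hI, τ, hτ, h0⟩ := hu
  have key : ∀ k, (∃ i, f i = k ∧ Function.extend f u 0 k = u i) ∨
      (k ∉ Set.range f ∧ Function.extend f u 0 k = 0) := by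
    intro k
    by_cases hk : ∃ i, f i = k
    · obtain ⟨i, rfl⟩ := hk
      exact Or.inl ⟨i, rfl, f.injective.extend_apply _ _ _⟩
    · exact Or.inr ⟨hk, Function.extend_apply' _ _ _ hk⟩
  refine ⟨fun k => ?_, τ.map f, hT.map_mem hτ, fun k hk => ?_⟩
  · rcases key k with ⟨i, -, h⟩ | ⟨-, h⟩
    · exact h ▸ hI i
    · simp [h]
  · rcases key k with ⟨i, rfl, h⟩ | ⟨-, h⟩
    · rw [h, h0 i fun hi => hk (by simp [hi])]
    · exact h

lemma level_extend (u : ι → ℝ) {t : ℝ} (ht : 0 < t) :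
    level (Function.extend f u 0) t = (level u t).map f := by
  ext k
  by_cases hk : ∃ i, f i = k
  · obtain ⟨i, rfl⟩ := hk
    simp [f.injective.extend_apply]
  · rw [mem_level, Function.extend_apply' _ _ _ hk]
    refine iff_of_false (not_le.2 ht) fun h => hk ?_
    obtain ⟨i, -, h⟩ := Finset.mem_map.1 h
    exact ⟨i, h⟩

/-- This is the purpose of the adjusted centres: in the slice at distance `η / 2`, the coordinates
of `P` extend those of the slice by `0`. -/
lemma layer_adjusted {u : ι → ℝ} (hu : u ∈ cube K') :
    layer (hT.adjusted η) (Function.extend f u 0) = hT.chart (u, fun _ => η / 2) := by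
  rw [layer_of_level (fun τ => τ.map f) fun t ht => level_extend u ht.1]
  exact layer_congr fun t ht => adjusted_map (hT.small.level_mem hu ht.1)

/-- The slice at distance `0` is the face itself, with the translated centres of `P'`. -/
lemma coord_base (hη : hT.IsWidth η) (p : P') : hη.coord (v + p) = hT.small.coord p := by
  have h0 : (0 : σ → ℝ) ∈ Icc (0 : σ → ℝ) fun _ => η := ⟨le_rfl, fun _ => hη.width_pos.le⟩
  have h : hT.chart (hT.small.coord p, 0) = v + p := by
    have : sliceCenter ℓ o o' v f σ 0 = fun τ => v + o' τ := by
      funext τ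
      simp [sliceCenter]
    rw [chart, this, layer_const_add, hT.small.layer_coord]
  rw [← h, hη.coord_chart (hT.small.coord_mem p) h0]

variable {F : κ → Set E} {F' : ι → Set E}

/-- The canonical homeomorphism of the moment-angle manifold of a face, and a homeomorphism that is
homotopic to a canonical one, form a commutative square. -/
theorem exists_square {o : Finset κ → E} {o' : Finset ι → E}
    (hT : IsTransverseFace P ℓ (nerveComplex P F) o P' ℓ' (nerveComplex P' F') o' v f σ)
    (hF : ∀ k, ∀ x ∈ P, x ∈ F k ↔ ℓ k x = 0) (hF' : ∀ i, ∀ x ∈ P', x ∈ F' i ↔ ℓ' i x = 0)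
    (hv : IsFaceEmbedding P' F' P F v f) :
    ∃ (h₁ : MomentAngleManifold P' F' ≃ₜ momentAngleComplex (nerveComplex P' F'))
      (h₂ h₂' : MomentAngleManifold P F ≃ₜ momentAngleComplex (nerveComplex P F)),
      (∀ z, h₂ (momentAngleManifoldMap hv z) = momentAngleComplexMap f hv.map_mem (h₁ z)) ∧
      IsCanonicalForm h₁ ∧ IsCanonicalForm h₂' ∧
      ContinuousMap.Homotopic
        (h₂ : C(MomentAngleManifold P F, momentAngleComplex (nerveComplex P F)))
        (h₂' : C(MomentAngleManifold P F, momentAngleComplex (nerveComplex P F))) := by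
  obtain ⟨η, hη0, hη1, hη2⟩ := hT.exists_width
  have hη : hT.IsWidth η := ⟨hη0, hη1, hη2⟩
  have hA := isCentered_adjusted hη
  let m := homeoModel hT.big.isCompact hT.big.nonneg hF
  refine ⟨canonicalHomeo hT.small hF', (m.trans (pushHomeo hη)).trans hA.homeoComplex,
    canonicalHomeo hA hF, ?_, isCanonicalForm_canonicalHomeo _ _,
    isCanonicalForm_canonicalHomeo _ _, ContinuousMap.Homotopic.symm ⟨?_⟩⟩
  · rintro ⟨t, p⟩
    refine Subtype.ext (funext fun k => ?_)
    have hp := hv.mem p.2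
    have hu := hT.small.coord_mem p
    have hbase := (hT.mem_iff p).1 p.2
    let t' : κ → Circle := Function.extend f t 1
    let z : model P ℓ := m (MomentAngleManifold.mk t' ⟨v + p, hp⟩)
    have hzk : ∀ j, z.1.2 j = (t' j : ℂ) * (ℓ j (v + p) : ℂ) := fun j => rfl
    have hz0 : normal σ z = 0 := by
      funext U
      change (t' U : ℂ) * (ℓ U (v + p) : ℂ) = 0
      rw [hbase.2 U U.2, Complex.ofReal_zero, mul_zero]
    have hpush : push η 1 (0 : σ → ℂ) = fun _ => ((η / 2 : ℝ) : ℂ) := by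
      funext U
      simp [push, max_eq_right hη0.le]
    have hle : ‖normal σ z‖ ≤ η := by
      rw [hz0, norm_zero]
      exact hη0.le
    have hcol := (norm_normal_le_iff hη z).1 hle
    -- The normal coordinate `0` is pushed to the constant `η / 2`, so the point lands in the slice
    -- that contains the adjusted centres.
    have hfst : twistFst hη (push η 1) z =
        layer (hT.adjusted η) (Function.extend f (hT.small.coord p) 0) := by
      rw [layer_adjusted hu, twistFst, if_pos hle, hz0, hpush]
      have h1 : hη.coord z.1.1 = hT.small.coord p := coord_base hη p
      have h2 : (fun _ : σ => ‖((η / 2 : ℝ) : ℂ)‖) = fun _ => η / 2 := by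
        rw [Complex.norm_real, Real.norm_of_nonneg (by linarith)]
      rw [h1, h2]
    have hcoord : hA.coord (model.fst (pushHomeo hη z)) =
        Function.extend f (hT.small.coord p) 0 := by
      rw [← hA.coord_layer (hT.extend_mem_cube hu)]
      exact congrArg hA.coord (Subtype.ext hfst)
    change (hA.homeoComplex (pushHomeo hη z)).1 k =
      Function.extend f ((canonicalHomeo hT.small hF') (MomentAngleManifold.mk t p)).1 1 k
    rw [hA.homeoComplex_apply, hcoord, pushHomeo_apply]
    have hsupp := isSupported_push (σ := σ) hη0 1
    have hnn := hT.big.nonneg _ (twistFst_mem hη hsupp z)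
    by_cases hf : ∃ i, f i = k
    · obtain ⟨i, rfl⟩ := hf
      have hi : f i ∉ σ := hT.notMem (τ := ∅) (hT.small.mem_nerve _ p.2 ∅ (by simp)) i
      have hone : ∀ h0 : ℓ (f i) (v + p) = 0, 1 - hT.small.coord p i = 0 := fun h0 => by
        rw [hT.apply_map _ p.2, ← hT.small.coord_eq_one_iff p i] at h0
        rw [h0, sub_self]
      rw [f.injective.extend_apply, f.injective.extend_apply, canonicalHomeo_mk,
        twist_apply hη hi, sgn_sgn_mul_mul (hnn _), hzk]
      · have ht' : t' (f i) = t i := f.injective.extend_apply _ _ _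
        have h := sgn_of_norm_eq_one (Circle.norm_coe (t i))
        rw [ht']
        conv_lhs => rw [← h]
        rw [sgn_sgn_mul_mul (hT.big.nonneg _ hp _) hone, h]
      · intro h0
        rw [apply_twistFst_eq_zero_iff hη hsupp z hi] at h0
        exact hone h0
    · rw [Function.extend_apply' _ _ _ hf, Function.extend_apply' _ _ _ hf]
      simp only [Pi.zero_apply, sub_zero, Complex.ofReal_one, mul_one, Pi.one_apply]
      -- Outside the range of `f` the modulus is `1`. The phase is that of `η / 2 > 0` for `k ∈ σ`,
      -- and otherwise the phase `1` put there by the face map.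
      by_cases hk : k ∈ σ
      · have h1 : (twist hη hsupp z).1.2 k = ((η / 2 : ℝ) : ℂ) := by
          have := congrFun (normal_twist hη hsupp z) ⟨k, hk⟩
          rw [hz0, hpush] at this
          exact this
        rw [h1, ← one_mul ((η / 2 : ℝ) : ℂ), sgn_mul_pos _ (half_pos hη0)]
        exact sgn_of_norm_eq_one (by simp)
      · have h1 : 0 < ℓ k (v + p) := hT.pos p p.2 k hk hf
        have h2 : 0 < ℓ k (twistFst hη (push η 1) z) := by
          refine lt_of_le_of_ne (hnn k) fun h => h1.ne' ?_
          exact (apply_twistFst_eq_zero_iff hη hsupp z hk).1 h.symm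
        have ht' : t' k = 1 := Function.extend_apply' _ _ _ hf
        rw [twist_apply hη hk, sgn_mul_pos _ h2, sgn_sgn, hzk, sgn_mul_pos _ h1, ht']
        exact sgn_of_norm_eq_one (by simp)
  -- The homotopy runs through the twists by `push η r`, followed by the canonical homeomorphism.
  · have hc := continuous_twist hη (fun r => isSupported_push (σ := σ) hη0 r) (continuous_push η)
    have hm : Continuous fun q : unitInterval × MomentAngleManifold P F => (q.1, m q.2) :=
      continuous_fst.prodMk (m.continuous.comp continuous_snd)
    have hcm := hA.continuous_modelMap.comp (hc.comp hm)
    refine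
      { toFun := fun q => hA.homeoComplex (twist hη (isSupported_push hη0 q.1) (m q.2))
        continuous_toFun := hcm
        map_zero_left := fun z => ?_
        map_one_left := fun z => rfl }
    change hA.homeoComplex (twist hη (isSupported_push hη0 0) (m z)) = hA.homeoComplex (m z)
    exact congrArg hA.homeoComplex (twist_eq_self hη (isSupported_push hη0 0) (m z) (push_zero _))

/-- The labels of the facets of a face. -/
lemma facet_eq_iff (hF : ∀ k, F k = {x | x ∈ P ∧ ℓ k x = 0})
    (hF' : ∀ i, F' i = {x | x ∈ P' ∧ ℓ' i x = 0}) (hK' : ∀ i, {i} ∈ K')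
    (hT : IsTransverseFace P ℓ K o P' ℓ' K' o' v f σ) (i : ι) (k : κ) :
    (fun x => v + x) '' F' i = (fun x => v + x) '' P' ∩ F k ↔ k = f i := by
  have hmem : ∀ j, ∀ x ∈ P', v + x ∈ F (f j) ↔ x ∈ F' j := by
    intro j x hx
    rw [hF, hF']
    simp only [mem_ofPred_eq, hT.apply_map x hx, hx, ((hT.mem_iff x).1 hx).1]
  have hsub : ∀ x ∈ F' i, x ∈ P' := fun x hx => by
    rw [hF'] at hx
    exact hx.1
  have himg : ∀ x, v + x ∈ (fun x => v + x) '' F' i ↔ x ∈ F' i := fun x =>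
    ⟨fun ⟨y, hy, h⟩ => by rwa [← add_left_cancel h], fun h => ⟨x, h, rfl⟩⟩
  have hci : o' {i} ∈ F' i := by
    rw [hF']
    exact ⟨hT.small.center_mem _ (hK' i), (hT.small.center_eq_zero_iff _ (hK' i) i).2 (by simp)⟩
  constructor
  · intro h
    by_cases hk : k ∈ σ
    · have h0 := hT.small.mono (hK' i) (Finset.empty_subset _)
      have hm := hT.small.center_mem _ h0
      have h1 : v + o' ∅ ∈ (fun x => v + x) '' P' ∩ F k := by
        refine ⟨⟨_, hm, rfl⟩, ?_⟩
        rw [hF]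
        exact ⟨((hT.mem_iff _).1 hm).1, ((hT.mem_iff _).1 hm).2 k hk⟩
      rw [← h, himg, hF'] at h1
      exact absurd ((hT.small.center_eq_zero_iff _ h0 i).1 h1.2) (by simp)
    have h2 : v + o' {i} ∈ (fun x => v + x) '' P' ∩ F k := h ▸ (himg _).2 hci
    by_cases hf : k ∈ Set.range f
    · obtain ⟨j, rfl⟩ := hf
      have h3 := (hmem j _ (hsub _ hci)).1 h2.2
      rw [hF'] at h3
      have := (hT.small.center_eq_zero_iff _ (hK' i) j).1 h3.2
      rw [Finset.mem_singleton.1 this]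
    · have h3 := h2.2
      rw [hF] at h3
      exact absurd h3.2 (hT.pos _ (hsub _ hci) k hk hf).ne'
  · rintro rfl
    ext y
    constructor
    · rintro ⟨x, hx, rfl⟩
      exact ⟨⟨x, hsub x hx, rfl⟩, (hmem i x (hsub x hx)).2 hx⟩
    · rintro ⟨⟨x, hx, rfl⟩, hy⟩
      exact ⟨x, (hmem i x hx).1 hy, rfl⟩

end IsTransverseFace

end Square

/-! ### Retractions of moment-angle-complexes -/

section Retraction

/-- A retraction induces a splitting in cohomology. -/
theorem isSplitEpiInCohomology_of_comp_eq_id {X Y : Type v} [TopologicalSpace X]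
    [TopologicalSpace Y] (R : Type u) [CommRing R] (φ : C(X, Y)) (r : C(Y, X))
    (h : ∀ x, r (φ x) = x) : IsSplitEpiInCohomology R φ := by
  refine ⟨pullback R r, fun q x => ?_, pullback_one r, fun p q x y => pullback_cup r x y⟩
  obtain ⟨f, rfl⟩ := Submodule.Quotient.mk_surjective _ x
  refine congrArg Submodule.Quotient.mk (Subtype.ext (funext fun s => ?_))
  change f.1 (r.comp (φ.comp s)) = f.1 s
  exact congrArg f.1 (ContinuousMap.ext fun y => h (s y))

variable {ι κ : Type}

/-- The retraction of a moment-angle-complex to the one of a full subcomplex. -/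
def momentAngleComplexRetraction {K : Set (Finset ι)} {L : Set (Finset κ)} (f : ι ↪ κ)
    (hf : ∀ τ ∈ L, τ.preimage f f.injective.injOn ∈ K) (z : momentAngleComplex L) :
    momentAngleComplex K :=
  ⟨fun i => z.1 (f i), by
    obtain ⟨τ, hτ, hz⟩ := z.2
    exact ⟨_, hf τ hτ, fun i => by simpa using hz (f i)⟩⟩

theorem isSplitEpiInCohomology_of_square {E : Type} [AddCommGroup E] [Module ℝ E]
    [TopologicalSpace E] [ContinuousAdd E] {P Q : Set E} {F : ι → Set E} {G : κ → Set E} {v : E}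
    {f : ι ↪ κ} (hv : IsFaceEmbedding P F Q G v f)
    (hfull : ∀ τ ∈ nerveComplex Q G, τ.preimage f f.injective.injOn ∈ nerveComplex P F)
    (h₁ : MomentAngleManifold P F ≃ₜ momentAngleComplex (nerveComplex P F))
    (h₂ : MomentAngleManifold Q G ≃ₜ momentAngleComplex (nerveComplex Q G))
    (h : ∀ z, h₂ (momentAngleManifoldMap hv z) = momentAngleComplexMap f hv.map_mem (h₁ z))
    (R : Type u) [CommRing R] : IsSplitEpiInCohomology R (momentAngleManifoldMap hv) := by
  have hc : Continuous (momentAngleComplexRetraction f hfull) :=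
    continuous_induced_rng.2
      (continuous_pi fun i => (continuous_apply (f i)).comp continuous_subtype_val)
  refine isSplitEpiInCohomology_of_comp_eq_id R _
    ⟨fun z => h₁.symm (momentAngleComplexRetraction f hfull (h₂ z)),
      h₁.symm.continuous.comp (hc.comp h₂.continuous)⟩ fun x => ?_
  change h₁.symm (momentAngleComplexRetraction f hfull (h₂ (momentAngleManifoldMap hv x))) = x
  rw [h, Homeomorph.symm_apply_eq]
  refine Subtype.ext (funext fun i => ?_)
  exact f.injective.extend_apply _ _ _

end Retraction

/-! ### Nestohedra as centred polytopes -/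

section Nestohedron

variable {α : Type} [Fintype α] [DecidableEq α]

lemma mem_simplex_iff {U : Finset α} {x : α → ℝ} :
    x ∈ convexHull ℝ ((fun i => (Pi.single i 1 : α → ℝ)) '' (U : Set α)) ↔
      (∀ i, 0 ≤ x i) ∧ (∀ i ∉ U, x i = 0) ∧ ∑ i, x i = 1 := by
  constructor
  · intro hx
    refine convexHull_min (t := {x | (∀ i, 0 ≤ x i) ∧ (∀ i ∉ U, x i = 0) ∧ ∑ i, x i = 1}) ?_ ?_ hx
    · rintro _ ⟨j, hj, rfl⟩
      refine ⟨fun i => ?_, fun i hi => ?_, by simp⟩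
      · by_cases h : i = j
        · simp [h]
        · simp [h]
      · exact Pi.single_eq_of_ne (fun h : i = j => hi (by rwa [h])) _
    · rintro y ⟨h1, h2, h3⟩ z ⟨h1', h2', h3'⟩ a b ha hb hab
      refine ⟨fun i => ?_, fun i hi => ?_, ?_⟩
      · have := mul_nonneg ha (h1 i)
        have := mul_nonneg hb (h1' i)
        simp only [Pi.add_apply, Pi.smul_apply, smul_eq_mul]
        linarith
      · simp [h2 i hi, h2' i hi]
      · simp only [Pi.add_apply, Pi.smul_apply, smul_eq_mul, Finset.sum_add_distrib,
          ← Finset.mul_sum, h3, h3']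
        linarith
  · rintro ⟨h1, h2, h3⟩
    have hx : x = ∑ i ∈ U, x i • (Pi.single i 1 : α → ℝ) := by
      funext j
      simp only [Finset.sum_apply, Pi.smul_apply, Pi.single_apply, smul_eq_mul, mul_ite, mul_one,
        mul_zero, Finset.sum_ite_eq]
      split_ifs with hj
      · rfl
      · exact h2 j hj
    rw [hx]
    refine (convex_convexHull ℝ _).sum_mem (fun i _ => h1 i) ?_ fun i hi =>
      subset_convexHull ℝ _ ⟨i, hi, rfl⟩
    rw [← h3]
    exact Finset.sum_subset (Finset.subset_univ U) fun i _ hi => h2 i hi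

lemma single_mem_simplex {U : Finset α} {i : α} (hi : i ∈ U) :
    (Pi.single i 1 : α → ℝ) ∈
      convexHull ℝ ((fun i => (Pi.single i 1 : α → ℝ)) '' (U : Set α)) :=
  subset_convexHull ℝ _ ⟨i, hi, rfl⟩

/-- A point of a simplex has coordinate sum `1` over every set that contains the vertices. -/
lemma sum_simplex {U T : Finset α} {x : α → ℝ}
    (hx : x ∈ convexHull ℝ ((fun i => (Pi.single i 1 : α → ℝ)) '' (U : Set α))) (h : U ⊆ T) :
    ∑ i ∈ T, x i = 1 := by
  obtain ⟨-, h2, h3⟩ := mem_simplex_iff.1 hx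
  rw [← h3]
  exact Finset.sum_subset (Finset.subset_univ T) fun i _ hi => h2 i fun hU => hi (h hU)

lemma mem_nestohedron {B : Finset (Finset α)} {x : α → ℝ} :
    x ∈ nestohedron B ↔ ∃ g : Finset α → α → ℝ,
      (∀ U ∈ B, g U ∈ convexHull ℝ ((fun i => (Pi.single i 1 : α → ℝ)) '' (U : Set α))) ∧
      ∑ U ∈ B, g U = x := by
  rw [nestohedron, Set.mem_finsetSum]
  constructor
  · rintro ⟨g, hg, h⟩
    exact ⟨g, fun U hU => hg hU, h⟩
  · rintro ⟨g, hg, h⟩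
    exact ⟨g, fun {U} hU => hg U hU, h⟩

lemma convex_nestohedron (B : Finset (Finset α)) : Convex ℝ (nestohedron B) :=
  Finset.sum_induction _ (fun s : Set (α → ℝ) => Convex ℝ s) (fun _ _ h h' => h.add h')
    (convex_singleton 0) fun _ _ => convex_convexHull ℝ _

lemma isCompact_nestohedron (B : Finset (Finset α)) : IsCompact (nestohedron B) :=
  Finset.sum_induction _ (fun s : Set (α → ℝ) => IsCompact s) (fun _ _ h h' => h.add h')
    isCompact_singleton fun U _ => (U.finite_toSet.image _).isCompact_convexHull ℝ

@[simp] lemma mem_restrict {B : Finset (Finset α)} {T U : Finset α} :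
    U ∈ restrict B T ↔ U ∈ B ∧ U ⊆ T := Finset.mem_filter

/-! ### Description of a nestohedron by inequalities -/

/-- The distance functions of the facets of a nestohedron. -/
def slack (B : Finset (Finset α)) (T : Finset α) : (α → ℝ) →ᴬ[ℝ] ℝ :=
  (∑ i ∈ T, ContinuousLinearMap.proj (R := ℝ) (φ := fun _ : α => ℝ) i).toContinuousAffineMap -
    ContinuousAffineMap.const ℝ (α → ℝ) ((restrict B T).card : ℝ)

lemma slack_apply (B : Finset (Finset α)) (T : Finset α) (x : α → ℝ) :
    slack B T x = ∑ i ∈ T, x i - (restrict B T).card := by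
  simp [slack]

/-- Each simplex of the Minkowski sum makes its own contribution, non-negative by
`slack_term_nonneg`. A vanishing slack can therefore be tested summand by summand. -/
lemma slack_sum {B : Finset (Finset α)} (T : Finset α) (g : Finset α → α → ℝ) :
    slack B T (∑ U ∈ B, g U) = ∑ U ∈ B, (∑ i ∈ T, g U i - if U ⊆ T then 1 else 0) := by
  rw [slack_apply, Finset.sum_sub_distrib, restrict, Finset.card_filter]
  simp only [Finset.sum_apply]
  rw [Finset.sum_comm]
  push_cast
  rfl

lemma slack_term_nonneg {U T : Finset α} {x : α → ℝ}
    (hx : x ∈ convexHull ℝ ((fun i => (Pi.single i 1 : α → ℝ)) '' (U : Set α))) :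
    0 ≤ ∑ i ∈ T, x i - if U ⊆ T then (1 : ℝ) else 0 := by
  split_ifs with h
  · rw [sum_simplex hx h, sub_self]
  · rw [sub_zero]
    exact Finset.sum_nonneg fun i _ => (mem_simplex_iff.1 hx).1 i

lemma slack_nonneg {B : Finset (Finset α)} {x : α → ℝ} (hx : x ∈ nestohedron B) (T : Finset α) :
    0 ≤ slack B T x := by
  obtain ⟨g, hg, rfl⟩ := mem_nestohedron.1 hx
  rw [slack_sum]
  exact Finset.sum_nonneg fun U hU => slack_term_nonneg (hg U hU)

section Building

variable {V : Finset α} {B : Finset (Finset α)} (hB : IsBuildingSet V B)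
include hB

lemma restrict_self : restrict B V = B :=
  Finset.filter_true_of_mem hB.subset

lemma slack_self {x : α → ℝ} (hx : x ∈ nestohedron B) : slack B V x = 0 := by
  obtain ⟨g, hg, rfl⟩ := mem_nestohedron.1 hx
  rw [slack_sum]
  refine Finset.sum_eq_zero fun U hU => ?_
  rw [sum_simplex (hg U hU) (hB.subset U hU), if_pos (hB.subset U hU), sub_self]

lemma apply_eq_zero_of_notMem {x : α → ℝ} (hx : x ∈ nestohedron B) {i : α} (hi : i ∉ V) :
    x i = 0 := by
  obtain ⟨g, hg, rfl⟩ := mem_nestohedron.1 hx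
  rw [Finset.sum_apply]
  exact Finset.sum_eq_zero fun U hU =>
    (mem_simplex_iff.1 (hg U hU)).2.1 i fun h => hi (hB.subset U hU h)

/-- The inequalities for the elements of the building set imply those for all subsets. -/
lemma slack_nonneg_of_building {x : α → ℝ} (h0 : ∀ i ∉ V, x i = 0)
    (h : ∀ T ∈ B, 0 ≤ slack B T x) (T : Finset α) : 0 ≤ slack B T x := by
  induction T using Finset.strongInduction with
  | H T ih =>
    rcases (restrict B T).eq_empty_or_nonempty with he | hne
    · rw [slack_apply, he, Finset.card_empty, Nat.cast_zero, sub_zero]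
      refine (Finset.sum_eq_zero fun i hi => h0 i fun hV => ?_).ge
      have : {i} ∈ restrict B T := by simp [hB.singleton_mem i hV, hi]
      simp [he] at this
    · obtain ⟨C, hC, hmax⟩ := Finset.exists_max_image _ Finset.card hne
      rw [mem_restrict] at hC
      have h1 := h C hC.1
      have h2 := ih (T \ C) (Finset.sdiff_ssubset hC.2 (hB.nonempty C hC.1))
      have hcard : (restrict B T).card ≤ (restrict B (T \ C)).card + (restrict B C).card := by
        refine (Finset.card_le_card fun W hW => ?_).trans (Finset.card_union_le _ _)
        rw [Finset.mem_union, mem_restrict, mem_restrict]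
        rw [mem_restrict] at hW
        by_cases hWC : (W ∩ C).Nonempty
        · right
          have hu := hmax (W ∪ C) (by
            rw [mem_restrict]
            exact ⟨hB.union_mem W hW.1 C hC.1 hWC, Finset.union_subset hW.2 hC.2⟩)
          have := Finset.eq_of_subset_of_card_le Finset.subset_union_right hu
          exact ⟨hW.1, this ▸ Finset.subset_union_left⟩
        · left
          rw [Finset.not_nonempty_iff_eq_empty, ← Finset.disjoint_iff_inter_eq_empty] at hWC
          exact ⟨hW.1, Finset.subset_sdiff.2 ⟨hW.2, hWC⟩⟩
      have hcard' : ((restrict B T).card : ℝ) ≤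
          (restrict B (T \ C)).card + (restrict B C).card := by exact_mod_cast hcard
      rw [slack_apply] at h1 h2 ⊢
      rw [← Finset.sum_sdiff hC.2]
      linarith

omit hB in
/-- The greedy bound for linear functions with coefficients in `[0, 1]`. -/
lemma sum_min_le {x : α → ℝ} (h : ∀ T, 0 ≤ slack B T x) {y : α → ℝ}
    (hy : ∀ i, y i ∈ Icc (0 : ℝ) 1) (m : Finset α → α)
    (hm : ∀ T ∈ B, m T ∈ T ∧ ∀ i ∈ T, y (m T) ≤ y i) :
    ∑ T ∈ B, y (m T) ≤ ∑ i, x i * y i := by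
  have h1 : ∑ i, x i * y i = ∑ τ, weight τ y * ∑ i ∈ τ, x i := by
    have : ∀ i, x i * y i = ∑ τ, weight τ y * (if i ∈ τ then x i else 0) := by
      intro i
      rw [← sum_weight_mem (hy i), Finset.mul_sum]
      refine Finset.sum_congr rfl fun τ _ => ?_
      split_ifs <;> ring
    rw [Finset.sum_congr rfl fun i _ => this i, Finset.sum_comm]
    refine Finset.sum_congr rfl fun τ _ => ?_
    rw [← Finset.mul_sum, Finset.sum_ite_mem, Finset.univ_inter]
  have h2 : ∑ T ∈ B, y (m T) = ∑ τ, weight τ y * (restrict B τ).card := by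
    have : ∀ T ∈ B, y (m T) = ∑ τ, weight τ y * (if T ⊆ τ then 1 else 0) := by
      intro T hT
      rw [← sum_weight_mem (hy (m T))]
      refine Finset.sum_congr rfl fun τ _ => ?_
      by_cases hw : weight τ y = 0
      · simp [hw]
      · obtain ⟨t, -, rfl⟩ := exists_level_eq hw
        -- An upper level set contains `T` iff it contains a minimizer on `T`. Summing the minima
        -- thus counts the elements of `B` inside the level sets.
        have : m T ∈ level y t ↔ T ⊆ level y t :=
          ⟨fun hmt i hi => mem_level.2 ((mem_level.1 hmt).trans ((hm T hT).2 i hi)),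
            fun hT' => hT' (hm T hT).1⟩
        simp only [this]
    rw [Finset.sum_congr rfl this, Finset.sum_comm]
    refine Finset.sum_congr rfl fun τ _ => ?_
    rw [← Finset.mul_sum, restrict, Finset.card_filter]
    push_cast
    rfl
  rw [h1, h2]
  refine Finset.sum_le_sum fun τ _ => mul_le_mul_of_nonneg_left ?_ (weight_nonneg τ y)
  have := h τ
  rw [slack_apply] at this
  linarith

/-- The description of a nestohedron by inequalities. -/
theorem mem_nestohedron_iff {x : α → ℝ} : x ∈ nestohedron B ↔
    (∀ i ∉ V, x i = 0) ∧ slack B V x = 0 ∧ ∀ T ∈ B, 0 ≤ slack B T x := by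
  refine ⟨fun hx => ⟨fun i hi => apply_eq_zero_of_notMem hB hx hi, slack_self hB hx,
    fun T _ => slack_nonneg hx T⟩, ?_⟩
  rintro ⟨h0, hV, hT⟩
  by_contra hx
  obtain ⟨l, c, hlx, hl⟩ := geometric_hahn_banach_point_closed (convex_nestohedron B)
    (isCompact_nestohedron B).isClosed hx
  set y : α → ℝ := fun i => l (Pi.single i 1) with hy
  have hly : ∀ z, l z = ∑ i, z i * y i := by
    intro z
    have hz : z = ∑ i, z i • (Pi.single i 1 : α → ℝ) := by
      funext j
      simp [Finset.sum_apply, Pi.single_apply]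
    conv_lhs => rw [hz]
    simp [hy]
  set C : ℝ := 1 + ∑ i, |y i| with hC
  have hsum0 : 0 ≤ ∑ i, |y i| := Finset.sum_nonneg fun _ _ => abs_nonneg _
  have hC0 : 0 < C := by linarith
  have hyC : ∀ i, |y i| ≤ C := fun i =>
    (Finset.single_le_sum (f := fun i => |y i|) (fun _ _ => abs_nonneg _)
      (Finset.mem_univ i)).trans (by linarith)
  -- An affine change of the separating functional brings its coefficients into `[0, 1]`. The added
  -- constant does no harm, because `x` and the competing vertex have the same coordinate sum `|B|`.
  set w : α → ℝ := fun i => 1 / 2 + y i / (2 * C) with hw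
  have hwy : ∀ i, y i = 2 * C * w i - C := by
    intro i
    simp only [hw]
    field_simp
    ring
  have hwI : ∀ i, w i ∈ Icc (0 : ℝ) 1 := by
    intro i
    have h1 := abs_le.1 (hyC i)
    have h2 := hwy i
    constructor <;> by_contra! hlt <;> nlinarith
  have hmin : ∀ T : Finset α, ∃ i, T ∈ B → i ∈ T ∧ ∀ j ∈ T, w i ≤ w j := by
    intro T
    by_cases hTB : T ∈ B
    · obtain ⟨i, hi, h⟩ := Finset.exists_min_image T w (hB.nonempty T hTB)
      exact ⟨i, fun _ => ⟨hi, h⟩⟩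
    · have hne : ∃ i : α, True := by
        -- If `α` is empty, so is `B`, and `x` is the empty sum.
        by_contra! hn
        refine hx (mem_nestohedron.2 ⟨fun _ => 0, fun U hU => ?_, ?_⟩)
        · obtain ⟨i, -⟩ := hB.nonempty U hU
          exact (hn i).elim
        · funext i
          exact (hn i).elim
      exact ⟨hne.choose, fun h => absurd h hTB⟩
  choose m hm using hmin
  have hb : ∑ T ∈ B, (Pi.single (m T) 1 : α → ℝ) ∈ nestohedron B :=
    mem_nestohedron.2 ⟨fun T => Pi.single (m T) 1, fun T hTB => single_mem_simplex (hm T hTB).1,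
      rfl⟩
  have h1 := sum_min_le (slack_nonneg_of_building hB h0 hT) hwI m hm
  have h2 : l (∑ T ∈ B, (Pi.single (m T) 1 : α → ℝ)) = ∑ T ∈ B, y (m T) := by
    rw [map_sum]
  have h3 : ∑ i, x i = B.card := by
    rw [slack_apply, restrict_self hB] at hV
    rw [← Finset.sum_subset (Finset.subset_univ V) fun i _ hi => h0 i hi]
    linarith
  have h4 : l x = 2 * C * ∑ i, x i * w i - C * B.card := by
    rw [hly, ← h3, Finset.mul_sum, Finset.mul_sum, ← Finset.sum_sub_distrib]
    refine Finset.sum_congr rfl fun i _ => ?_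
    rw [hwy]
    ring
  have h5 : ∑ T ∈ B, y (m T) = 2 * C * ∑ T ∈ B, w (m T) - C * B.card := by
    simp only [hwy, Finset.sum_sub_distrib, ← Finset.mul_sum, Finset.sum_const, nsmul_eq_mul]
    ring
  have h6 := hl _ hb
  rw [h2, h5] at h6
  rw [h4] at hlx
  have := mul_le_mul_of_nonneg_left h1 (by linarith : 0 ≤ 2 * C)
  linarith

/-! ### Nested sets and the centres of the faces -/

omit hB in
/-- The function that counts the elements of `B` inside a set is supermodular, so the sets on which
a point of the nestohedron attains its bound are closed under unions. -/
lemma slack_union {x : α → ℝ} (hx : x ∈ nestohedron B) {A C : Finset α} (hA : slack B A x = 0)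
    (hC : slack B C x = 0) :
    slack B (A ∪ C) x = 0 ∧ ∀ W ∈ B, W ⊆ A ∪ C → W ⊆ A ∨ W ⊆ C := by
  have hsub : restrict B A ∪ restrict B C ⊆ restrict B (A ∪ C) := by
    intro W hW
    rw [Finset.mem_union, mem_restrict, mem_restrict] at hW
    rw [mem_restrict]
    rcases hW with h | h
    · exact ⟨h.1, h.2.trans Finset.subset_union_left⟩
    · exact ⟨h.1, h.2.trans Finset.subset_union_right⟩
  have hinter : restrict B A ∩ restrict B C = restrict B (A ∩ C) := by
    ext W
    simp only [Finset.mem_inter, mem_restrict, Finset.subset_inter_iff]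
    tauto
  have h1 := Finset.card_union_add_card_inter (restrict B A) (restrict B C)
  rw [hinter] at h1
  have h1' : ((restrict B A ∪ restrict B C).card : ℝ) + (restrict B (A ∩ C)).card =
      (restrict B A).card + (restrict B C).card := by exact_mod_cast h1
  have h2 := Finset.sum_union_inter (s₁ := A) (s₂ := C) (f := x)
  have h3 := slack_nonneg hx (A ∪ C)
  have h4 := slack_nonneg hx (A ∩ C)
  have h5 : ((restrict B A ∪ restrict B C).card : ℝ) ≤ (restrict B (A ∪ C)).card := by
    exact_mod_cast Finset.card_le_card hsub
  simp only [slack_apply] at hA hC h3 h4 ⊢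
  have h6 : (restrict B (A ∪ C)).card ≤ (restrict B A ∪ restrict B C).card := by
    have : ((restrict B (A ∪ C)).card : ℝ) ≤ (restrict B A ∪ restrict B C).card := by linarith
    exact_mod_cast this
  have h7 := Finset.eq_of_subset_of_card_le hsub h6
  refine ⟨by rw [← h7] at h3 ⊢; linarith, fun W hW hWs => ?_⟩
  have : W ∈ restrict B A ∪ restrict B C := by
    rw [h7, mem_restrict]
    exact ⟨hW, hWs⟩
  rw [Finset.mem_union, mem_restrict, mem_restrict] at this
  exact this.imp And.right And.right

/-- A set of subsets is nested if no element of `B` is contained in the union of some of these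
subsets unless it is contained in one of them. -/
def Nested (B σ : Finset (Finset α)) : Prop :=
  ∀ W ∈ B, ∀ τ ⊆ σ, W ⊆ τ.biUnion id → ∃ A ∈ τ, W ⊆ A

/-- Adding one set at a time, `slack_union` keeps the slack of the union zero and forces every
element of `B` inside it into one of its members. -/
lemma nested_of_slack_eq_zero {x : α → ℝ} (hx : x ∈ nestohedron B) {σ : Finset (Finset α)}
    (h : ∀ T ∈ σ, slack B T x = 0) : Nested B σ := by
  have key : ∀ τ : Finset (Finset α), τ ⊆ σ → slack B (τ.biUnion id) x = 0 ∧
      ∀ W ∈ B, W ⊆ τ.biUnion id → ∃ A ∈ τ, W ⊆ A := by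
    intro τ
    induction τ using Finset.induction_on with
    | empty =>
      intro _
      refine ⟨?_, fun W hW hWs => ?_⟩
      · have : restrict B ∅ = ∅ := by
          refine Finset.filter_false_of_mem fun T hT hs => ?_
          exact (hB.nonempty T hT).ne_empty (Finset.subset_empty.1 hs)
        simp [slack_apply, this]
      · exact absurd (Finset.subset_empty.1 hWs) (hB.nonempty W hW).ne_empty
    | insert A τ _ ih =>
      intro hs
      obtain ⟨ih1, ih2⟩ := ih fun T hT => hs (Finset.mem_insert_of_mem hT)
      obtain ⟨h1, h2⟩ := slack_union hx (h A (hs (Finset.mem_insert_self _ _))) ih1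
      rw [Finset.biUnion_insert]
      refine ⟨h1, fun W hW hWs => ?_⟩
      rcases h2 W hW hWs with h3 | h3
      · exact ⟨A, Finset.mem_insert_self _ _, h3⟩
      · obtain ⟨A', hA', h4⟩ := ih2 W hW h3
        exact ⟨A', Finset.mem_insert_of_mem hA', h4⟩
  exact fun W hW τ hτ hs => (key τ hτ).2 W hW hs

/-- The elements of `T` that lie in no element of `σ` that does not contain `T`. -/
def topPart (σ : Finset (Finset α)) (T : Finset α) : Finset α := {i ∈ T | ∀ A ∈ σ, i ∈ A → T ⊆ A}

/-- The centre of the face of the nestohedron that belongs to a nested set. -/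
def nestedCenter (B σ : Finset (Finset α)) : α → ℝ :=
  ∑ T ∈ B, fun i => if i ∈ topPart σ T then ((topPart σ T).card : ℝ)⁻¹ else 0

omit hB in
/-- An element of `B` is not covered by elements of a nested set that do not contain it. -/
lemma Nested.exists_notMem {σ : Finset (Finset α)} (hσ : Nested B σ) {U T : Finset α} (hU : U ∈ B)
    (h : ∀ A ∈ σ, U ⊆ A → T ⊆ A) : ∃ i ∈ U, ∀ A ∈ σ, i ∈ A → T ⊆ A := by
  by_contra! hn
  obtain ⟨A, hA, hUA⟩ := hσ U hU {A ∈ σ | ¬ T ⊆ A} (Finset.filter_subset _ _) fun i hi => by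
    obtain ⟨A, hA, hiA, hTA⟩ := hn i hi
    exact Finset.mem_biUnion.2 ⟨A, Finset.mem_filter.2 ⟨hA, hTA⟩, hiA⟩
  rw [Finset.mem_filter] at hA
  exact hA.2 (h A hA.1 hUA)

omit hB in
lemma Nested.topPart_mem {σ : Finset (Finset α)} (hσ : Nested B σ) {T : Finset α} (hT : T ∈ B) :
    (fun i => if i ∈ topPart σ T then ((topPart σ T).card : ℝ)⁻¹ else 0) ∈
      convexHull ℝ ((fun i => (Pi.single i 1 : α → ℝ)) '' (T : Set α)) := by
  obtain ⟨i, hi, h⟩ := hσ.exists_notMem hT fun A _ hA => hA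
  have hne : (topPart σ T).Nonempty := ⟨i, Finset.mem_filter.2 ⟨hi, h⟩⟩
  refine mem_simplex_iff.2 ⟨fun i => ?_, fun i hi => ?_, ?_⟩
  · split_ifs <;> positivity
  · exact if_neg fun h => hi (Finset.mem_filter.1 h).1
  · rw [Finset.sum_ite_mem, Finset.univ_inter, Finset.sum_const, nsmul_eq_mul,
      mul_inv_cancel₀ (by simpa using hne.ne_empty)]

omit hB in
lemma Nested.center_mem {σ : Finset (Finset α)} (hσ : Nested B σ) :
    nestedCenter B σ ∈ nestohedron B :=
  mem_nestohedron.2 ⟨_, fun _ hT => hσ.topPart_mem hT, rfl⟩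

/-- The summand of `T` is the mass that the uniform distribution on `topPart σ T` gives to `U`,
minus `1` if `T ⊆ U`. For `U ∈ σ`, the top part of any `T` not inside `U` avoids `U`. For `U ∉ σ`,
the smallest member of `σ ∪ {V}` containing `U` has positive mass on `U` without being contained in
it. -/
lemma Nested.slack_center_eq_zero_iff (hV : V ∈ B) {σ : Finset (Finset α)} (hσ : Nested B σ)
    (hσB : σ ⊆ B) {U : Finset α} (hU : U ∈ B) (hUV : U ≠ V) :
    slack B U (nestedCenter B σ) = 0 ↔ U ∈ σ := by
  rw [nestedCenter, slack_sum, Finset.sum_eq_zero_iff_of_nonneg fun T hT =>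
    slack_term_nonneg (hσ.topPart_mem hT)]
  constructor
  · intro h
    by_contra hUσ
    obtain ⟨T, hT, hmin⟩ := Finset.exists_min_image {A ∈ insert V σ | U ⊆ A} Finset.card
      ⟨V, by simp [hB.subset U hU]⟩
    rw [Finset.mem_filter, Finset.mem_insert] at hT
    have hTB : T ∈ B := by
      rcases hT.1 with rfl | hT
      exacts [hV, hσB hT]
    have hTU : ¬ T ⊆ U := by
      intro hs
      obtain rfl := Finset.Subset.antisymm hs hT.2
      rcases hT.1 with rfl | hT
      exacts [hUV rfl, hUσ hT]
    -- Two intersecting members of a nested set are comparable, since their union is in `B` and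
    -- hence lies in one of them; the minimal cardinality of `T` decides the direction.
    have hcover : ∀ A ∈ σ, U ⊆ A → T ⊆ A := by
      intro A hA hUA
      have hcard := hmin A (by simp [hA, hUA])
      suffices h : T ⊆ A ∨ A ⊆ T by
        rcases h with h | h
        · exact h
        · exact (Finset.eq_of_subset_of_card_le h hcard).symm.subset
      rcases hT.1 with rfl | hTσ
      · exact Or.inr (hB.subset A (hσB hA))
      · have hne : (T ∩ A).Nonempty := by
          obtain ⟨i, hi⟩ := hB.nonempty U hU
          exact ⟨i, Finset.mem_inter.2 ⟨hT.2 hi, hUA hi⟩⟩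
        obtain ⟨C, hC, hs⟩ := hσ _ (hB.union_mem T hTB A (hσB hA) hne) {T, A} (by
          intro C hC
          simp only [Finset.mem_insert, Finset.mem_singleton] at hC
          rcases hC with rfl | rfl
          exacts [hTσ, hA]) (by simp [Finset.biUnion_insert])
        simp only [Finset.mem_insert, Finset.mem_singleton] at hC
        rcases hC with rfl | rfl
        · exact Or.inr (Finset.subset_union_right.trans hs)
        · exact Or.inl (Finset.subset_union_left.trans hs)
    obtain ⟨i, hi, htop⟩ := hσ.exists_notMem hU hcover
    have hmem : i ∈ topPart σ T := Finset.mem_filter.2 ⟨hT.2 hi, htop⟩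
    have h0 := h T hTB
    rw [if_neg hTU, sub_zero, Finset.sum_eq_zero_iff_of_nonneg] at h0
    · have h1 := h0 i hi
      rw [if_pos hmem, inv_eq_zero, Nat.cast_eq_zero, Finset.card_eq_zero] at h1
      exact Finset.notMem_empty i (h1 ▸ hmem)
    · intro j _
      split_ifs <;> positivity
  · intro hUσ T hT
    by_cases hTU : T ⊆ U
    · rw [sum_simplex (hσ.topPart_mem hT) hTU, if_pos hTU, sub_self]
    · rw [if_neg hTU, sub_zero]
      refine Finset.sum_eq_zero fun i hi => if_neg fun h => hTU ?_
      exact (Finset.mem_filter.1 h).2 U hUσ hi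

omit hB in
lemma nested_singleton (hB : IsBuildingSet V B) (U : Finset α) : Nested B {U} := by
  intro W hW τ hτ hs
  rcases Finset.subset_singleton_iff.1 hτ with rfl | rfl
  · exact absurd (Finset.subset_empty.1 hs) (hB.nonempty W hW).ne_empty
  · exact ⟨U, by simp, by simpa using hs⟩

/-- The minimum of the coordinate sum over `T` is exactly `|B|_T|`, because the centre for `{T}`
attains it. -/
lemma facet_eq (hV : V ∈ B) (T : NonMax V B) :
    facet B T.1 = {x | x ∈ nestohedron B ∧ slack B T.1 x = 0} := by
  have hn := nested_singleton hB T.1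
  have h0 : slack B T.1 (nestedCenter B {T.1}) = 0 :=
    (Nested.slack_center_eq_zero_iff hB hV hn (by simp [T.2.1]) T.2.1 T.2.2).2 (by simp)
  ext x
  refine and_congr_right fun hx => ⟨fun h => ?_, fun h y hy => ?_⟩
  · have h1 := h _ hn.center_mem
    have h2 := slack_nonneg hx T.1
    rw [slack_apply] at h0 h2 ⊢
    linarith
  · have h1 := slack_nonneg hy T.1
    rw [slack_apply] at h h1
    linarith

/-- The labels of a set of facets. -/
def labels (σ : Finset (NonMax V B)) : Finset (Finset α) := σ.map (Function.Embedding.subtype _)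

omit hB in
@[simp] lemma mem_labels {σ : Finset (NonMax V B)} {T : NonMax V B} : T.1 ∈ labels σ ↔ T ∈ σ := by
  simp [labels, T.2]

omit hB in
lemma labels_subset (σ : Finset (NonMax V B)) : labels σ ⊆ B := by
  intro T hT
  obtain ⟨T, -, rfl⟩ := Finset.mem_map.1 hT
  exact T.2.1

lemma mem_nestedSetComplex_iff (hV : V ∈ B) (σ : Finset (NonMax V B)) :
    σ ∈ nestedSetComplex V B ↔ Nested B (labels σ) := by
  constructor
  · rintro ⟨x, hx, h⟩
    refine nested_of_slack_eq_zero hB hx fun T hT => ?_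
    obtain ⟨T, hTσ, rfl⟩ := Finset.mem_map.1 hT
    have := h T hTσ
    rw [facets, facet_eq hB hV] at this
    exact this.2
  · intro h
    refine ⟨nestedCenter B (labels σ), h.center_mem, fun T hT => ?_⟩
    rw [facets, facet_eq hB hV]
    exact ⟨h.center_mem, (Nested.slack_center_eq_zero_iff hB hV h (labels_subset σ) T.2.1 T.2.2).2
      (mem_labels.2 hT)⟩

lemma singleton_mem_nestedSetComplex (hV : V ∈ B) (T : NonMax V B) :
    {T} ∈ nestedSetComplex V B := by
  rw [mem_nestedSetComplex_iff hB hV]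
  exact nested_singleton hB T.1

/-- A nestohedron is centred. -/
theorem isCentered_nestohedron (hV : V ∈ B) :
    IsCentered (nestohedron B) (fun T : NonMax V B => slack B T.1) (nestedSetComplex V B)
      (fun σ => nestedCenter B (labels σ)) where
  isCompact := isCompact_nestohedron B
  convex := convex_nestohedron B
  nonneg x hx T := slack_nonneg hx T.1
  lineMap_mem x hx y hy r h := by
    rw [mem_nestohedron_iff hB] at hx hy ⊢
    have hVz : slack B V (AffineMap.lineMap x y r) = 0 := by
      rw [apply_lineMap, hx.2.1, hy.2.1]
      ring
    refine ⟨fun i hi => ?_, hVz, fun T hT => ?_⟩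
    · rw [AffineMap.lineMap_apply_module]
      simp [hx.1 i hi, hy.1 i hi]
    · by_cases hTV : T = V
      · rw [hTV, hVz]
      · exact h ⟨T, hT, hTV⟩
  mem_nerve x hx σ h := ⟨x, hx, fun T hT => by
    rw [facets, facet_eq hB hV]
    exact ⟨hx, h T hT⟩⟩
  center_mem σ hσ := ((mem_nestedSetComplex_iff hB hV σ).1 hσ).center_mem
  center_eq_zero_iff σ hσ T := by
    rw [Nested.slack_center_eq_zero_iff hB hV ((mem_nestedSetComplex_iff hB hV σ).1 hσ)
      (labels_subset σ) T.2.1 T.2.2, mem_labels]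

theorem bijOn_facet (hV : V ∈ B) :
    Set.BijOn (facet B) {T | T ∈ B ∧ T ≠ V} {G | IsFacet (nestohedron B) G} := by
  have hP := isCentered_nestohedron hB hV
  have hK := singleton_mem_nestedSetComplex hB hV
  refine ⟨fun T hT => ?_, fun T hT U hU h => ?_, fun G hG => ?_⟩
  · exact (hP.isFacet_iff hK _).2 ⟨⟨T, hT⟩, (facet_eq hB hV ⟨T, hT⟩).symm⟩
  · rw [facet_eq hB hV ⟨T, hT⟩, facet_eq hB hV ⟨U, hU⟩] at h
    have := hP.eq_of_zero_subset hK (i := ⟨T, hT⟩) (j := ⟨U, hU⟩) h.subset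
    exact Subtype.mk.inj this
  · obtain ⟨T, hT⟩ := (hP.isFacet_iff hK G).1 hG
    exact ⟨T.1, T.2, (facet_eq hB hV T).trans hT⟩

end Building

end Nestohedron

/-! ### Faces of nestohedra -/

section Faces

variable {α : Type} [Fintype α] [DecidableEq α]
variable {V S : Finset α} {B : Finset (Finset α)}

lemma IsBuildingSet.restrict (hB : IsBuildingSet V B) (hS : S ⊆ V) :
    IsBuildingSet S (restrict B S) where
  subset T hT := (mem_restrict.1 hT).2
  nonempty T hT := hB.nonempty T (mem_restrict.1 hT).1
  singleton_mem i hi := mem_restrict.2 ⟨hB.singleton_mem i (hS hi), by simpa using hi⟩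
  union_mem T hT U hU h := by
    rw [mem_restrict] at hT hU ⊢
    exact ⟨hB.union_mem T hT.1 U hU.1 h, Finset.union_subset hT.2 hU.2⟩

lemma slack_restrict {T : Finset α} (hT : T ⊆ S) : slack (restrict B S) T = slack B T := by
  have : restrict (restrict B S) T = restrict B T := by
    ext U
    simp only [mem_restrict]
    exact ⟨fun h => ⟨h.1.1, h.2⟩, fun h => ⟨⟨h.1, h.2.trans hT⟩, h.2⟩⟩
  ext x
  rw [slack_apply, slack_apply, this]

lemma labels_map_inclusion (hS : S ⊂ V) (σ : Finset (NonMax S (restrict B S))) :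
    labels (σ.map (inclusion B hS)) = labels σ := by
  rw [labels, Finset.map_map]
  rfl

/-- The inclusion of building sets makes the nested set complex of the restriction a full
subcomplex. -/
theorem mem_nestedSetComplex_restrict_iff (hB : IsBuildingSet V B) (hV : V ∈ B) (hSB : S ∈ B)
    (hS : S ⊂ V) (σ : Finset (NonMax S (restrict B S))) :
    σ ∈ nestedSetComplex S (restrict B S) ↔ σ.map (inclusion B hS) ∈ nestedSetComplex V B := by
  rw [mem_nestedSetComplex_iff (hB.restrict hS.subset)
    (mem_restrict.2 ⟨hSB, Finset.Subset.refl S⟩), mem_nestedSetComplex_iff hB hV,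
    labels_map_inclusion]
  refine ⟨fun h W hW τ hτ hs => ?_, fun h W hW => h W (mem_restrict.1 hW).1⟩
  -- A set covered by subsets of `S` lies in `S`, so nestedness does not see the elements of `B`
  -- outside the restriction.
  refine h W (mem_restrict.2 ⟨hW, hs.trans (Finset.biUnion_subset.2 fun A hA => ?_)⟩) τ hτ hs
  exact (mem_restrict.1 (labels_subset σ (hτ hA))).2

/-- A translate of the nestohedron of a restriction that is a face of the whole nestohedron. -/
theorem isTransverseFace_nestohedron (hB : IsBuildingSet V B) (hV : V ∈ B) (hSB : S ∈ B)
    (hS : S ⊂ V) {v : α → ℝ} (hv : IsFaceTranslation B S v) :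
    ∃ σ : Finset (NonMax V B), IsTransverseFace (nestohedron B) (fun T : NonMax V B => slack B T.1)
      (nestedSetComplex V B) (fun σ => nestedCenter B (labels σ)) (nestohedron (restrict B S))
      (fun T : NonMax S (restrict B S) => slack (restrict B S) T.1)
      (nestedSetComplex S (restrict B S)) (fun σ => nestedCenter (restrict B S) (labels σ)) v
      (inclusion B hS) σ := by
  classical
  have hBS := hB.restrict hS.subset
  have hSS : S ∈ restrict B S := mem_restrict.2 ⟨hSB, Finset.Subset.refl S⟩
  have hP := isCentered_nestohedron hB hV
  have hP' := isCentered_nestohedron hBS hSS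
  set G := (fun x => v + x) '' nestohedron (restrict B S) with hG
  have hGmem : ∀ x, v + x ∈ G ↔ x ∈ nestohedron (restrict B S) := fun x =>
    ⟨fun ⟨y, hy, h⟩ => by rwa [← add_left_cancel h], fun h => ⟨x, h, rfl⟩⟩
  have hne : G.Nonempty := by
    have hn : Nested (restrict B S) (labels (∅ : Finset (NonMax S (restrict B S)))) := by
      intro W hW τ hτ hs
      obtain rfl : τ = ∅ := by simpa [labels] using hτ
      exact absurd (Finset.subset_empty.1 hs) (hBS.nonempty W hW).ne_empty
    exact ⟨_, _, hn.center_mem, rfl⟩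
  have hGeq := hP.exposed_eq hv.2 hne
  have hsum : ∀ (T : Finset α) x, x ∈ nestohedron (restrict B S) →
      ∑ i ∈ T, (v + x) i = ∑ i ∈ T, v i + ∑ i ∈ T ∩ S, x i := by
    intro T x hx
    simp only [Pi.add_apply, Finset.sum_add_distrib]
    congr 1
    refine (Finset.sum_subset Finset.inter_subset_left fun i hi hn => ?_).symm
    exact apply_eq_zero_of_notMem hBS hx fun hiS => hn (Finset.mem_inter.2 ⟨hi, hiS⟩)
  have hsub : ∀ T ⊆ S, ∀ x ∈ nestohedron (restrict B S),
      slack B T (v + x) = slack (restrict B S) T x := by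
    intro T hT x hx
    rw [slack_restrict hT, slack_apply, slack_apply, hsum T x hx,
      Finset.sum_eq_zero fun i hi => hv.1 i (hT hi), zero_add, Finset.inter_eq_left.2 hT]
  -- The set `σ` consists of all facets containing the face; as an exposed face it is their
  -- intersection.
  refine ⟨Finset.univ.filter fun T : NonMax V B => ∀ y ∈ G, slack B T.1 y = 0, ?_⟩
  refine ⟨hP, hP', fun x => ?_, fun x hx T => ?_, fun x hx T hT hTr => ?_, fun τ hτ => ?_⟩
  · rw [← hGmem]
    refine (Set.ext_iff.1 hGeq (v + x)).trans (and_congr_right fun _ => ?_)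
    simp [hG]
  · exact hsub T.1 (mem_restrict.1 T.2.1).2 x hx
  · have hxP : v + x ∈ nestohedron B := hv.2.subset ⟨x, hx, rfl⟩
    have hSx : slack B S (v + x) = 0 := by
      rw [hsub S (Finset.Subset.refl S) x hx, slack_self hBS hx]
    refine lt_of_le_of_ne (slack_nonneg hxP T.1) fun h0 => ?_
    have hTS : ¬ T.1 ⊆ S := by
      intro hs
      by_cases he : T.1 = S
      · refine hT (Finset.mem_filter.2 ⟨Finset.mem_univ _, ?_⟩)
        rintro _ ⟨y, hy, rfl⟩
        rw [he, hsub S (Finset.Subset.refl S) y hy, slack_self hBS hy]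
      · exact hTr ⟨⟨T.1, mem_restrict.2 ⟨T.2.1, hs⟩, he⟩, rfl⟩
    -- If the coordinate sum over `T ∩ S` is constant on the small nestohedron, the slack of `T` is
    -- constant on the face. Being zero at one point, it vanishes throughout, which would put `T`
    -- into `σ`.
    have hconst : ∀ c : ℝ, (∀ y ∈ nestohedron (restrict B S), ∑ i ∈ T.1 ∩ S, y i = c) →
        False := by
      intro c hc
      refine hT (Finset.mem_filter.2 ⟨Finset.mem_univ _, ?_⟩)
      rintro _ ⟨y, hy, rfl⟩
      rw [slack_apply, hsum T.1 x hx, hc x hx] at h0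
      rw [slack_apply, hsum T.1 y hy, hc y hy]
      exact h0.symm
    by_cases hd : (T.1 ∩ S).Nonempty
    · have hu := hB.union_mem T.1 T.2.1 S hSB hd
      -- Both `T` and `S` have slack zero at this point, so `T ∪ S ∈ B` must lie in one of them.
      -- Since `T` is not inside `S`, this means `S ⊆ T`.
      rcases (slack_union hxP h0.symm hSx).2 _ hu (Finset.Subset.refl _) with h | h
      · have hST : T.1 ∩ S = S := Finset.inter_eq_right.2 (Finset.subset_union_right.trans h)
        refine hconst ((restrict (restrict B S) S).card) fun y hy => ?_
        have := slack_self hBS hy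
        rw [slack_apply] at this
        rw [hST]
        linarith
      · exact hTS (Finset.subset_union_left.trans h)
    · rw [Finset.not_nonempty_iff_eq_empty] at hd
      exact hconst 0 fun y _ => by simp [hd]
  · exact (mem_nestedSetComplex_restrict_iff hB hV hSB hS τ).2 hτ

/-! ### A linear function that exposes the face -/

lemma le_sum_mul_simplex {U : Finset α} {z y : α → ℝ} {m : ℝ}
    (hz : z ∈ convexHull ℝ ((fun i => (Pi.single i 1 : α → ℝ)) '' (U : Set α)))
    (hm : ∀ i ∈ U, m ≤ y i) : m ≤ ∑ i, y i * z i := by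
  obtain ⟨h1, h2, h3⟩ := mem_simplex_iff.1 hz
  have : m = ∑ i, m * z i := by rw [← Finset.mul_sum, h3, mul_one]
  rw [this]
  refine Finset.sum_le_sum fun i _ => ?_
  by_cases hi : i ∈ U
  · exact mul_le_mul_of_nonneg_right (hm i hi) (h1 i)
  · simp [h2 i hi]

lemma eq_single_of_sum_mul_le {U : Finset α} {z y : α → ℝ} {g : α}
    (hz : z ∈ convexHull ℝ ((fun i => (Pi.single i 1 : α → ℝ)) '' (U : Set α)))
    (hg : ∀ i ∈ U, i ≠ g → y g < y i) (h : ∑ i, y i * z i ≤ y g) : z = Pi.single g 1 := by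
  obtain ⟨h1, h2, h3⟩ := mem_simplex_iff.1 hz
  have hnn : ∀ i, 0 ≤ (y i - y g) * z i := by
    intro i
    by_cases hi : i ∈ U
    · by_cases hig : i = g
      · simp [hig]
      · exact mul_nonneg (sub_nonneg.2 (hg i hi hig).le) (h1 i)
    · simp [h2 i hi]
  have hle : ∑ i, (y i - y g) * z i ≤ 0 := by
    simp only [sub_mul, Finset.sum_sub_distrib, ← Finset.mul_sum, h3]
    linarith
  have h0 := (Finset.sum_eq_zero_iff_of_nonneg fun i _ => hnn i).1
    (le_antisymm hle (Finset.sum_nonneg fun i _ => hnn i))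
  have hz0 : ∀ i, i ≠ g → z i = 0 := by
    intro i hig
    by_cases hi : i ∈ U
    · exact (mul_eq_zero.1 (h0 i (Finset.mem_univ i))).resolve_left
        (sub_pos.2 (hg i hi hig)).ne'
    · exact h2 i hi
  have hzg : z g = 1 := by
    rw [← h3, Finset.sum_eq_single g (fun i _ => hz0 i) fun h => absurd (Finset.mem_univ g) h]
  funext i
  by_cases hig : i = g
  · simp [hig, hzg]
  · simp [hig, hz0 i hig]

/-- The nestohedron of a restriction is, up to translation, a face of the whole nestohedron. -/
theorem exists_isFaceTranslation (B : Finset (Finset α)) (hS : S.Nonempty) :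
    ∃ v, IsFaceTranslation B S v := by
  classical
  have : Nonempty α := ⟨hS.choose⟩
  set c : ℝ := (Fintype.card α : ℝ) with hc
  -- Minimization acts on each simplex separately. The constant weight on `S` leaves simplices
  -- inside `S` whole, while the distinct smaller weights elsewhere reduce every other simplex to a
  -- single vertex outside `S`.
  set w : α → ℝ := fun i => if i ∈ S then c else (Fintype.equivFin α i : ℕ) with hw
  have hwS : ∀ i ∈ S, w i = c := fun i hi => by simp [hw, hi]
  have hwlt : ∀ i ∉ S, w i < c := fun i hi => by
    simp only [hw, hi, if_false, hc]
    exact_mod_cast (Fintype.equivFin α i).2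
  have hwinj : ∀ i ∉ S, ∀ j ∉ S, w i = w j → i = j := by
    intro i hi j hj h
    simp only [hw, hi, hj, if_false] at h
    exact (Fintype.equivFin α).injective (Fin.ext (by exact_mod_cast h))
  have hg : ∀ U : Finset α, ¬ U ⊆ S → ∃ g, g ∈ U ∧ g ∉ S ∧ ∀ i ∈ U, i ≠ g → w g < w i := by
    intro U hU
    obtain ⟨i, hi⟩ : (U \ S).Nonempty := Finset.sdiff_nonempty.2 hU
    obtain ⟨g, hgU, hmin⟩ := Finset.exists_min_image (U \ S) w ⟨i, hi⟩
    rw [Finset.mem_sdiff] at hgU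
    refine ⟨g, hgU.1, hgU.2, fun j hj hjg => ?_⟩
    by_cases hjS : j ∈ S
    · rw [hwS j hjS]
      exact hwlt g hgU.2
    · refine lt_of_le_of_ne (hmin j (Finset.mem_sdiff.2 ⟨hj, hjS⟩)) fun h => hjg ?_
      exact (hwinj g hgU.2 j hjS h).symm
  choose! g hg using hg
  set v : α → ℝ := ∑ U ∈ B with ¬ U ⊆ S, Pi.single (g U) 1 with hv
  -- This is the minimum of the cost on the simplex of `U`; a point of the sum has minimal cost iff
  -- all its summands do.
  let m : Finset α → ℝ := fun U => if U ⊆ S then c else w (g U)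
  let cost : (α → ℝ) →L[ℝ] ℝ := ∑ i, w i • ContinuousLinearMap.proj (R := ℝ) i
  have hcost : ∀ z, cost z = ∑ i, w i * z i := fun z => by simp [cost]
  have hm : ∀ (U : Finset α) (z : α → ℝ), z ∈ convexHull ℝ ((fun i => (Pi.single i 1 : α → ℝ)) '' (U : Set α)) →
      m U ≤ cost z := by
    intro U z hz
    rw [hcost]
    refine le_sum_mul_simplex hz fun i hi => ?_
    by_cases hU : U ⊆ S
    · simp [m, hU, hwS i (hU hi)]
    · simp only [m, hU, if_false]
      by_cases hig : i = g U
      · rw [hig]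
      · exact ((hg U hU).2.2 i hi hig).le
  have hlow : ∀ x ∈ nestohedron B, ∑ U ∈ B, m U ≤ cost x := by
    intro x hx
    obtain ⟨h, hh, rfl⟩ := mem_nestohedron.1 hx
    rw [map_sum]
    exact Finset.sum_le_sum fun U hU => hm U _ (hh U hU)
  have hface : ∀ x, x ∈ (fun x => v + x) '' nestohedron (restrict B S) ↔
      x ∈ nestohedron B ∧ cost x ≤ ∑ U ∈ B, m U := by
    intro x
    constructor
    · rintro ⟨p, hp, rfl⟩
      obtain ⟨h, hh, rfl⟩ := mem_nestohedron.1 hp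
      have he : v + ∑ U ∈ restrict B S, h U =
          ∑ U ∈ B, if U ⊆ S then h U else Pi.single (g U) 1 := by
        rw [Finset.sum_ite, add_comm]
        rfl
      have hmem : ∀ U ∈ B, (if U ⊆ S then h U else Pi.single (g U) 1) ∈
          convexHull ℝ ((fun i => (Pi.single i 1 : α → ℝ)) '' (U : Set α)) := by
        intro U hU
        split_ifs with hUS
        · exact hh U (mem_restrict.2 ⟨hU, hUS⟩)
        · exact single_mem_simplex (hg U hUS).1
      refine ⟨mem_nestohedron.2 ⟨_, hmem, he.symm⟩, ?_⟩
      change cost (v + ∑ U ∈ restrict B S, h U) ≤ _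
      rw [he, map_sum]
      refine Finset.sum_le_sum fun U hU => ?_
      by_cases hUS : U ⊆ S
      · simp only [hUS, if_true, m]
        obtain ⟨-, h2, h3⟩ := mem_simplex_iff.1 (hh U (mem_restrict.2 ⟨hU, hUS⟩))
        have : ∀ i, w i * h U i = c * h U i := by
          intro i
          by_cases hi : i ∈ U
          · rw [hwS i (hUS hi)]
          · simp [h2 i hi]
        rw [hcost, Finset.sum_congr rfl fun i _ => this i, ← Finset.mul_sum, h3, mul_one]
      · simp [hUS, m, hcost, Pi.single_apply]
    · rintro ⟨hx, hle⟩
      obtain ⟨h, hh, rfl⟩ := mem_nestohedron.1 hx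
      have heq : ∀ U ∈ B, m U = cost (h U) := by
        refine (Finset.sum_eq_sum_iff_of_le fun U hU => hm U _ (hh U hU)).1 ?_
        rw [map_sum] at hle
        exact le_antisymm (Finset.sum_le_sum fun U hU => hm U _ (hh U hU)) hle
      refine ⟨∑ U ∈ restrict B S, h U,
        mem_nestohedron.2 ⟨h, fun W hW => hh W (mem_restrict.1 hW).1, rfl⟩, ?_⟩
      have hvh : v = ∑ U ∈ B with ¬ U ⊆ S, h U := by
        refine Finset.sum_congr rfl fun U hU => ?_
        rw [Finset.mem_filter] at hU
        refine (eq_single_of_sum_mul_le (hh U hU.1) (hg U hU.2).2.2 ?_).symm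
        rw [← hcost, ← heq U hU.1]
        simp [m, hU.2]
      change v + ∑ U ∈ restrict B S, h U = _
      rw [hvh, add_comm]
      exact Finset.sum_filter_add_sum_filter_not B _ _
  refine ⟨v, fun i hi => ?_, fun hne => ⟨-cost, ?_⟩⟩
  · rw [hv, Finset.sum_apply]
    refine Finset.sum_eq_zero fun U hU => Pi.single_eq_of_ne ?_ _
    rintro rfl
    exact (hg U (Finset.mem_filter.1 hU).2).2.1 hi
  · obtain ⟨z, hz⟩ := hne
    ext x
    rw [hface]
    refine and_congr_right fun hx => ⟨fun h y hy => ?_, fun h => ?_⟩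
    · exact neg_le_neg (h.trans (hlow y hy))
    · have := h z ((hface z).1 hz).1
      exact (neg_le_neg_iff.1 this).trans ((hface z).1 hz).2

end Faces

end NestoMA

end

open NestoMA in
theorem proposition4p10 {n : ℕ} (B : Finset (Finset (Fin (n + 1))))
    (hB : IsBuildingSet Finset.univ B) (hconn : Finset.univ ∈ B)
    (S : Finset (Fin (n + 1))) (hSB : S ∈ B) (hS : S ⊂ Finset.univ) :
    -- the facets of the two nestohedra are labelled by the non-maximal elements
    Set.BijOn (facet B) {T | T ∈ B ∧ T ≠ Finset.univ} {G | IsFacet (nestohedron B) G} ∧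
    Set.BijOn (facet (restrict B S)) {T | T ∈ restrict B S ∧ T ≠ S}
      {G | IsFacet (nestohedron (restrict B S)) G} ∧
    -- the inclusion of building sets makes `N_{B|_S}` a full subcomplex of `N_B`
    (∀ σ : Finset (NonMax S (restrict B S)),
      σ ∈ nestedSetComplex S (restrict B S) ↔
        σ.map (inclusion B hS) ∈ nestedSetComplex Finset.univ B) ∧
    -- `P_{B|_S}` is a face of `P_B`
    (∃ v, IsFaceTranslation B S v) ∧
    ∀ v, IsFaceTranslation B S v →
      ∃ hv : IsFaceEmbedding (nestohedron (restrict B S)) (facets S (restrict B S))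
          (nestohedron B) (facets Finset.univ B) v (inclusion B hS),
        -- the commutative square
        (∃ (h₁ : ZP S (restrict B S) ≃ₜ ZN S (restrict B S))
            (h₂ h₂' : ZP Finset.univ B ≃ₜ ZN Finset.univ B),
          (∀ z, h₂ (momentAngleManifoldMap hv z) =
            momentAngleComplexMap (inclusion B hS) hv.map_mem (h₁ z)) ∧
          IsCanonicalForm h₁ ∧ IsCanonicalForm h₂' ∧
          ContinuousMap.Homotopic (h₂ : C(ZP Finset.univ B, ZN Finset.univ B))
            (h₂' : C(ZP Finset.univ B, ZN Finset.univ B))) ∧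
        -- the split epimorphism in cohomology
        ∀ (R : Type*) [CommRing R], IsSplitEpiInCohomology R (momentAngleManifoldMap hv) := by
  have hSS : S ∈ restrict B S := mem_restrict.2 ⟨hSB, Finset.Subset.refl S⟩
  have hBS := hB.restrict hS.subset
  have hfull := mem_nestedSetComplex_restrict_iff hB hconn hSB hS
  refine ⟨bijOn_facet hB hconn, bijOn_facet hBS hSS, hfull,
    exists_isFaceTranslation B (hB.nonempty S hSB), fun v hv => ?_⟩
  obtain ⟨σ, hT⟩ := isTransverseFace_nestohedron hB hconn hSB hS hv
  have hF := facet_eq hB hconn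
  have hF' := facet_eq hBS hSS
  have hemb : IsFaceEmbedding (nestohedron (restrict B S)) (facets S (restrict B S))
      (nestohedron B) (facets Finset.univ B) v (inclusion B hS) :=
    ⟨hv.2, hT.facet_eq_iff hF hF' (singleton_mem_nestedSetComplex hBS hSS)⟩
  have hmem : ∀ (T : NonMax Finset.univ B), ∀ x ∈ nestohedron B,
      x ∈ facets Finset.univ B T ↔ slack B T.1 x = 0 := fun T x hx => by
    rw [facets, hF]
    exact and_iff_right hx
  have hmem' : ∀ (T : NonMax S (restrict B S)), ∀ x ∈ nestohedron (restrict B S),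
      x ∈ facets S (restrict B S) T ↔ slack (restrict B S) T.1 x = 0 := fun T x hx => by
    rw [facets, hF']
    exact and_iff_right hx
  obtain ⟨h₁, h₂, h₂', hsq, hc₁, hc₂, hh⟩ := hT.exists_square hmem hmem' hemb
  refine ⟨hemb, ⟨h₁, h₂, h₂', hsq, hc₁, hc₂, hh⟩, fun R _ => ?_⟩
  refine isSplitEpiInCohomology_of_square hemb (fun τ hτ => ?_) h₁ h₂ hsq R
  -- The labels of `τ` that lie in `B|_S` form a subset of `τ`, hence a simplex of the full
  -- subcomplex.
  refine (hfull _).2 ((isCentered_nestohedron hB hconn).mono hτ ?_)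
  exact Finset.map_subset_iff_subset_preimage.2 (Finset.Subset.refl _)
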